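/- Let $\mathfrak g$ be the Lie algebra of a compact semisimple Lie group, with generators $t^a$ satisfying $[t^a,t^b]=f^{abc}t^c$ and $\mathrm{tr}(t^at^b)=-2\delta^{ab}$, where $\mathrm{tr}$ is the Killing form. Let $(M,g)$ be a smooth Riemannian manifold of dimension $d$ and let $U\subset M$ be a convex open domain: any two points of $U$ are joined by exactly one geodesic in $U$ (up to affine reparameterization), and this geodesic depends smoothly on its end points. Fix coordinates on $U$ (Greek indices; repeated indices are summed), with Christoffel symbols $\Gamma^\rho_{\mu\nu}$, and let $B_\mu=B^a_\mu t^a\in C^\infty(U,\mathfrak g)$ be the components of a Yang--Mills connection, with adjoint matrices $(A_\mu)^{ab}=f^{adb}B_\mu^d$. For a matrix-valued covariant tensor field $h_{\nu_1\ldots\nu_n}$, with Levi-Civita derivative $\nabla_\rho h_{\nu_1\ldots\nu_n}=\partial_\rho h_{\nu_1\ldots\nu_n}-\sum_i\Gamma^\alpha_{\rho\nu_i}h_{\nu_1\ldots\alpha\ldots\nu_n}$, put $$\overrightarrow D_\rho h=\nabla_\rho h+A_\rho h,\qquad h\overleftarrow D_\rho=\nabla_\rho h-hA_\rho .$$ For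 $x,y\in U$ let $\gamma:[u_0,u_1]\to U$ be the geodesic with $\gamma(u_0)=y$, $\gamma(u_1)=x$, and let $$\Phi(x,y)=1+\sum_{k\ge1}(-1)^k\int_{u_0}^{u_1}ds_1\int_{u_0}^{s_1}ds_2\cdots\int_{u_0}^{s_{k-1}}ds_k\,a(s_1)\cdots a(s_k),\qquad a(s)=\dot\gamma^\mu(s)A_\mu(\gamma(s)),$$ be the ordered exponential. Let $\sigma(x,y)$ be half the square of the length of $\gamma$, and $\sigma^\rho(x,y)=g^{\rho\nu}(x)\,\partial_{x^\nu}\sigma(x,y)$, $\sigma^{\rho'}(x,y)=g^{\rho\nu}(y)\,\partial_{y^\nu}\sigma(x,y)$. Then the series defining $\Phi(x,y)$ converges, its sum does not depend on the parameterization of the geodesic, and $\Phi$ has the two covariant Taylor expansions $$\Phi^{ab}(x,y)\sim\delta^{ab}+\sum_{k=1}^{\infty}\frac{(-1)^k}{k!}\,\sigma^{\mu_1'}(x,y)\cdots\sigma^{\mu_k'}(x,y)\,\bigl(1\overleftarrow D_{\mu_1}\cdots\overleftarrow D_{\mu_k}\bigr)^{ab}(y),$$ $$\Phi^{ab}(x,y)\sim\delta^{ab}+\sum_{k=1}^{\infty}\frac{(-1)^k}{k!}\,\sigma^{\mu_k}(x,y)\cdots\sigma^{\mu_1}(x,y)\,\bigl(\overrightarrow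 D_{\mu_k}\cdots\overrightarrow D_{\mu_1}1\bigr)^{ab}(x),$$ where $1$ is the constant unit matrix, in the following sense. For every compact $K\subset U$ and every $N\ge0$ there is a constant $C$ such that for all $x,y\in K$ the difference between $\Phi^{ab}(x,y)$ and the sum of the terms of order at most $N$ of either expansion has absolute value at most $C\,\sigma(x,y)^{(N+1)/2}$. If moreover the components $g_{\mu\nu}$ and $B^a_\mu$ are real-analytic functions of the coordinates on $U$, then every point of $U$ has a neighbourhood $W\subset U$ such that for all $x,y\in W$ both series converge absolutely to $\Phi^{ab}(x,y)$. -/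

import Mathlib

open scoped ContDiff Manifold

noncomputable section

namespace YangMills

/-- The coordinate space `ℝ^d`. -/
abbrev Coord (d : ℕ) : Type := EuclideanSpace ℝ (Fin d)

section Geometry

variable {d : ℕ}

/-- The partial derivative `∂_μ f` at the point `ξ`. -/
def pd (μ : Fin d) (f : Coord d → ℝ) (ξ : Coord d) : ℝ :=
  fderiv ℝ f ξ (EuclideanSpace.single μ 1)

/-- The Christoffel symbols of the second kind `Γ^ρ_{μν}(ξ)` of the metric components `G`. -/
def christoffel (G : Coord d → Matrix (Fin d) (Fin d) ℝ) (ρ μ ν : Fin d) (ξ : Coord d) : ℝ :=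
  ∑ α, (G ξ)⁻¹ ρ α / 2 *
    (pd ν (fun η => G η α μ) ξ + pd μ (fun η => G η α ν) ξ - pd α (fun η => G η μ ν) ξ)

/-- The velocity of a curve parameterized by the closed interval `[u₀, u₁]`. -/
def velocity (γ : ℝ → Coord d) (u₀ u₁ s : ℝ) : Coord d :=
  derivWithin γ (Set.Icc u₀ u₁) s

/-- `γ : [u₀, u₁] → X` is a parameterized geodesic from `y` to `x` which stays in `X`. -/
structure IsGeodesic (G : Coord d → Matrix (Fin d) (Fin d) ℝ) (X : Set (Coord d))
    (u₀ u₁ : ℝ) (x y : Coord d) (γ : ℝ → Coord d) : Prop where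
  mapsTo : Set.MapsTo γ (Set.Icc u₀ u₁) X
  start : γ u₀ = y
  finish : γ u₁ = x
  differentiable : DifferentiableOn ℝ γ (Set.Icc u₀ u₁)
  equation : ∀ s ∈ Set.Icc u₀ u₁, ∀ ρ : Fin d,
    HasDerivWithinAt (fun r => velocity γ u₀ u₁ r ρ)
      (-∑ μ, ∑ ν, christoffel G ρ μ ν (γ s) * velocity γ u₀ u₁ s μ * velocity γ u₀ u₁ s ν)
      (Set.Icc u₀ u₁) s

/-- `X` is a convex open domain for the metric `G`: any two points `x, y` of `X` are joined by
exactly one geodesic `[0, 1] → X`, and this geodesic depends smoothly on its end points. -/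
def IsConvexDomain (G : Coord d → Matrix (Fin d) (Fin d) ℝ) (X : Set (Coord d)) : Prop :=
  IsOpen X ∧ ∃ c : Coord d → Coord d → ℝ → Coord d,
    (∀ x ∈ X, ∀ y ∈ X, IsGeodesic G X 0 1 x y (c x y) ∧
      ∀ γ, IsGeodesic G X 0 1 x y γ → Set.EqOn γ (c x y) (Set.Icc 0 1)) ∧
    ContDiffOn ℝ ∞ (fun q : (Coord d × Coord d) × ℝ => c q.1.1 q.1.2 q.2)
      ((X ×ˢ X) ×ˢ Set.Icc (0 : ℝ) 1)

open Classical in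
/-- The geodesic `[0, 1] → X` from `y` to `x` (the constant curve `y` if there is none). -/
def geodesic (G : Coord d → Matrix (Fin d) (Fin d) ℝ) (X : Set (Coord d)) (x y : Coord d) :
    ℝ → Coord d :=
  if h : ∃ γ, IsGeodesic G X 0 1 x y γ then h.choose else fun _ => y

/-- The length of a curve `[u₀, u₁] → ℝ^d` with respect to the metric `G`. -/
def curveLength (G : Coord d → Matrix (Fin d) (Fin d) ℝ) (u₀ u₁ : ℝ) (γ : ℝ → Coord d) : ℝ :=
  ∫ s in u₀..u₁, Real.sqrt
    (∑ μ, ∑ ν, G (γ s) μ ν * velocity γ u₀ u₁ s μ * velocity γ u₀ u₁ s ν)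

/-- Synge's world function: half the square of the length of the geodesic from `y` to `x`. -/
def synge (G : Coord d → Matrix (Fin d) (Fin d) ℝ) (X : Set (Coord d)) (x y : Coord d) : ℝ :=
  curveLength G 0 1 (geodesic G X x y) ^ 2 / 2

/-- `σ^ρ(x, y) = g^{ρν}(x) ∂_{x^ν} σ(x, y)`. -/
def syngeUp (G : Coord d → Matrix (Fin d) (Fin d) ℝ) (X : Set (Coord d)) (ρ : Fin d)
    (x y : Coord d) : ℝ :=
  ∑ ν, (G x)⁻¹ ρ ν * pd ν (fun η => synge G X η y) x

/-- `σ^{ρ'}(x, y) = ∂_{y^{ν'}} σ(x, y) g^{ν'ρ'}(y)`. -/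
def syngeUp' (G : Coord d → Matrix (Fin d) (Fin d) ℝ) (X : Set (Coord d)) (ρ : Fin d)
    (x y : Coord d) : ℝ :=
  ∑ ν, pd ν (fun η => synge G X x η) y * (G y)⁻¹ ν ρ

end Geometry

section Gauge

variable {d : ℕ} {ι : Type*} [Fintype ι]

/-- The structure constants `f^{abc}`, defined by `[t^a, t^b] = f^{abc} t^c`. -/
def structureConst {𝔤 : Type*} [LieRing 𝔤] [LieAlgebra ℝ 𝔤] (t : Module.Basis ι ℝ 𝔤)
    (a b c : ι) : ℝ :=
  t.repr ⁅t a, t b⁆ c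

/-- The connection component `B_μ` in the adjoint representation: the matrix with the entries
`f^{adb} B^d_μ(ξ)`, where `B_μ = B^a_μ t^a`. -/
def connMatrix {𝔤 : Type*} [LieRing 𝔤] [LieAlgebra ℝ 𝔤] (t : Module.Basis ι ℝ 𝔤)
    (B : Fin d → Coord d → 𝔤) (μ : Fin d) (ξ : Coord d) : Matrix ι ι ℝ :=
  Matrix.of fun a b => ∑ c, structureConst t a c b * t.repr (B μ ξ) c

/-- The components `h_{ν_1 … ν_n}^{ab}(ξ)` of a covariant tensor field of rank `n` with values in
the matrices. -/
abbrev TensorField (d : ℕ) (ι : Type*) (n : ℕ) : Type _ :=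
  (Fin n → Fin d) → Coord d → Matrix ι ι ℝ

/-- The Levi-Civita covariant derivative `∇_ρ h_{ν_1 … ν_n}`; the new index `ρ` is put in front. -/
def nabla (G : Coord d → Matrix (Fin d) (Fin d) ℝ) {n : ℕ} (h : TensorField d ι n) :
    TensorField d ι (n + 1) := fun κ ξ => Matrix.of fun a b =>
  pd (κ 0) (fun η => h (Fin.tail κ) η a b) ξ -
    ∑ i, ∑ α, christoffel G α (κ 0) (Fin.tail κ i) ξ *
      h (Function.update (Fin.tail κ) i α) ξ a b

/-- The covariant derivative acting from the left, `∇_ρ h + A_ρ h`. -/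
def leftD (G : Coord d → Matrix (Fin d) (Fin d) ℝ) (A : Fin d → Coord d → Matrix ι ι ℝ) {n : ℕ}
    (h : TensorField d ι n) : TensorField d ι (n + 1) := fun κ ξ =>
  nabla G h κ ξ + A (κ 0) ξ * h (Fin.tail κ) ξ

/-- The covariant derivative acting from the right, `∇_ρ h - h A_ρ`. -/
def rightD (G : Coord d → Matrix (Fin d) (Fin d) ℝ) (A : Fin d → Coord d → Matrix ι ι ℝ) {n : ℕ}
    (h : TensorField d ι n) : TensorField d ι (n + 1) := fun κ ξ =>
  nabla G h κ ξ - h (Fin.tail κ) ξ * A (κ 0) ξ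

variable [DecidableEq ι]

/-- `D_{μ_k} … D_{μ_1} 1` with the derivatives acting from the left; `κ = (μ_k, …, μ_1)`. -/
def leftIter (G : Coord d → Matrix (Fin d) (Fin d) ℝ) (A : Fin d → Coord d → Matrix ι ι ℝ) :
    (k : ℕ) → TensorField d ι k
  | 0 => fun _ _ => 1
  | k + 1 => leftD G A (leftIter G A k)

/-- `1 D_{μ_1} … D_{μ_k}` with the derivatives acting from the right; `κ = (μ_k, …, μ_1)`. -/
def rightIter (G : Coord d → Matrix (Fin d) (Fin d) ℝ) (A : Fin d → Coord d → Matrix ι ι ℝ) :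
    (k : ℕ) → TensorField d ι k
  | 0 => fun _ _ => 1
  | k + 1 => rightD G A (rightIter G A k)

/-- `γ̇^μ(s) A_μ(γ(s))` for a curve on `[u₀, u₁]`. -/
def pullback (A : Fin d → Coord d → Matrix ι ι ℝ) (u₀ u₁ : ℝ) (γ : ℝ → Coord d) (s : ℝ) :
    Matrix ι ι ℝ :=
  ∑ μ, velocity γ u₀ u₁ s μ • A μ (γ s)

/-- The iterated integral
`∫_{u₀}^{s} ds_1 ∫_{u₀}^{s_1} ds_2 … ∫_{u₀}^{s_{k-1}} ds_k P a(s_1) a(s_2) … a(s_k)`. -/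
def iteratedIntegral (a : ℝ → Matrix ι ι ℝ) (u₀ : ℝ) : ℕ → Matrix ι ι ℝ → ℝ → Matrix ι ι ℝ
  | 0, P, _ => P
  | k + 1, P, s => Matrix.of fun i j =>
      ∫ r in u₀..s, iteratedIntegral a u₀ k (P * a r) r i j

/-- The `k`-th term of the path-ordered exponential along a curve `γ` on `[u₀, u₁]`. -/
def orderedTerm (A : Fin d → Coord d → Matrix ι ι ℝ) (u₀ u₁ : ℝ) (γ : ℝ → Coord d) (k : ℕ) :
    Matrix ι ι ℝ :=
  (-1 : ℝ) ^ k • iteratedIntegral (pullback A u₀ u₁ γ) u₀ k 1 u₁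

/-- The path-ordered exponential `Φ(x, y)` along the geodesic from `y` to `x` in `X`. -/
def orderedExp (G : Coord d → Matrix (Fin d) (Fin d) ℝ) (X : Set (Coord d))
    (A : Fin d → Coord d → Matrix ι ι ℝ) (x y : Coord d) : Matrix ι ι ℝ :=
  Matrix.of fun a b => ∑' k, orderedTerm A 0 1 (geodesic G X x y) k a b

/-- `((-1)^k / k!) σ^{μ_1'}(x,y) … σ^{μ_k'}(x,y) (1 D_{μ_1'} … D_{μ_k'})(y)`, with the
derivatives acting from the right; the unit matrix for `k = 0`. -/
def rightTaylorTerm (G : Coord d → Matrix (Fin d) (Fin d) ℝ) (X : Set (Coord d))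
    (A : Fin d → Coord d → Matrix ι ι ℝ) (k : ℕ) (x y : Coord d) : Matrix ι ι ℝ :=
  ((-1 : ℝ) ^ k / (k.factorial : ℝ)) •
    ∑ κ : Fin k → Fin d, (∏ i, syngeUp' G X (κ i) x y) • rightIter G A k κ y

/-- `((-1)^k / k!) σ^{μ_k}(x,y) … σ^{μ_1}(x,y) (D_{μ_k} … D_{μ_1} 1)(x)`, with the
derivatives acting from the left; the unit matrix for `k = 0`. -/
def leftTaylorTerm (G : Coord d → Matrix (Fin d) (Fin d) ℝ) (X : Set (Coord d))
    (A : Fin d → Coord d → Matrix ι ι ℝ) (k : ℕ) (x y : Coord d) : Matrix ι ι ℝ :=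
  ((-1 : ℝ) ^ k / (k.factorial : ℝ)) •
    ∑ κ : Fin k → Fin d, (∏ i, syngeUp G X (κ i) x y) • leftIter G A k κ x

end Gauge

section Chart

variable {d : ℕ} {M : Type*} [TopologicalSpace M] [ChartedSpace (Coord d) M]

/-- The coordinate vector `∂_μ` of the chart `φ` at the point with coordinates `ξ`. -/
def coordVector (φ : OpenPartialHomeomorph M (Coord d)) (μ : Fin d) (ξ : Coord d) :
    TangentSpace (𝓡 d) (φ.symm ξ) :=
  mfderiv (𝓡 d) (𝓡 d) φ.symm ξ (EuclideanSpace.single μ (1 : ℝ) : Coord d)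

/-- The components `g_{μν}` of a Riemannian metric in the chart `φ`, as functions of the
coordinates. -/
def metricComponents [IsManifold (𝓡 d) ∞ M]
    (g : Bundle.ContMDiffRiemannianMetric (𝓡 d) ∞ (Coord d) (fun p : M => TangentSpace (𝓡 d) p))
    (φ : OpenPartialHomeomorph M (Coord d)) (ξ : Coord d) : Matrix (Fin d) (Fin d) ℝ :=
  Matrix.of fun μ ν => g.inner (φ.symm ξ) (coordVector φ μ ξ) (coordVector φ ν ξ)

end Chart

end YangMills

end

/-! Let `γ : [0, 1] → X` be the geodesic from `y` to `x` and `a = γ̇^μ A_μ(γ)`. The iterated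
integrals are the Picard series of `F' = -a F`, `F 0 = 1`, so `Φ(x, y) = F 1`, and uniqueness for
this equation gives independence of the parameterization. Also `Φ(x, y) = H 0`, where `H' = H a` and
`H 1 = 1`, because `H * F` is constant (`transport_eq_backward`).

Covariant derivatives enter through the phase space of pairs `(ξ, v)`. A tensor field `h` defines a
function `contract h`, homogeneous in `v`, and the geodesic spray differentiates it into `contract
(nabla G h)`: the Christoffel terms of `∇` are exactly the acceleration (`hasFDerivAt_contract`).
Hence along `γ` the curves `contract (rightIter G A k) * F` form a chain, each the derivative of the
one before, and so do the curves `H * contract (leftIter G A k)`. Ordinary Taylor expansion of the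
first members, at `0` and at `1` respectively, yields both expansions in powers of the end
velocities. The first variation formula (`IsGeodesicMap.fderiv_synge`) identifies these: `σ^μ =
γ̇^μ(1)` and `σ^{μ'} = -γ̇^μ(0)`. The remainder of order `N` is homogeneous of degree `N + 1` in
`γ̇`, up to a bounded transport factor, and the speed is `√(2σ)`; compactness makes the bound
uniform.

For analytic data the contractions are iterates of a first order differential operator with analytic
coefficients on the phase space, which forces bounds `c k! D^k` (`norm_iterate_le`). By homogeneity
in `v`, `D` may be replaced by `1/2` near the zero section. Geodesics between nearby points stay
there, so the terms decay geometrically and the remainders tend to zero. -/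

noncomputable section

namespace YangMills

/-! ### Parallel transport as a Picard series -/

section Transport

variable {𝔸 : Type*} [NormedRing 𝔸] [NormedAlgebra ℝ 𝔸] [CompleteSpace 𝔸]

/-- The iterated integral `∫_{u₀}^{s} ds_1 … ∫_{u₀}^{s_{k-1}} ds_k a(s_1) … a(s_k)` in a Banach
algebra. -/
def chenTerm (a : ℝ → 𝔸) (u₀ : ℝ) : ℕ → ℝ → 𝔸
  | 0, _ => 1
  | k + 1, s => ∫ r in u₀..s, a r * chenTerm a u₀ k r

omit [CompleteSpace 𝔸] in
lemma continuous_chenTerm {a : ℝ → 𝔸} (ha : Continuous a) (u₀ : ℝ) (k : ℕ) :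
    Continuous (chenTerm a u₀ k) := by
  induction k with
  | zero => exact continuous_const
  | succ k ih =>
    exact intervalIntegral.continuous_primitive (fun _ _ => (ha.mul ih).intervalIntegrable _ _) u₀

lemma hasDerivAt_chenTerm_succ {a : ℝ → 𝔸} (ha : Continuous a) (u₀ : ℝ) (k : ℕ) (s : ℝ) :
    HasDerivAt (chenTerm a u₀ (k + 1)) (a s * chenTerm a u₀ k s) s :=
  (ha.mul (continuous_chenTerm ha u₀ k)).integral_hasStrictDerivAt u₀ s |>.hasDerivAt

-- Integrating the bound `M` over the ordered simplex gives `(M |s - u₀|) ^ k / k!`, so the series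
-- is dominated by an exponential.
omit [CompleteSpace 𝔸] in
lemma norm_chenTerm_le {a : ℝ → 𝔸} (ha : Continuous a) {M : ℝ} (hM : ∀ r, ‖a r‖ ≤ M)
    (u₀ : ℝ) (k : ℕ) (s : ℝ) :
    ‖chenTerm a u₀ k s‖ ≤ ‖(1 : 𝔸)‖ * ((M * |s - u₀|) ^ k / (k.factorial : ℝ)) := by
  have hM0 : 0 ≤ M := (norm_nonneg _).trans (hM 0)
  induction k generalizing s with
  | zero => simp [chenTerm]
  | succ k ih =>
    have h1 : ∀ r, ‖a r * chenTerm a u₀ k r‖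
        ≤ (‖(1 : 𝔸)‖ * M ^ (k + 1) / (k.factorial : ℝ)) * |r - u₀| ^ k := by
      intro r
      calc ‖a r * chenTerm a u₀ k r‖ ≤ ‖a r‖ * ‖chenTerm a u₀ k r‖ := norm_mul_le _ _
        _ ≤ M * (‖(1 : 𝔸)‖ * ((M * |r - u₀|) ^ k / (k.factorial : ℝ))) := by
            gcongr
            · exact hM r
            · exact ih r
        _ = _ := by rw [mul_pow]; ring
    have hc : Continuous fun r => (‖(1 : 𝔸)‖ * M ^ (k + 1) / (k.factorial : ℝ)) * |r - u₀| ^ k := by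
      fun_prop
    have hc' : Continuous fun r => ‖a r * chenTerm a u₀ k r‖ :=
      (ha.mul (continuous_chenTerm ha u₀ k)).norm
    calc ‖chenTerm a u₀ (k + 1) s‖
        ≤ ∫ r in Set.uIoc u₀ s, ‖a r * chenTerm a u₀ k r‖ :=
          intervalIntegral.norm_integral_le_integral_norm_uIoc
      _ ≤ ∫ r in Set.uIoc u₀ s, (‖(1 : 𝔸)‖ * M ^ (k + 1) / (k.factorial : ℝ)) * |r - u₀| ^ k :=
          MeasureTheory.integral_mono (hc'.intervalIntegrable u₀ s).def'
            (hc.intervalIntegrable u₀ s).def' h1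
      _ = _ := by
          rw [MeasureTheory.integral_const_mul, integral_pow_abs_sub_uIoc, mul_pow,
            Nat.factorial_succ]
          push_cast
          field_simp

/-- Termwise differentiation of the Picard series: the derivative of term `k + 1` is `-a` times term
`k`. The norm bound is recorded because the remainder estimates need it uniformly in the end points.
-/
lemma exists_transport {a : ℝ → 𝔸} {u₀ u₁ M : ℝ} (hu : u₀ ≤ u₁)
    (ha : ContinuousOn a (Set.Icc u₀ u₁)) (hM : ∀ s ∈ Set.Icc u₀ u₁, ‖a s‖ ≤ M) :
    ∃ F : ℝ → 𝔸, F u₀ = 1 ∧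
      (∀ s ∈ Set.Icc u₀ u₁, HasDerivWithinAt F (-(a s * F s)) (Set.Icc u₀ u₁) s) ∧
      HasSum (fun k => (-1 : ℝ) ^ k • chenTerm a u₀ k u₁) (F u₁) ∧
      ∀ s ∈ Set.Icc u₀ u₁, ‖F s‖ ≤ ‖(1 : 𝔸)‖ * Real.exp (M * (u₁ - u₀)) := by
  -- Extending `a` by constants beyond the end points makes it continuous and bounded on all of `ℝ`,
  -- without changing the integrals inside the interval.
  set b : ℝ → 𝔸 := Set.IccExtend hu ((Set.Icc u₀ u₁).domRestrict a) with hb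
  have hbc : Continuous b := (continuousOn_iff_continuous_domRestrict.1 ha).Icc_extend'
  have hbM : ∀ r, ‖b r‖ ≤ M := fun r => hM _ (Set.projIcc u₀ u₁ hu r).2
  have hba : ∀ s ∈ Set.Icc u₀ u₁, b s = a s := fun s hs => by
    rw [hb, Set.IccExtend_of_mem _ _ hs]; rfl
  have hM0 : 0 ≤ M := (norm_nonneg _).trans (hbM 0)
  have hterm : ∀ k, ∀ s ∈ Set.Icc u₀ u₁, chenTerm b u₀ k s = chenTerm a u₀ k s := by
    intro k
    induction k with
    | zero => intro s _; rfl
    | succ k ih =>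
      intro s hs
      refine intervalIntegral.integral_congr fun r hr => ?_
      rw [Set.uIcc_of_le hs.1] at hr
      have hr' : r ∈ Set.Icc u₀ u₁ := ⟨hr.1, hr.2.trans hs.2⟩
      simp only [hba r hr', ih r hr']
  set g : ℕ → ℝ → 𝔸 := fun k s => (-1 : ℝ) ^ k • chenTerm b u₀ k s with hg
  have hgn : ∀ k s, ‖g k s‖ ≤ ‖(1 : 𝔸)‖ * ((M * |s - u₀|) ^ k / (k.factorial : ℝ)) := by
    intro k s
    simp only [hg, norm_smul, norm_pow, norm_neg, norm_one, one_pow, one_mul]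
    exact norm_chenTerm_le hbc hbM u₀ k s
  have hexp : ∀ s, HasSum (fun k : ℕ => ‖(1 : 𝔸)‖ * ((M * |s - u₀|) ^ k / (k.factorial : ℝ)))
      (‖(1 : 𝔸)‖ * Real.exp (M * |s - u₀|)) := fun s => by
    have := NormedSpace.expSeries_div_hasSum_exp (M * |s - u₀|)
    rw [← Real.exp_eq_exp_ℝ] at this
    exact this.mul_left _
  have hsum : ∀ s, Summable fun k => g k s := fun s =>
    Summable.of_norm_bounded (hexp s).summable fun k => hgn k s
  set F : ℝ → 𝔸 := fun s => ∑' k, g k s with hF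
  have hder : ∀ s, HasDerivAt F (-(b s * F s)) s := by
    intro s
    -- The ball of radius `L` around `u₀` contains `s`, and on it the differentiated series has a
    -- summable majorant `w`. Both `g'` and `w` are shifted by one index because term `0` is
    -- constant.
    set L : ℝ := |s - u₀| + 1
    set g' : ℕ → ℝ → 𝔸 := fun k r => Nat.casesOn k 0 fun n => -(b r * g n r) with hg'
    set w : ℕ → ℝ := fun k => Nat.casesOn k 0
      fun n => M * (‖(1 : 𝔸)‖ * ((M * L) ^ n / (n.factorial : ℝ))) with hw
    have hws : Summable w := by
      rw [← summable_nat_add_iff 1]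
      have := (hexp (u₀ + L)).summable.mul_left M
      have hL : |u₀ + L - u₀| = L := by
        rw [add_sub_cancel_left]; exact abs_of_nonneg (by positivity)
      rw [hL] at this
      exact this
    have key := hasDerivAt_tsum_of_isPreconnected (g := g) (g' := g') (u := w)
      (t := Metric.ball u₀ L) (y₀ := u₀) (y := s) hws Metric.isOpen_ball
      (convex_ball _ _).isPreconnected ?_ ?_ ?_ (hsum u₀) ?_
    · have h1 : ∑' k, g' k s = -(b s * F s) := by
        have h0 : Summable fun k => g' k s := by
          rw [← summable_nat_add_iff 1]
          exact ((hsum s).mul_left (b s)).neg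
        rw [h0.tsum_eq_zero_add]
        simp only [hg', tsum_neg]
        rw [(hsum s).tsum_mul_left]
        exact zero_add _
      rw [← h1]; exact key
    · rintro (_ | n) r _
      · have : g 0 = fun _ => (1 : 𝔸) := by ext r; simp [hg, chenTerm]
        rw [this]
        exact hasDerivAt_const _ _
      · have := (hasDerivAt_chenTerm_succ hbc u₀ n r).const_smul ((-1 : ℝ) ^ (n + 1))
        refine this.congr_deriv ?_
        simp only [hg', hg, pow_succ, mul_neg, mul_one, neg_smul, mul_smul_comm]
    · rintro (_ | n) r hr
      · simp [hg', hw]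
      · have hr' : |r - u₀| ≤ L := by
          rw [Metric.mem_ball, Real.dist_eq] at hr; exact hr.le
        simp only [hg', hw, norm_neg]
        calc ‖b r * g n r‖ ≤ ‖b r‖ * ‖g n r‖ := norm_mul_le _ _
          _ ≤ M * (‖(1 : 𝔸)‖ * ((M * |r - u₀|) ^ n / (n.factorial : ℝ))) := by
            gcongr
            · exact hbM r
            · exact hgn n r
          _ ≤ _ := by gcongr
    · simp only [Metric.mem_ball, dist_self]; positivity
    · rw [Metric.mem_ball, Real.dist_eq]; simp [L]
  refine ⟨F, ?_, ?_, ?_, ?_⟩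
  · have h0 : ∀ k, k ≠ 0 → g k u₀ = 0 := by
      rintro (_ | k) hk
      · exact absurd rfl hk
      · simp [hg, chenTerm]
    rw [hF]
    simp only
    rw [tsum_eq_single 0 h0]
    simp [hg, chenTerm]
  · intro s hs
    rw [← hba s hs]
    exact (hder s).hasDerivWithinAt
  · have e : (fun k => (-1 : ℝ) ^ k • chenTerm a u₀ k u₁) = fun k => g k u₁ :=
      funext fun k => by simp only [hg, hterm _ u₁ (Set.right_mem_Icc.2 hu)]
    rw [e]
    exact (hsum u₁).hasSum
  · intro s hs
    have h1 : ‖F s‖ ≤ ‖(1 : 𝔸)‖ * Real.exp (M * |s - u₀|) := by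
      rw [← (hexp s).tsum_eq]
      exact tsum_of_norm_bounded (hexp s).summable.hasSum fun k => hgn k s
    refine h1.trans ?_
    have : |s - u₀| ≤ u₁ - u₀ := by
      rw [abs_of_nonneg (by linarith [hs.1])]; linarith [hs.2]
    gcongr

omit [CompleteSpace 𝔸] in
/-- A curve with vanishing derivative on an interval is constant. -/
lemma eq_of_hasDerivWithinAt_zero {E : Type*} [NormedAddCommGroup E] [NormedSpace ℝ E]
    {f : ℝ → E} {u₀ u₁ : ℝ} (hf : ∀ s ∈ Set.Icc u₀ u₁, HasDerivWithinAt f 0 (Set.Icc u₀ u₁) s)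
    {s r : ℝ} (hs : s ∈ Set.Icc u₀ u₁) (hr : r ∈ Set.Icc u₀ u₁) : f s = f r := by
  have := (convex_Icc u₀ u₁).norm_image_sub_le_of_norm_hasDerivWithin_le (C := 0) hf
    (by simp) hr hs
  rw [zero_mul, norm_le_zero_iff, sub_eq_zero] at this
  exact this

end Transport

/-! ### Transport as a function of the starting time -/

section Backward

variable {𝔸 : Type*} [NormedRing 𝔸] [NormedAlgebra ℝ 𝔸] [CompleteSpace 𝔸]

/-- Time reversal turns `H' = H a` into forward transport with the factors in the opposite order,
that is, forward transport in `𝔸ᵐᵒᵖ`. -/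
lemma exists_backward_transport {a : ℝ → 𝔸} {u₀ u₁ M : ℝ} (hu : u₀ ≤ u₁)
    (ha : ContinuousOn a (Set.Icc u₀ u₁)) (hM : ∀ s ∈ Set.Icc u₀ u₁, ‖a s‖ ≤ M) :
    ∃ H : ℝ → 𝔸, H u₁ = 1 ∧
      (∀ s ∈ Set.Icc u₀ u₁, HasDerivWithinAt H (H s * a s) (Set.Icc u₀ u₁) s) ∧
      ∀ s ∈ Set.Icc u₀ u₁, ‖H s‖ ≤ ‖(1 : 𝔸)‖ * Real.exp (M * (u₁ - u₀)) := by
  have hmem : ∀ s ∈ Set.Icc u₀ u₁, u₀ + u₁ - s ∈ Set.Icc u₀ u₁ := fun s hs =>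
    ⟨by linarith [hs.2], by linarith [hs.1]⟩
  obtain ⟨F, hF0, hF, -, hFM⟩ := exists_transport (𝔸 := 𝔸ᵐᵒᵖ)
    (a := fun s => MulOpposite.op (a (u₀ + u₁ - s))) hu
    (MulOpposite.continuous_op.comp_continuousOn
      (ha.comp (by fun_prop) (fun s hs => hmem s hs))) (M := M)
    (fun s hs => hM _ (hmem s hs))
  refine ⟨fun s => (F (u₀ + u₁ - s)).unop, by simp [hF0], ?_, ?_⟩
  · intro s hs
    have h1 : HasDerivWithinAt (fun s : ℝ => u₀ + u₁ - s) (-1) (Set.Icc u₀ u₁) s :=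
      ((hasDerivAt_id s).const_sub (u₀ + u₁)).hasDerivWithinAt
    have h2 := (hF _ (hmem s hs)).scomp s h1 (fun r hr => hmem r hr)
    have h3 := ((MulOpposite.opContinuousLinearEquiv ℝ (M := 𝔸)).symm :
      𝔸ᵐᵒᵖ →L[ℝ] 𝔸).hasFDerivAt.comp_hasDerivWithinAt s h2
    refine h3.congr_deriv ?_
    simp
  · intro s hs
    exact hFM _ (hmem s hs)

-- The product `H * F` has derivative `H a F - H a F = 0`, so its values at the two ends agree.
omit [CompleteSpace 𝔸] in
lemma transport_eq_backward {a F H : ℝ → 𝔸} {u₀ u₁ : ℝ} (hu : u₀ ≤ u₁)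
    (hF : ∀ s ∈ Set.Icc u₀ u₁, HasDerivWithinAt F (-(a s * F s)) (Set.Icc u₀ u₁) s)
    (hF0 : F u₀ = 1)
    (hH : ∀ s ∈ Set.Icc u₀ u₁, HasDerivWithinAt H (H s * a s) (Set.Icc u₀ u₁) s)
    (hH1 : H u₁ = 1) : F u₁ = H u₀ := by
  have : ∀ s ∈ Set.Icc u₀ u₁, HasDerivWithinAt (H * F) 0 (Set.Icc u₀ u₁) s := by
    intro s hs
    refine ((hH s hs).mul (hF s hs)).congr_deriv ?_
    rw [mul_neg, mul_assoc, add_neg_cancel]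
  have := eq_of_hasDerivWithinAt_zero this (Set.right_mem_Icc.2 hu) (Set.left_mem_Icc.2 hu)
  simpa [hF0, hH1] using this

/-- Every solution ends at `H u₀` for one and the same backward solution `H`; no Grönwall argument
is needed. -/
lemma transport_unique {a F F' : ℝ → 𝔸} {u₀ u₁ : ℝ} (hu : u₀ ≤ u₁)
    (ha : ContinuousOn a (Set.Icc u₀ u₁))
    (hF : ∀ s ∈ Set.Icc u₀ u₁, HasDerivWithinAt F (-(a s * F s)) (Set.Icc u₀ u₁) s)
    (hF0 : F u₀ = 1)
    (hF' : ∀ s ∈ Set.Icc u₀ u₁, HasDerivWithinAt F' (-(a s * F' s)) (Set.Icc u₀ u₁) s)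
    (hF0' : F' u₀ = 1) : F u₁ = F' u₁ := by
  obtain ⟨M, hM⟩ := isCompact_Icc.exists_bound_of_continuousOn ha
  obtain ⟨H, hH1, hH, -⟩ := exists_backward_transport hu ha hM
  rw [transport_eq_backward hu hF hF0 hH hH1, transport_eq_backward hu hF' hF0' hH hH1]

lemma hasSum_chenTerm {a F : ℝ → 𝔸} {u₀ u₁ : ℝ} (hu : u₀ ≤ u₁)
    (ha : ContinuousOn a (Set.Icc u₀ u₁))
    (hF : ∀ s ∈ Set.Icc u₀ u₁, HasDerivWithinAt F (-(a s * F s)) (Set.Icc u₀ u₁) s)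
    (hF0 : F u₀ = 1) : HasSum (fun k => (-1 : ℝ) ^ k • chenTerm a u₀ k u₁) (F u₁) := by
  obtain ⟨M, hM⟩ := isCompact_Icc.exists_bound_of_continuousOn ha
  obtain ⟨F', hF0', hF', hs, -⟩ := exists_transport hu ha hM
  rwa [transport_unique hu ha hF hF0 hF' hF0']

end Backward

/-! ### Taylor's formula for a chain of derivatives -/

section Taylor

variable {V : Type*} [NormedAddCommGroup V] [NormedSpace ℝ V]

/-- The product rule telescopes and only the top term survives. -/
lemma hasDerivWithinAt_taylorSum {g : ℕ → ℝ → V} {S : Set ℝ} {s : ℝ}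
    (hg : ∀ k, HasDerivWithinAt (g k) (g (k + 1) s) S s) (t₀ : ℝ) (N : ℕ) :
    HasDerivWithinAt
      (fun r => ∑ k ∈ Finset.range (N + 1), ((t₀ - r) ^ k / (k.factorial : ℝ)) • g k r)
      (((t₀ - s) ^ N / (N.factorial : ℝ)) • g (N + 1) s) S s := by
  induction N with
  | zero => simpa using hg 0
  | succ N ih =>
    simp only [Finset.sum_range_succ _ (N + 1)]
    have h1 : HasDerivWithinAt (fun r : ℝ => (t₀ - r) ^ (N + 1) / ((N + 1).factorial : ℝ))
        (-((t₀ - s) ^ N / (N.factorial : ℝ))) S s := by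
      have := ((((hasDerivAt_id s).const_sub t₀).pow (N + 1)).div_const
        ((N + 1).factorial : ℝ)).hasDerivWithinAt (s := S)
      refine this.congr_deriv ?_
      rw [Nat.factorial_succ]
      push_cast
      simp
      field_simp
    refine (ih.add (h1.smul (hg (N + 1)))).congr_deriv ?_
    simp only [neg_smul]
    abel

/-- Taylor's formula for a chain of curves `g k` with `(g k)' = g (k + 1)` on `[0, 1]`. -/
lemma norm_taylorSum_sub_le {g : ℕ → ℝ → V}
    (hg : ∀ k, ∀ s ∈ Set.Icc (0 : ℝ) 1, HasDerivWithinAt (g k) (g (k + 1) s) (Set.Icc 0 1) s)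
    (N : ℕ) {C t₀ : ℝ} (hC : ∀ s ∈ Set.Icc (0 : ℝ) 1, ‖g (N + 1) s‖ ≤ C)
    (ht : t₀ ∈ Set.Icc (0 : ℝ) 1) :
    ‖∑ k ∈ Finset.range (N + 1), ((t₀ - 1) ^ k / (k.factorial : ℝ)) • g k 1 -
      ∑ k ∈ Finset.range (N + 1), ((t₀ - 0) ^ k / (k.factorial : ℝ)) • g k 0‖
      ≤ C / (N.factorial : ℝ) := by
  have := (convex_Icc (0 : ℝ) 1).norm_image_sub_le_of_norm_hasDerivWithin_le
    (C := C / (N.factorial : ℝ))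
    (fun s hs => hasDerivWithinAt_taylorSum (fun k => hg k s hs) t₀ N) ?_
    (Set.left_mem_Icc.2 zero_le_one) (Set.right_mem_Icc.2 zero_le_one)
  · simpa using this
  · intro s hs
    -- This crude bound replaces integration of `|t₀ - s| ^ N`, hence `N!` and not `(N + 1)!` in the
    -- estimate.
    have h1 : |t₀ - s| ≤ 1 := by
      rw [abs_le]; constructor <;> linarith [hs.1, hs.2, ht.1, ht.2]
    have h0 : 0 ≤ C := (norm_nonneg _).trans (hC s hs)
    rw [norm_smul, Real.norm_eq_abs, abs_div, abs_pow, Nat.abs_cast, div_mul_eq_mul_div]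
    gcongr
    calc |t₀ - s| ^ N * ‖g (N + 1) s‖ ≤ 1 * C := by
          gcongr
          · exact pow_le_one₀ (abs_nonneg _) h1
          · exact hC s hs
      _ = C := one_mul C

/-- The case `t₀ = 1`: at time `1` every summand with `k > 0` vanishes and only `g 0 1` is left. -/
lemma norm_sub_taylor_zero_le {g : ℕ → ℝ → V}
    (hg : ∀ k, ∀ s ∈ Set.Icc (0 : ℝ) 1, HasDerivWithinAt (g k) (g (k + 1) s) (Set.Icc 0 1) s)
    (N : ℕ) {C : ℝ} (hC : ∀ s ∈ Set.Icc (0 : ℝ) 1, ‖g (N + 1) s‖ ≤ C) :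
    ‖g 0 1 - ∑ k ∈ Finset.range (N + 1), (1 / (k.factorial : ℝ)) • g k 0‖
      ≤ C / (N.factorial : ℝ) := by
  have := norm_taylorSum_sub_le hg N hC (Set.right_mem_Icc.2 zero_le_one)
  simpa [Finset.sum_range_succ'] using this

lemma norm_sub_taylor_one_le {g : ℕ → ℝ → V}
    (hg : ∀ k, ∀ s ∈ Set.Icc (0 : ℝ) 1, HasDerivWithinAt (g k) (g (k + 1) s) (Set.Icc 0 1) s)
    (N : ℕ) {C : ℝ} (hC : ∀ s ∈ Set.Icc (0 : ℝ) 1, ‖g (N + 1) s‖ ≤ C) :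
    ‖g 0 0 - ∑ k ∈ Finset.range (N + 1), ((-1) ^ k / (k.factorial : ℝ)) • g k 1‖
      ≤ C / (N.factorial : ℝ) := by
  have := norm_taylorSum_sub_le hg N hC (Set.left_mem_Icc.2 zero_le_one)
  have e : ∑ k ∈ Finset.range (N + 1), ((0 - 0 : ℝ) ^ k / (k.factorial : ℝ)) • g k 0 = g 0 0 := by
    simp [Finset.sum_range_succ']
  rw [e] at this
  rw [norm_sub_rev]
  simpa using this

end Taylor

/-! ### Matrices as a Banach algebra, and their entries -/

section MatrixGlue

variable {ι : Type*} [Fintype ι] [DecidableEq ι]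

attribute [local instance] Matrix.linftyOpNormedRing Matrix.linftyOpNormedAlgebra

/-- The `(a, b)` entry of a matrix, as a continuous linear functional. -/
def entryL (a b : ι) : Matrix ι ι ℝ →L[ℝ] ℝ :=
  LinearMap.toContinuousLinearMap (Matrix.entryLinearMap ℝ ℝ a b)

omit [DecidableEq ι] in
@[simp] lemma entryL_apply (a b : ι) (P : Matrix ι ι ℝ) : entryL a b P = P a b := rfl

lemma abs_entry_le (P : Matrix ι ι ℝ) (a b : ι) : |P a b| ≤ ‖P‖ := by
  rw [Matrix.linfty_opNorm_def, ← Real.norm_eq_abs, ← coe_nnnorm, NNReal.coe_le_coe]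
  exact (Finset.single_le_sum (f := fun j => ‖P a j‖₊) (fun _ _ => zero_le)
    (Finset.mem_univ b)).trans
    (Finset.le_sup (f := fun i => ∑ j, ‖P i j‖₊) (Finset.mem_univ a))

lemma matrix_fun_eq_sum {E : Type*} (f : E → Matrix ι ι ℝ) :
    f = fun p => ∑ a, ∑ b, f p a b • Matrix.single a b (1 : ℝ) := by
  funext p
  conv_lhs => rw [Matrix.matrix_eq_sum_single (f p)]
  simp

lemma contDiffOn_matrix {E : Type*} [NormedAddCommGroup E] [NormedSpace ℝ E] {n : ℕ∞ω}
    {f : E → Matrix ι ι ℝ} {S : Set E} (h : ∀ a b, ContDiffOn ℝ n (fun p => f p a b) S) :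
    ContDiffOn ℝ n f S := by
  rw [matrix_fun_eq_sum f]
  exact ContDiffOn.sum fun a _ => ContDiffOn.sum fun b _ => (h a b).smul contDiffOn_const

lemma chenTerm_congr {a b : ℝ → Matrix ι ι ℝ} {u₀ u₁ : ℝ} (h : Set.EqOn a b (Set.Icc u₀ u₁))
    (k : ℕ) {s : ℝ} (hs : s ∈ Set.Icc u₀ u₁) : chenTerm a u₀ k s = chenTerm b u₀ k s := by
  induction k generalizing s with
  | zero => rfl
  | succ k ih =>
    refine intervalIntegral.integral_congr fun r hr => ?_
    rw [Set.uIcc_of_le hs.1] at hr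
    have hr' : r ∈ Set.Icc u₀ u₁ := ⟨hr.1, hr.2.trans hs.2⟩
    simp only [h hr', ih hr']

omit [DecidableEq ι] in
lemma iteratedIntegral_congr {a b : ℝ → Matrix ι ι ℝ} {u₀ u₁ : ℝ}
    (h : Set.EqOn a b (Set.Icc u₀ u₁)) (k : ℕ) (P : Matrix ι ι ℝ) {s : ℝ}
    (hs : s ∈ Set.Icc u₀ u₁) : iteratedIntegral a u₀ k P s = iteratedIntegral b u₀ k P s := by
  induction k generalizing s P with
  | zero => rfl
  | succ k ih =>
    ext i j
    refine intervalIntegral.integral_congr fun r hr => ?_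
    rw [Set.uIcc_of_le hs.1] at hr
    have hr' : r ∈ Set.Icc u₀ u₁ := ⟨hr.1, hr.2.trans hs.2⟩
    simp only [h hr', ih _ hr']

/-- The product accumulates in the argument `P`, so the induction runs over all `P`. Left
multiplication followed by taking an entry is continuous and linear, hence commutes with the
integral. -/
lemma iteratedIntegral_eq_of_continuous {a : ℝ → Matrix ι ι ℝ} (ha : Continuous a) (u₀ : ℝ)
    (k : ℕ) (P : Matrix ι ι ℝ) (s : ℝ) :
    iteratedIntegral a u₀ k P s = P * chenTerm a u₀ k s := by
  induction k generalizing s P with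
  | zero => simp [iteratedIntegral, chenTerm]
  | succ k ih =>
    ext i j
    have hi := (ha.mul (continuous_chenTerm ha u₀ k)).intervalIntegrable
      (μ := MeasureTheory.volume) u₀ s
    have := ((entryL i j).comp (ContinuousLinearMap.mul ℝ (Matrix ι ι ℝ) P)).intervalIntegral_comp_comm hi
    change ∫ r in u₀..s, iteratedIntegral a u₀ k (P * a r) r i j = _
    simp only [ih, mul_assoc]
    exact this

lemma iteratedIntegral_eq {a : ℝ → Matrix ι ι ℝ} {u₀ u₁ : ℝ} (hu : u₀ ≤ u₁)
    (ha : ContinuousOn a (Set.Icc u₀ u₁)) (k : ℕ) (P : Matrix ι ι ℝ) :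
    iteratedIntegral a u₀ k P u₁ = P * chenTerm a u₀ k u₁ := by
  have hbc : Continuous (Set.IccExtend hu ((Set.Icc u₀ u₁).domRestrict a)) :=
    (continuousOn_iff_continuous_domRestrict.1 ha).Icc_extend'
  have hab : Set.EqOn a (Set.IccExtend hu ((Set.Icc u₀ u₁).domRestrict a)) (Set.Icc u₀ u₁) :=
    fun s hs => by rw [Set.IccExtend_of_mem _ _ hs]; rfl
  rw [iteratedIntegral_congr hab k P (Set.right_mem_Icc.2 hu),
    chenTerm_congr hab k (Set.right_mem_Icc.2 hu), iteratedIntegral_eq_of_continuous hbc]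

lemma hasSum_orderedTerm {d : ℕ} {A : Fin d → Coord d → Matrix ι ι ℝ} {u₀ u₁ : ℝ} (hu : u₀ ≤ u₁)
    {γ : ℝ → Coord d} (ha : ContinuousOn (pullback A u₀ u₁ γ) (Set.Icc u₀ u₁))
    {F : ℝ → Matrix ι ι ℝ} (hF : ∀ s ∈ Set.Icc u₀ u₁,
      HasDerivWithinAt F (-(pullback A u₀ u₁ γ s * F s)) (Set.Icc u₀ u₁) s)
    (hF0 : F u₀ = 1) (a b : ι) :
    HasSum (fun k => orderedTerm A u₀ u₁ γ k a b) (F u₁ a b) := by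
  have := (hasSum_chenTerm hu ha hF hF0).mapL (entryL a b)
  simpa only [orderedTerm, iteratedIntegral_eq hu ha, one_mul, entryL_apply] using this

end MatrixGlue

/-! ### The geodesic spray acts on contractions as the covariant derivative -/

section Contraction

variable {d : ℕ}

/-- The acceleration `-Γ^ρ_{μν}(ξ) v^μ v^ν` of a geodesic through `ξ` with velocity `v`. -/
def acceleration (G : Coord d → Matrix (Fin d) (Fin d) ℝ) (p : Coord d × Coord d) : Coord d :=
  WithLp.toLp 2 fun ρ => -∑ μ, ∑ ν, christoffel G ρ μ ν p.1 * p.2 μ * p.2 ν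

/-- The geodesic spray, the vector field of the geodesic flow on the phase space. -/
def spray (G : Coord d → Matrix (Fin d) (Fin d) ℝ) (p : Coord d × Coord d) : Coord d × Coord d :=
  (p.2, acceleration G p)

lemma sum_mul_pd (f : Coord d → ℝ) (ξ v : Coord d) : ∑ μ, v μ * pd μ f ξ = fderiv ℝ f ξ v := by
  have hv : v = ∑ μ, v μ • EuclideanSpace.single μ (1 : ℝ) := by
    ext i
    simp [Finset.sum_apply, Pi.single_apply]
  conv_rhs => rw [hv]
  simp [pd, map_sum]

/-- Exchanging the `i`-th index with the extra summation index is an involution. -/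
lemma sum_swap_update {k : ℕ} (i : Fin k) (f : (Fin k → Fin d) → Fin d → ℝ) :
    ∑ κ, ∑ α, f κ α = ∑ κ, ∑ α, f (Function.update κ i α) (κ i) := by
  rw [← Finset.sum_product', ← Finset.sum_product']
  refine Finset.sum_nbij' (fun q => (Function.update q.1 i q.2, q.1 i))
    (fun q => (Function.update q.1 i q.2, q.1 i)) ?_ ?_ ?_ ?_ ?_ <;> simp

lemma sum_fin_succ_fun {R : Type*} [AddCommMonoid R] {k : ℕ} (f : (Fin (k + 1) → Fin d) → R) :
    ∑ κ, f κ = ∑ μ, ∑ κ : Fin k → Fin d, f (Fin.cons μ κ) := by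
  rw [← Finset.sum_product', ← (Fin.consEquiv fun _ => Fin d).sum_comp]
  rfl

/-- Renaming dummy indices moves each Christoffel symbol from a slot of `H` to the corresponding
velocity factor, where it becomes, up to sign, the geodesic acceleration. -/
lemma contraction_christoffel (Γ : Fin d → Fin d → Fin d → ℝ) {k : ℕ}
    (H : (Fin k → Fin d) → ℝ) (v : Coord d) :
    ∑ μ, ∑ κ : Fin k → Fin d, (v μ * ∏ i, v (κ i)) *
      ∑ i, ∑ α, Γ α μ (κ i) * H (Function.update κ i α) =
    ∑ κ : Fin k → Fin d, (∑ i, (∏ j ∈ Finset.univ.erase i, v (κ j)) *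
      ∑ μ, ∑ ν, Γ (κ i) μ ν * v μ * v ν) * H κ := by
  have h1 : ∀ μ (i : Fin k), ∑ κ : Fin k → Fin d, ∑ α, (v μ * ∏ i, v (κ i)) *
      (Γ α μ (κ i) * H (Function.update κ i α)) =
      ∑ κ : Fin k → Fin d, ∑ ν, (∏ j ∈ Finset.univ.erase i, v (κ j)) *
        (Γ (κ i) μ ν * v μ * v ν) * H κ := by
    intro μ i
    rw [sum_swap_update i]
    refine Finset.sum_congr rfl fun κ _ => Finset.sum_congr rfl fun α _ => ?_
    have h2 : ∏ j, v (Function.update κ i α j)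
        = v α * ∏ j ∈ Finset.univ.erase i, v (κ j) := by
      rw [← Finset.mul_prod_erase _ _ (Finset.mem_univ i)]
      congr 1
      · simp
      · refine Finset.prod_congr rfl fun j hj => ?_
        rw [Function.update_of_ne (Finset.ne_of_mem_erase hj)]
    rw [h2]
    simp
    ring
  calc _ = ∑ μ, ∑ i, ∑ κ : Fin k → Fin d, ∑ α, (v μ * ∏ i, v (κ i)) *
      (Γ α μ (κ i) * H (Function.update κ i α)) := by
        refine Finset.sum_congr rfl fun μ _ => ?_
        rw [Finset.sum_comm]
        simp only [Finset.mul_sum]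
    _ = ∑ μ, ∑ i, ∑ κ : Fin k → Fin d, ∑ ν, (∏ j ∈ Finset.univ.erase i, v (κ j)) *
        (Γ (κ i) μ ν * v μ * v ν) * H κ := by
        simp only [h1]
    _ = ∑ i, ∑ κ : Fin k → Fin d, ∑ μ, ∑ ν, (∏ j ∈ Finset.univ.erase i, v (κ j)) *
        (Γ (κ i) μ ν * v μ * v ν) * H κ := by
        rw [Finset.sum_comm]
        exact Finset.sum_congr rfl fun i _ => Finset.sum_comm
    _ = _ := by
        rw [Finset.sum_comm]
        simp only [Finset.mul_sum, Finset.sum_mul]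

lemma hasFDerivAt_contraction {k : ℕ} {H : (Fin k → Fin d) → Coord d → ℝ}
    {p : Coord d × Coord d} (hH : ∀ κ, DifferentiableAt ℝ (H κ) p.1) :
    ∃ L : Coord d × Coord d →L[ℝ] ℝ,
      HasFDerivAt (fun q : Coord d × Coord d => ∑ κ, (∏ i, q.2 (κ i)) * H κ q.1) L p ∧
      ∀ w : Coord d × Coord d, L w = ∑ κ, ((∏ i, p.2 (κ i)) * fderiv ℝ (H κ) p.1 w.1 +
        (∑ i, (∏ j ∈ Finset.univ.erase i, p.2 (κ j)) * w.2 (κ i)) * H κ p.1) := by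
  have hcoord : ∀ ρ : Fin d, HasFDerivAt (fun q : Coord d × Coord d => q.2 ρ)
      ((EuclideanSpace.proj ρ : Coord d →L[ℝ] ℝ).comp (ContinuousLinearMap.snd ℝ _ _)) p :=
    fun ρ => ((EuclideanSpace.proj ρ : Coord d →L[ℝ] ℝ).comp
      (ContinuousLinearMap.snd ℝ (Coord d) (Coord d))).hasFDerivAt
  have h1 : ∀ κ : Fin k → Fin d, _ := fun κ =>
    (HasFDerivAt.finsetProd (u := Finset.univ) fun i _ => hcoord (κ i)).mul
      ((hH κ).hasFDerivAt.comp p (hasFDerivAt_fst (𝕜 := ℝ) (p := p)))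
  refine ⟨_, HasFDerivAt.fun_sum fun κ _ => h1 κ, fun w => ?_⟩
  simp only [sum_apply, add_apply,
    smul_apply, ContinuousLinearMap.comp_apply, smul_eq_mul]
  refine Finset.sum_congr rfl fun κ _ => ?_
  simp
  ring

/-- The horizontal part of the spray gives `v^μ ∂_μ H`. The vertical part replaces one velocity
factor at a time by the acceleration, and by `contraction_christoffel` this is the Christoffel part
of `∇`. -/
lemma hasFDerivAt_contraction_spray (G : Coord d → Matrix (Fin d) (Fin d) ℝ) {k : ℕ}
    {H : (Fin k → Fin d) → Coord d → ℝ}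
    {p : Coord d × Coord d} (hH : ∀ κ, DifferentiableAt ℝ (H κ) p.1) :
    ∃ L : Coord d × Coord d →L[ℝ] ℝ,
      HasFDerivAt (fun q : Coord d × Coord d => ∑ κ, (∏ i, q.2 (κ i)) * H κ q.1) L p ∧
      L (spray G p) = ∑ κ : Fin (k + 1) → Fin d, (∏ i, p.2 (κ i)) *
        (pd (κ 0) (H (Fin.tail κ)) p.1 - ∑ i, ∑ α, christoffel G α (κ 0) (Fin.tail κ i) p.1 *
          H (Function.update (Fin.tail κ) i α) p.1) := by
  obtain ⟨L, hL, hLw⟩ := hasFDerivAt_contraction hH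
  refine ⟨L, hL, ?_⟩
  rw [hLw, sum_fin_succ_fun]
  simp only [Fin.prod_univ_succ, Fin.cons_zero, Fin.cons_succ, Fin.tail_cons, mul_sub,
    Finset.sum_sub_distrib]
  rw [contraction_christoffel (fun ρ μ ν => christoffel G ρ μ ν p.1) (fun κ => H κ p.1),
    Finset.sum_add_distrib, sub_eq_add_neg]
  congr 1
  · rw [Finset.sum_comm]
    refine Finset.sum_congr rfl fun κ _ => ?_
    simp only [spray, ← sum_mul_pd, Finset.mul_sum]
    exact Finset.sum_congr rfl fun μ _ => by ring
  · rw [← Finset.sum_neg_distrib]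
    refine Finset.sum_congr rfl fun κ _ => ?_
    simp only [spray, acceleration, mul_neg, Finset.sum_neg_distrib, neg_mul]

end Contraction

/-! ### Contractions of matrix-valued tensor fields -/

section MatrixContraction

variable {d : ℕ} {ι : Type*} [Fintype ι] [DecidableEq ι]

attribute [local instance] Matrix.linftyOpNormedRing Matrix.linftyOpNormedAlgebra

/-- The function `v^{κ_1} … v^{κ_k} h_{κ_1 … κ_k}(ξ)` on the phase space. -/
def contract {k : ℕ} (h : TensorField d ι k) (p : Coord d × Coord d) : Matrix ι ι ℝ :=
  ∑ κ : Fin k → Fin d, (∏ i, p.2 (κ i)) • h κ p.1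

omit [Fintype ι] [DecidableEq ι] in
lemma contract_apply {k : ℕ} (h : TensorField d ι k) (p : Coord d × Coord d) (a b : ι) :
    contract h p a b = ∑ κ : Fin k → Fin d, (∏ i, p.2 (κ i)) * h κ p.1 a b := by
  simp [contract, Matrix.sum_apply]

lemma hasFDerivAt_matrix {E : Type*} [NormedAddCommGroup E] [NormedSpace ℝ E]
    {f : E → Matrix ι ι ℝ} {L : ι → ι → E →L[ℝ] ℝ} {p : E}
    (h : ∀ a b, HasFDerivAt (fun q => f q a b) (L a b) p) :
    ∃ D : E →L[ℝ] Matrix ι ι ℝ, HasFDerivAt f D p ∧ ∀ w a b, D w a b = L a b w := by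
  refine ⟨∑ a, ∑ b, (L a b).smulRight (Matrix.single a b (1 : ℝ)), ?_, ?_⟩
  · rw [matrix_fun_eq_sum f]
    exact HasFDerivAt.fun_sum fun a _ => HasFDerivAt.fun_sum fun b _ => (h a b).smul_const _
  · intro w a b
    simp [Matrix.sum_apply, Matrix.single_apply, ite_and]

/-- Lifted geodesics are integral curves of the spray, so this converts ordinary derivatives along a
geodesic into covariant ones. -/
lemma hasFDerivAt_contract (G : Coord d → Matrix (Fin d) (Fin d) ℝ) {k : ℕ}
    {h : TensorField d ι k} {p : Coord d × Coord d}
    (hh : ∀ κ a b, DifferentiableAt ℝ (fun ξ => h κ ξ a b) p.1) :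
    ∃ D : Coord d × Coord d →L[ℝ] Matrix ι ι ℝ,
      HasFDerivAt (contract h) D p ∧ D (spray G p) = contract (nabla G h) p := by
  choose L hL hLs using fun a b => hasFDerivAt_contraction_spray G (p := p) (fun κ => hh κ a b)
  obtain ⟨D, hD, hDL⟩ := hasFDerivAt_matrix (f := contract h) (L := L) (p := p)
    (fun a b => by simpa only [contract_apply] using hL a b)
  refine ⟨D, hD, ?_⟩
  ext a b
  rw [hDL, hLs, contract_apply]
  rfl

/-- The matrix `v^μ A_μ(ξ)`. -/
def contractForm (A : Fin d → Coord d → Matrix ι ι ℝ) (p : Coord d × Coord d) : Matrix ι ι ℝ :=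
  ∑ μ, p.2 μ • A μ p.1

omit [DecidableEq ι] in
lemma contract_leftD (G : Coord d → Matrix (Fin d) (Fin d) ℝ)
    (A : Fin d → Coord d → Matrix ι ι ℝ) {k : ℕ} (h : TensorField d ι k)
    (p : Coord d × Coord d) :
    contract (leftD G A h) p = contract (nabla G h) p + contractForm A p * contract h p := by
  simp only [contract, leftD, smul_add, Finset.sum_add_distrib]
  congr 1
  rw [sum_fin_succ_fun, contractForm, Finset.sum_mul]
  refine Finset.sum_congr rfl fun μ _ => ?_
  rw [Finset.mul_sum]
  refine Finset.sum_congr rfl fun κ _ => ?_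
  simp only [Fin.prod_univ_succ, Fin.cons_zero, Fin.cons_succ, Fin.tail_cons, mul_smul,
    Matrix.smul_mul, Matrix.mul_smul]
  exact smul_comm _ _ _

omit [DecidableEq ι] in
lemma contract_rightD (G : Coord d → Matrix (Fin d) (Fin d) ℝ)
    (A : Fin d → Coord d → Matrix ι ι ℝ) {k : ℕ} (h : TensorField d ι k)
    (p : Coord d × Coord d) :
    contract (rightD G A h) p = contract (nabla G h) p - contract h p * contractForm A p := by
  simp only [contract, rightD, smul_sub, Finset.sum_sub_distrib]
  congr 1
  rw [sum_fin_succ_fun, contractForm, Finset.mul_sum]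
  refine Finset.sum_congr rfl fun μ _ => ?_
  rw [Finset.sum_mul]
  refine Finset.sum_congr rfl fun κ _ => ?_
  simp [Fin.prod_univ_succ, mul_smul]

omit [Fintype ι] [DecidableEq ι] in
lemma contract_smul {k : ℕ} (h : TensorField d ι k) (ξ v : Coord d) (c : ℝ) :
    contract h (ξ, c • v) = c ^ k • contract h (ξ, v) := by
  simp [contract, Finset.smul_sum, Finset.prod_mul_distrib, mul_smul]

end MatrixContraction

/-! ### Regularity of the spray and of the iterated derivatives -/

section Smoothness

variable {d : ℕ} {n : ℕ∞ω} {X : Set (Coord d)}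

/-- The condition `n + 1 ≤ n` singles out `n = ∞` and `n = ω`, so one argument serves the smooth and
the analytic case. -/
lemma contDiffOn_pd (hn : n + 1 ≤ n) (hX : IsOpen X) {f : Coord d → ℝ} (hf : ContDiffOn ℝ n f X)
    (μ : Fin d) : ContDiffOn ℝ n (pd μ f) X :=
  (hf.fderiv_of_isOpen hX hn).clm_apply contDiffOn_const

lemma contDiffOn_det {E : Type*} [NormedAddCommGroup E] [NormedSpace ℝ E] {S : Set E}
    {κ : Type*} [Fintype κ] [DecidableEq κ] {f : E → Matrix κ κ ℝ}
    (h : ∀ a b, ContDiffOn ℝ n (fun p => f p a b) S) : ContDiffOn ℝ n (fun p => (f p).det) S := by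
  simp only [Matrix.det_apply']
  exact ContDiffOn.sum fun σ _ => contDiffOn_const.mul (contDiffOn_prod fun i _ => h _ _)

lemma contDiffOn_inv {E : Type*} [NormedAddCommGroup E] [NormedSpace ℝ E] {S : Set E}
    {κ : Type*} [Fintype κ] [DecidableEq κ] {f : E → Matrix κ κ ℝ}
    (h : ∀ a b, ContDiffOn ℝ n (fun p => f p a b) S) (hdet : ∀ p ∈ S, (f p).det ≠ 0) (a b : κ) :
    ContDiffOn ℝ n (fun p => (f p)⁻¹ a b) S := by
  simp only [Matrix.inv_def, Ring.inverse_eq_inv', Matrix.smul_apply, smul_eq_mul,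
    Matrix.adjugate_apply]
  refine ((contDiffOn_det h).inv hdet).mul (contDiffOn_det fun i j => ?_)
  by_cases hi : i = b
  · subst hi
    simpa using contDiffOn_const
  · simpa only [Matrix.updateRow_ne hi] using h i j

lemma contDiffOn_christoffel (hn : n + 1 ≤ n) (hX : IsOpen X)
    {G : Coord d → Matrix (Fin d) (Fin d) ℝ} (hG : ∀ μ ν, ContDiffOn ℝ n (fun ξ => G ξ μ ν) X)
    (hdet : ∀ ξ ∈ X, (G ξ).det ≠ 0) (ρ μ ν : Fin d) :
    ContDiffOn ℝ n (christoffel G ρ μ ν) X := by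
  have hpd := fun μ ν ρ => contDiffOn_pd hn hX (hG μ ν) ρ
  exact ContDiffOn.sum fun α _ => ((contDiffOn_inv hG hdet ρ α).div_const 2).mul
    (((hpd _ _ _).add (hpd _ _ _)).sub (hpd _ _ _))

lemma contDiffOn_comp_fst {V : Type*} [NormedAddCommGroup V] [NormedSpace ℝ V]
    {f : Coord d → V} (hf : ContDiffOn ℝ n f X) :
    ContDiffOn ℝ n (fun p : Coord d × Coord d => f p.1) (X ×ˢ Set.univ) :=
  hf.comp contDiffOn_fst fun _ hp => hp.1

lemma contDiff_snd_coord (μ : Fin d) : ContDiff ℝ n fun p : Coord d × Coord d => p.2 μ :=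
  (contDiff_piLp_apply (p := 2) (E := fun _ : Fin d => ℝ) (i := μ)).comp contDiff_snd

lemma contDiffOn_spray (hn : n + 1 ≤ n) (hX : IsOpen X)
    {G : Coord d → Matrix (Fin d) (Fin d) ℝ} (hG : ∀ μ ν, ContDiffOn ℝ n (fun ξ => G ξ μ ν) X)
    (hdet : ∀ ξ ∈ X, (G ξ).det ≠ 0) : ContDiffOn ℝ n (spray G) (X ×ˢ Set.univ) := by
  refine contDiffOn_snd.prodMk (contDiffOn_piLp' 2 fun ρ => ContDiffOn.neg ?_)
  exact ContDiffOn.sum fun μ _ => ContDiffOn.sum fun ν _ =>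
    ((contDiffOn_comp_fst (contDiffOn_christoffel hn hX hG hdet ρ μ ν)).mul
      (contDiff_snd_coord μ).contDiffOn).mul (contDiff_snd_coord ν).contDiffOn

variable {ι : Type*} [Fintype ι] [DecidableEq ι]

attribute [local instance] Matrix.linftyOpNormedRing Matrix.linftyOpNormedAlgebra

omit [Fintype ι] [DecidableEq ι] in
lemma contDiffOn_nabla (hn : n + 1 ≤ n) (hX : IsOpen X)
    {G : Coord d → Matrix (Fin d) (Fin d) ℝ} (hG : ∀ μ ν, ContDiffOn ℝ n (fun ξ => G ξ μ ν) X)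
    (hdet : ∀ ξ ∈ X, (G ξ).det ≠ 0) {k : ℕ} {h : TensorField d ι k}
    (hh : ∀ κ a b, ContDiffOn ℝ n (fun ξ => h κ ξ a b) X) (κ : Fin (k + 1) → Fin d) (a b : ι) :
    ContDiffOn ℝ n (fun ξ => nabla G h κ ξ a b) X :=
  (contDiffOn_pd hn hX (hh _ a b) _).sub (ContDiffOn.sum fun _ _ => ContDiffOn.sum fun _ _ =>
    (contDiffOn_christoffel hn hX hG hdet _ _ _).mul (hh _ a b))

omit [DecidableEq ι] in
lemma contDiffOn_mul_entry {E : Type*} [NormedAddCommGroup E] [NormedSpace ℝ E] {S : Set E}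
    {f g : E → Matrix ι ι ℝ} (hf : ∀ a b, ContDiffOn ℝ n (fun p => f p a b) S)
    (hg : ∀ a b, ContDiffOn ℝ n (fun p => g p a b) S) (a b : ι) :
    ContDiffOn ℝ n (fun p => (f p * g p) a b) S := by
  simp only [Matrix.mul_apply]
  exact ContDiffOn.sum fun c _ => (hf a c).mul (hg c b)

lemma contDiffOn_leftIter (hn : n + 1 ≤ n) (hX : IsOpen X)
    {G : Coord d → Matrix (Fin d) (Fin d) ℝ} (hG : ∀ μ ν, ContDiffOn ℝ n (fun ξ => G ξ μ ν) X)
    (hdet : ∀ ξ ∈ X, (G ξ).det ≠ 0) {A : Fin d → Coord d → Matrix ι ι ℝ}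
    (hA : ∀ μ a b, ContDiffOn ℝ n (fun ξ => A μ ξ a b) X) (k : ℕ) (κ : Fin k → Fin d) (a b : ι) :
    ContDiffOn ℝ n (fun ξ => leftIter G A k κ ξ a b) X := by
  induction k generalizing a b with
  | zero => exact contDiffOn_const
  | succ k ih =>
    exact (contDiffOn_nabla hn hX hG hdet ih κ a b).add
      (contDiffOn_mul_entry (hA _) (ih _) a b)

lemma contDiffOn_rightIter (hn : n + 1 ≤ n) (hX : IsOpen X)
    {G : Coord d → Matrix (Fin d) (Fin d) ℝ} (hG : ∀ μ ν, ContDiffOn ℝ n (fun ξ => G ξ μ ν) X)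
    (hdet : ∀ ξ ∈ X, (G ξ).det ≠ 0) {A : Fin d → Coord d → Matrix ι ι ℝ}
    (hA : ∀ μ a b, ContDiffOn ℝ n (fun ξ => A μ ξ a b) X) (k : ℕ) (κ : Fin k → Fin d) (a b : ι) :
    ContDiffOn ℝ n (fun ξ => rightIter G A k κ ξ a b) X := by
  induction k generalizing a b with
  | zero => exact contDiffOn_const
  | succ k ih =>
    exact (contDiffOn_nabla hn hX hG hdet ih κ a b).sub
      (contDiffOn_mul_entry (ih _) (hA _) a b)

lemma contDiffOn_contractForm {A : Fin d → Coord d → Matrix ι ι ℝ}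
    (hA : ∀ μ a b, ContDiffOn ℝ n (fun ξ => A μ ξ a b) X) :
    ContDiffOn ℝ n (contractForm A) (X ×ˢ Set.univ) :=
  ContDiffOn.sum fun μ _ => (contDiff_snd_coord μ).contDiffOn.smul
    (contDiffOn_comp_fst (contDiffOn_matrix (hA μ)))

lemma contDiffOn_contract {k : ℕ} {h : TensorField d ι k}
    (hh : ∀ κ a b, ContDiffOn ℝ n (fun ξ => h κ ξ a b) X) :
    ContDiffOn ℝ n (contract h) (X ×ˢ Set.univ) :=
  ContDiffOn.sum fun κ _ => (contDiffOn_prod fun i _ => (contDiff_snd_coord (κ i)).contDiffOn).smul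
    (contDiffOn_comp_fst (contDiffOn_matrix (hh κ)))

end Smoothness

/-! ### Taylor expansion along a lifted geodesic -/

section GeodesicChain

variable {d : ℕ} {X : Set (Coord d)} {G : Coord d → Matrix (Fin d) (Fin d) ℝ}
  {u₀ u₁ : ℝ} {x y : Coord d} {γ : ℝ → Coord d}

/-- The lift of a curve to the phase space. -/
def phase (γ : ℝ → Coord d) (u₀ u₁ s : ℝ) : Coord d × Coord d := (γ s, velocity γ u₀ u₁ s)

lemma IsGeodesic.hasDerivWithinAt (hγ : IsGeodesic G X u₀ u₁ x y γ) {s : ℝ}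
    (hs : s ∈ Set.Icc u₀ u₁) :
    HasDerivWithinAt γ (velocity γ u₀ u₁ s) (Set.Icc u₀ u₁) s :=
  (hγ.differentiable s hs).hasDerivWithinAt

lemma IsGeodesic.hasDerivWithinAt_velocity (hγ : IsGeodesic G X u₀ u₁ x y γ) {s : ℝ}
    (hs : s ∈ Set.Icc u₀ u₁) :
    HasDerivWithinAt (velocity γ u₀ u₁) (acceleration G (phase γ u₀ u₁ s)) (Set.Icc u₀ u₁) s := by
  have h := (hasDerivWithinAt_pi (φ := fun r ρ => velocity γ u₀ u₁ r ρ)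
    (φ' := fun ρ => acceleration G (phase γ u₀ u₁ s) ρ)).2 fun ρ => hγ.equation s hs ρ
  exact ((EuclideanSpace.equiv (Fin d) ℝ).symm :
    (Fin d → ℝ) →L[ℝ] Coord d).hasFDerivAt.comp_hasDerivWithinAt s h

lemma IsGeodesic.hasDerivWithinAt_phase (hγ : IsGeodesic G X u₀ u₁ x y γ) {s : ℝ}
    (hs : s ∈ Set.Icc u₀ u₁) :
    HasDerivWithinAt (phase γ u₀ u₁) (spray G (phase γ u₀ u₁ s)) (Set.Icc u₀ u₁) s :=
  (hγ.hasDerivWithinAt hs).prodMk (hγ.hasDerivWithinAt_velocity hs)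

lemma IsGeodesic.continuousOn_phase (hγ : IsGeodesic G X u₀ u₁ x y γ) :
    ContinuousOn (phase γ u₀ u₁) (Set.Icc u₀ u₁) :=
  fun _ hs => (hγ.hasDerivWithinAt_phase hs).continuousWithinAt

lemma IsGeodesic.mapsTo_phase (hγ : IsGeodesic G X u₀ u₁ x y γ) :
    Set.MapsTo (phase γ u₀ u₁) (Set.Icc u₀ u₁) (X ×ˢ Set.univ) :=
  fun _ hs => ⟨hγ.mapsTo hs, trivial⟩

variable {ι : Type*} [Fintype ι] [DecidableEq ι] {A : Fin d → Coord d → Matrix ι ι ℝ}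

attribute [local instance] Matrix.linftyOpNormedRing Matrix.linftyOpNormedAlgebra

lemma IsGeodesic.continuousOn_pullback (hγ : IsGeodesic G X u₀ u₁ x y γ)
    (hA : ∀ μ a b, ContDiffOn ℝ ∞ (fun ξ => A μ ξ a b) X) :
    ContinuousOn (pullback A u₀ u₁ γ) (Set.Icc u₀ u₁) := by
  have h : ContinuousOn (fun s => contractForm A (phase γ u₀ u₁ s)) (Set.Icc u₀ u₁) :=
    (contDiffOn_contractForm hA).continuousOn.comp hγ.continuousOn_phase hγ.mapsTo_phase
  exact h

lemma IsGeodesic.hasDerivWithinAt_contract (hγ : IsGeodesic G X u₀ u₁ x y γ) (hX : IsOpen X)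
    {k : ℕ} {h : TensorField d ι k} (hh : ∀ κ a b, ContDiffOn ℝ ∞ (fun ξ => h κ ξ a b) X)
    {s : ℝ} (hs : s ∈ Set.Icc u₀ u₁) :
    HasDerivWithinAt (fun r => contract h (phase γ u₀ u₁ r))
      (contract (nabla G h) (phase γ u₀ u₁ s)) (Set.Icc u₀ u₁) s := by
  obtain ⟨D, hD, hDs⟩ := hasFDerivAt_contract G (h := h) (p := phase γ u₀ u₁ s) fun κ a b =>
    ((hh κ a b).differentiableOn (by simp)).differentiableAt (hX.mem_nhds (hγ.mapsTo hs))
  rw [← hDs]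
  exact hD.comp_hasDerivWithinAt s (hγ.hasDerivWithinAt_phase hs)

variable (hX : IsOpen X) (hG : ∀ μ ν, ContDiffOn ℝ ∞ (fun ξ => G ξ μ ν) X)
  (hdet : ∀ ξ ∈ X, (G ξ).det ≠ 0) (hA : ∀ μ a b, ContDiffOn ℝ ∞ (fun ξ => A μ ξ a b) X)
include hX hG hdet hA

/-- The chain is `contract (rightIter G A k) * F`; the term produced by `F' = -a F` is the one that
completes `∇` to the right derivative. -/
lemma IsGeodesic.norm_sub_rightSum_le (hγ : IsGeodesic G X 0 1 x y γ) {F : ℝ → Matrix ι ι ℝ}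
    (hF : ∀ s ∈ Set.Icc (0 : ℝ) 1,
      HasDerivWithinAt F (-(pullback A 0 1 γ s * F s)) (Set.Icc 0 1) s)
    (hF0 : F 0 = 1) (N : ℕ) {C : ℝ} (hC : ∀ s ∈ Set.Icc (0 : ℝ) 1,
      ‖contract (rightIter G A (N + 1)) (phase γ 0 1 s) * F s‖ ≤ C) :
    ‖F 1 - ∑ k ∈ Finset.range (N + 1), (1 / (k.factorial : ℝ)) •
      contract (rightIter G A k) (phase γ 0 1 0)‖ ≤ C / (N.factorial : ℝ) := by
  have hder : ∀ k, ∀ s ∈ Set.Icc (0 : ℝ) 1,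
      HasDerivWithinAt (fun r => contract (rightIter G A k) (phase γ 0 1 r) * F r)
        (contract (rightIter G A (k + 1)) (phase γ 0 1 s) * F s) (Set.Icc 0 1) s := by
    intro k s hs
    refine ((hγ.hasDerivWithinAt_contract hX
      (contDiffOn_rightIter (by simp) hX hG hdet hA k) hs).mul (hF s hs)).congr_deriv ?_
    rw [rightIter, contract_rightD, sub_mul, mul_neg, mul_assoc, sub_eq_add_neg]
    rfl
  have := norm_sub_taylor_zero_le hder N hC
  simpa [hF0, contract, rightIter] using this

/-- The chain is `H * contract (leftIter G A k)`, with `H' = H a` supplying the gauge term. It is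
expanded at time `1` and read at time `0`, whence the signs. -/
lemma IsGeodesic.norm_sub_leftSum_le (hγ : IsGeodesic G X 0 1 x y γ) {H : ℝ → Matrix ι ι ℝ}
    (hH : ∀ s ∈ Set.Icc (0 : ℝ) 1,
      HasDerivWithinAt H (H s * pullback A 0 1 γ s) (Set.Icc 0 1) s)
    (hH1 : H 1 = 1) (N : ℕ) {C : ℝ} (hC : ∀ s ∈ Set.Icc (0 : ℝ) 1,
      ‖H s * contract (leftIter G A (N + 1)) (phase γ 0 1 s)‖ ≤ C) :
    ‖H 0 - ∑ k ∈ Finset.range (N + 1), ((-1) ^ k / (k.factorial : ℝ)) •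
      contract (leftIter G A k) (phase γ 0 1 1)‖ ≤ C / (N.factorial : ℝ) := by
  have hder : ∀ k, ∀ s ∈ Set.Icc (0 : ℝ) 1,
      HasDerivWithinAt (fun r => H r * contract (leftIter G A k) (phase γ 0 1 r))
        (H s * contract (leftIter G A (k + 1)) (phase γ 0 1 s)) (Set.Icc 0 1) s := by
    intro k s hs
    refine ((hH s hs).mul (hγ.hasDerivWithinAt_contract hX
      (contDiffOn_leftIter (by simp) hX hG hdet hA k) hs)).congr_deriv ?_
    rw [leftIter, contract_leftD, mul_add, mul_assoc, add_comm]
    rfl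
  have := norm_sub_taylor_one_le hder N hC
  simpa [hH1, contract, leftIter] using this

end GeodesicChain

/-! ### The metric form and the lowered geodesic equation -/

section MetricForm

variable {d : ℕ}

/-- The bilinear form `g_{μν} v^μ w^ν`. -/
def bform (g : Matrix (Fin d) (Fin d) ℝ) (v w : Coord d) : ℝ := ∑ μ, ∑ ν, g μ ν * v μ * w ν

/-- The derivative of the metric components in the direction `v`. -/
def metricDeriv (G : Coord d → Matrix (Fin d) (Fin d) ℝ) (ξ v : Coord d) :
    Matrix (Fin d) (Fin d) ℝ :=
  Matrix.of fun μ ν => fderiv ℝ (fun η => G η μ ν) ξ v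

lemma bform_comm {g : Matrix (Fin d) (Fin d) ℝ} (hg : g.IsSymm) (v w : Coord d) :
    bform g v w = bform g w v := by
  rw [bform, bform, Finset.sum_comm]
  refine Finset.sum_congr rfl fun μ _ => Finset.sum_congr rfl fun ν _ => ?_
  rw [hg.apply]; ring

lemma sum_metric_christoffel {G : Coord d → Matrix (Fin d) (Fin d) ℝ} {ξ : Coord d}
    (hdet : (G ξ).det ≠ 0) (β μ ν : Fin d) :
    ∑ ρ, G ξ β ρ * christoffel G ρ μ ν ξ =
      (pd ν (fun η => G η β μ) ξ + pd μ (fun η => G η β ν) ξ - pd β (fun η => G η μ ν) ξ) / 2 := by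
  have hinv : ∀ α, ∑ ρ, G ξ β ρ * (G ξ)⁻¹ ρ α = if β = α then 1 else 0 := fun α => by
    rw [← Matrix.mul_apply, Matrix.mul_nonsing_inv _ (isUnit_iff_ne_zero.2 hdet),
      Matrix.one_apply]
  set T : Fin d → ℝ := fun α =>
    pd ν (fun η => G η α μ) ξ + pd μ (fun η => G η α ν) ξ - pd α (fun η => G η μ ν) ξ with hT
  calc ∑ ρ, G ξ β ρ * christoffel G ρ μ ν ξ
      = ∑ ρ, ∑ α, (G ξ β ρ * (G ξ)⁻¹ ρ α) * (T α / 2) := by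
        refine Finset.sum_congr rfl fun ρ _ => ?_
        rw [christoffel, Finset.mul_sum]
        exact Finset.sum_congr rfl fun α _ => by simp only [hT]; ring
    _ = ∑ α, (∑ ρ, G ξ β ρ * (G ξ)⁻¹ ρ α) * (T α / 2) := by
        rw [Finset.sum_comm]
        simp only [Finset.sum_mul]
    _ = T β / 2 := by simp [hinv]

/-- Lowering the index removes the inverse metric from `Γ`; of its three metric derivatives, two
coincide after contraction with `v^μ v^ν`. -/
lemma bform_acceleration {G : Coord d → Matrix (Fin d) (Fin d) ℝ} {ξ : Coord d}
    (hdet : (G ξ).det ≠ 0) (hsymm : (G ξ).IsSymm) (v w : Coord d) :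
    bform (G ξ) (acceleration G (ξ, v)) w =
      -bform (metricDeriv G ξ v) w v + bform (metricDeriv G ξ w) v v / 2 := by
  have h1 : bform (G ξ) (acceleration G (ξ, v)) w = -∑ β, ∑ μ, ∑ ν,
      w β * v μ * v ν * ∑ ρ, G ξ β ρ * christoffel G ρ μ ν ξ := by
    rw [bform_comm hsymm]
    simp only [bform, acceleration, mul_neg, Finset.sum_neg_distrib, Finset.mul_sum, neg_inj]
    refine Finset.sum_congr rfl fun β _ => ?_
    rw [Finset.sum_comm]
    refine Finset.sum_congr rfl fun μ _ => ?_
    rw [Finset.sum_comm]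
    exact Finset.sum_congr rfl fun ν _ => Finset.sum_congr rfl fun ρ _ => by ring
  simp only [sum_metric_christoffel hdet] at h1
  have h2 : ∀ a b c : Coord d, bform (metricDeriv G ξ a) b c =
      ∑ β, ∑ μ, ∑ ν, b β * c μ * a ν * pd ν (fun η => G η β μ) ξ := by
    intro a b c
    refine Finset.sum_congr rfl fun β _ => Finset.sum_congr rfl fun μ _ => ?_
    rw [metricDeriv, Matrix.of_apply, ← sum_mul_pd, Finset.sum_mul, Finset.sum_mul]
    exact Finset.sum_congr rfl fun ν _ => by ring
  have h3 : ∑ β, ∑ μ, ∑ ν, w β * v μ * v ν * pd μ (fun η => G η β ν) ξ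
      = ∑ β, ∑ μ, ∑ ν, w β * v μ * v ν * pd ν (fun η => G η β μ) ξ := by
    refine Finset.sum_congr rfl fun β _ => ?_
    rw [Finset.sum_comm]
    exact Finset.sum_congr rfl fun μ _ => Finset.sum_congr rfl fun ν _ => by ring
  have h4 : ∑ β, ∑ μ, ∑ ν, v β * v μ * w ν * pd ν (fun η => G η β μ) ξ
      = ∑ β, ∑ μ, ∑ ν, w β * v μ * v ν * pd β (fun η => G η μ ν) ξ := by
    calc _ = ∑ β, ∑ ν, ∑ μ, v β * v μ * w ν * pd ν (fun η => G η β μ) ξ :=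
          Finset.sum_congr rfl fun β _ => Finset.sum_comm
      _ = ∑ ν, ∑ β, ∑ μ, v β * v μ * w ν * pd ν (fun η => G η β μ) ξ := Finset.sum_comm
      _ = _ := Finset.sum_congr rfl fun ν _ => Finset.sum_congr rfl fun β _ =>
          Finset.sum_congr rfl fun μ _ => by ring
  rw [h1, h2, h2, h4]
  have h5 : ∑ β, ∑ μ, ∑ ν, w β * v μ * v ν * ((pd ν (fun η => G η β μ) ξ +
      pd μ (fun η => G η β ν) ξ - pd β (fun η => G η μ ν) ξ) / 2) =
      (∑ β, ∑ μ, ∑ ν, w β * v μ * v ν * pd ν (fun η => G η β μ) ξ +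
      ∑ β, ∑ μ, ∑ ν, w β * v μ * v ν * pd μ (fun η => G η β ν) ξ -
      ∑ β, ∑ μ, ∑ ν, w β * v μ * v ν * pd β (fun η => G η μ ν) ξ) / 2 := by
    simp only [← Finset.sum_add_distrib, ← Finset.sum_sub_distrib, Finset.sum_div]
    exact Finset.sum_congr rfl fun β _ => Finset.sum_congr rfl fun μ _ =>
      Finset.sum_congr rfl fun ν _ => by ring
  rw [h5, h3]
  ring

lemma hasDerivWithinAt_coord {a : ℝ → Coord d} {a' : Coord d} {S : Set ℝ} {s : ℝ}
    (ha : HasDerivWithinAt a a' S s) (μ : Fin d) : HasDerivWithinAt (fun r => a r μ) (a' μ) S s :=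
  (EuclideanSpace.proj μ : Coord d →L[ℝ] ℝ).hasFDerivAt.comp_hasDerivWithinAt s ha

lemma hasDerivWithinAt_bform {G : Coord d → Matrix (Fin d) (Fin d) ℝ} {γ a b : ℝ → Coord d}
    {γ' a' b' : Coord d} {S : Set ℝ} {s : ℝ}
    (hG : ∀ μ ν, DifferentiableAt ℝ (fun ξ => G ξ μ ν) (γ s))
    (hγ : HasDerivWithinAt γ γ' S s) (ha : HasDerivWithinAt a a' S s)
    (hb : HasDerivWithinAt b b' S s) :
    HasDerivWithinAt (fun r => bform (G (γ r)) (a r) (b r))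
      (bform (metricDeriv G (γ s) γ') (a s) (b s) + bform (G (γ s)) a' (b s) +
        bform (G (γ s)) (a s) b') S s := by
  have h := HasDerivWithinAt.fun_sum (u := Finset.univ) fun μ _ =>
    HasDerivWithinAt.fun_sum (u := Finset.univ) fun ν _ =>
      (((hG μ ν).hasFDerivAt.comp_hasDerivWithinAt s hγ).mul (hasDerivWithinAt_coord ha μ)).mul
        (hasDerivWithinAt_coord hb ν)
  refine h.congr_deriv ?_
  simp only [bform, metricDeriv, Matrix.of_apply, ← Finset.sum_add_distrib]
  exact Finset.sum_congr rfl fun μ _ => Finset.sum_congr rfl fun ν _ => by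
    simp only [Function.comp_apply, Pi.mul_apply]; ring

end MetricForm

/-! ### Conservation of speed along geodesics -/

section Energy

variable {d : ℕ} {X : Set (Coord d)} {G : Coord d → Matrix (Fin d) (Fin d) ℝ}
  {u₀ u₁ : ℝ} {x y : Coord d} {γ : ℝ → Coord d}

lemma differentiableAt_metric (hX : IsOpen X) (hG : ∀ μ ν, ContDiffOn ℝ ∞ (fun ξ => G ξ μ ν) X)
    {ξ : Coord d} (hξ : ξ ∈ X) (μ ν : Fin d) : DifferentiableAt ℝ (fun η => G η μ ν) ξ :=
  ((hG μ ν).differentiableOn (by simp)).differentiableAt (hX.mem_nhds hξ)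

variable (hX : IsOpen X) (hG : ∀ μ ν, ContDiffOn ℝ ∞ (fun ξ => G ξ μ ν) X)
  (hpos : ∀ ξ ∈ X, (G ξ).PosDef)
include hX hG hpos

omit hX hG in
lemma metric_isSymm {ξ : Coord d} (hξ : ξ ∈ X) : (G ξ).IsSymm :=
  Matrix.isHermitian_iff_isSymm.1 (hpos ξ hξ).isHermitian

/-- The derivative of `g(γ̇, V)` along a geodesic `γ`. -/
lemma IsGeodesic.hasDerivWithinAt_bform_velocity (hγ : IsGeodesic G X u₀ u₁ x y γ) {s : ℝ}
    (hs : s ∈ Set.Icc u₀ u₁) {V : ℝ → Coord d} {V' : Coord d} {S : Set ℝ}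
    (hS : S ⊆ Set.Icc u₀ u₁) (hV : HasDerivWithinAt V V' S s) :
    HasDerivWithinAt (fun r => bform (G (γ r)) (velocity γ u₀ u₁ r) (V r))
      (bform (metricDeriv G (γ s) (V s)) (velocity γ u₀ u₁ s) (velocity γ u₀ u₁ s) / 2 +
        bform (G (γ s)) (velocity γ u₀ u₁ s) V') S s := by
  have hξ := hγ.mapsTo hs
  refine (hasDerivWithinAt_bform (differentiableAt_metric hX hG hξ)
    ((hγ.hasDerivWithinAt hs).mono hS) ((hγ.hasDerivWithinAt_velocity hs).mono hS) hV).congr_deriv ?_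
  have hsymm : (metricDeriv G (γ s) (velocity γ u₀ u₁ s)).IsSymm := by
    ext μ ν
    have : (fun η => G η ν μ) =ᶠ[nhds (γ s)] fun η => G η μ ν := by
      filter_upwards [hX.mem_nhds hξ] with η hη
      exact (metric_isSymm hpos hη).apply μ ν
    simp only [Matrix.transpose_apply, metricDeriv, Matrix.of_apply, this.fderiv_eq]
  -- The acceleration term cancels `(∂_γ̇ g)(γ̇, V)` and leaves `(∂_V g)(γ̇, γ̇) / 2`.
  rw [phase, bform_acceleration (hpos _ hξ).det_pos.ne' (metric_isSymm hpos hξ),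
    bform_comm hsymm (V s)]
  ring

/-- Take `V = γ̇` in the preceding formula; by the geodesic equation `g(γ̇, γ̈)` is minus half of
`(∂_γ̇ g)(γ̇, γ̇)`. -/
lemma IsGeodesic.bform_velocity_const (hγ : IsGeodesic G X u₀ u₁ x y γ) {s r : ℝ}
    (hs : s ∈ Set.Icc u₀ u₁) (hr : r ∈ Set.Icc u₀ u₁) :
    bform (G (γ s)) (velocity γ u₀ u₁ s) (velocity γ u₀ u₁ s) =
      bform (G (γ r)) (velocity γ u₀ u₁ r) (velocity γ u₀ u₁ r) := by
  refine eq_of_hasDerivWithinAt_zero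
    (f := fun s => bform (G (γ s)) (velocity γ u₀ u₁ s) (velocity γ u₀ u₁ s)) (fun s hs => ?_) hs hr
  have hξ := hγ.mapsTo hs
  refine (hγ.hasDerivWithinAt_bform_velocity hX hG hpos hs subset_rfl
    (hγ.hasDerivWithinAt_velocity hs)).congr_deriv ?_
  rw [bform_comm (metric_isSymm hpos hξ), phase,
    bform_acceleration (hpos _ hξ).det_pos.ne' (metric_isSymm hpos hξ)]
  ring

omit hX hG in
lemma bform_self_nonneg {ξ : Coord d} (hξ : ξ ∈ X) (v : Coord d) : 0 ≤ bform (G ξ) v v := by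
  have := (hpos ξ hξ).posSemidef.dotProduct_mulVec_nonneg v.ofLp
  refine this.trans_eq ?_
  simp only [bform, dotProduct, Matrix.mulVec, Finset.mul_sum]
  exact Finset.sum_congr rfl fun μ _ => Finset.sum_congr rfl fun ν _ => by simp; ring

omit hX hG in
lemma bform_self_pos {ξ : Coord d} (hξ : ξ ∈ X) {v : Coord d} (hv : v ≠ 0) :
    0 < bform (G ξ) v v := by
  have hv' : v.ofLp ≠ 0 := by simpa using hv
  have := (hpos ξ hξ).dotProduct_mulVec_pos hv'
  refine this.trans_eq ?_
  simp only [bform, dotProduct, Matrix.mulVec, Finset.mul_sum]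
  exact Finset.sum_congr rfl fun μ _ => Finset.sum_congr rfl fun ν _ => by simp; ring

lemma IsGeodesic.curveLength_sq (hγ : IsGeodesic G X 0 1 x y γ) {s : ℝ}
    (hs : s ∈ Set.Icc (0 : ℝ) 1) :
    curveLength G 0 1 γ ^ 2 = bform (G (γ s)) (velocity γ 0 1 s) (velocity γ 0 1 s) := by
  have h : curveLength G 0 1 γ =
      ∫ _ in (0 : ℝ)..1, Real.sqrt (bform (G (γ s)) (velocity γ 0 1 s) (velocity γ 0 1 s)) := by
    refine intervalIntegral.integral_congr fun r hr => ?_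
    rw [Set.uIcc_of_le zero_le_one] at hr
    simp only
    rw [← hγ.bform_velocity_const hX hG hpos hr hs]
    rfl
  rw [h]
  simp [Real.sq_sqrt (bform_self_nonneg hpos (hγ.mapsTo hs) _)]

end Energy

/-! ### The first variation of the world function -/

section FirstVariation

variable {d : ℕ} {X : Set (Coord d)} {G : Coord d → Matrix (Fin d) (Fin d) ℝ}

/-- The domain of the two-point geodesic map. -/
abbrev flowDomain (X : Set (Coord d)) : Set ((Coord d × Coord d) × ℝ) :=
  (X ×ˢ X) ×ˢ Set.Icc (0 : ℝ) 1

lemma uniqueDiffOn_flowDomain (hX : IsOpen X) : UniqueDiffOn ℝ (flowDomain X) :=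
  (hX.prod hX).uniqueDiffOn.prod (uniqueDiffOn_Icc zero_lt_one)

/-- `C (x, y) s` is the unique geodesic from `y` to `x` in `X`, and depends smoothly on all its
arguments. -/
structure IsGeodesicMap (G : Coord d → Matrix (Fin d) (Fin d) ℝ) (X : Set (Coord d))
    (C : (Coord d × Coord d) × ℝ → Coord d) : Prop where
  isGeodesic : ∀ q ∈ X ×ˢ X, IsGeodesic G X 0 1 q.1 q.2 fun s => C (q, s)
  unique : ∀ q ∈ X ×ˢ X, ∀ γ, IsGeodesic G X 0 1 q.1 q.2 γ →
    Set.EqOn γ (fun s => C (q, s)) (Set.Icc 0 1)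
  contDiffOn : ContDiffOn ℝ ∞ C (flowDomain X)

lemma IsConvexDomain.exists_isGeodesicMap (h : IsConvexDomain G X) :
    ∃ C, IsGeodesicMap G X C := by
  obtain ⟨-, c, hc, hs⟩ := h
  exact ⟨fun q => c q.1.1 q.1.2 q.2, fun q hq => (hc _ hq.1 _ hq.2).1,
    fun q hq => (hc _ hq.1 _ hq.2).2, hs⟩

lemma velocity_congr {γ γ' : ℝ → Coord d} {u₀ u₁ : ℝ} (h : Set.EqOn γ γ' (Set.Icc u₀ u₁)) {s : ℝ}
    (hs : s ∈ Set.Icc u₀ u₁) : velocity γ u₀ u₁ s = velocity γ' u₀ u₁ s :=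
  derivWithin_congr h (h hs)

variable {C : (Coord d × Coord d) × ℝ → Coord d}

lemma IsGeodesicMap.isGeodesic_geodesic (hC : IsGeodesicMap G X C) {x y : Coord d} (hx : x ∈ X)
    (hy : y ∈ X) : IsGeodesic G X 0 1 x y (geodesic G X x y) := by
  have h : ∃ γ, IsGeodesic G X 0 1 x y γ := ⟨_, hC.isGeodesic (x, y) ⟨hx, hy⟩⟩
  rw [geodesic, dif_pos h]
  exact h.choose_spec

lemma IsGeodesicMap.eqOn_geodesic (hC : IsGeodesicMap G X C) {x y : Coord d} (hx : x ∈ X)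
    (hy : y ∈ X) : Set.EqOn (geodesic G X x y) (fun s => C ((x, y), s)) (Set.Icc 0 1) :=
  hC.unique (x, y) ⟨hx, hy⟩ _ (hC.isGeodesic_geodesic hx hy)

/-- The velocity of the geodesic `C (q, ·)`. -/
def flowVelocity (X : Set (Coord d)) (C : (Coord d × Coord d) × ℝ → Coord d)
    (Q : (Coord d × Coord d) × ℝ) : Coord d :=
  fderivWithin ℝ C (flowDomain X) Q (0, 1)

lemma IsGeodesicMap.hasFDerivWithinAt (hC : IsGeodesicMap G X C) {Q : (Coord d × Coord d) × ℝ}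
    (hQ : Q ∈ flowDomain X) :
    HasFDerivWithinAt C (fderivWithin ℝ C (flowDomain X) Q) (flowDomain X) Q :=
  (hC.contDiffOn.differentiableOn (by simp) Q hQ).hasFDerivWithinAt

lemma IsGeodesicMap.velocity_eq (hC : IsGeodesicMap G X C) {q : Coord d × Coord d}
    (hq : q ∈ X ×ˢ X) {s : ℝ} (hs : s ∈ Set.Icc (0 : ℝ) 1) :
    velocity (fun r => C (q, r)) 0 1 s = flowVelocity X C (q, s) := by
  have h1 : HasDerivWithinAt (fun r : ℝ => (q, r)) (0, 1) (Set.Icc 0 1) s :=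
    (hasDerivWithinAt_const s _ q).prodMk (hasDerivWithinAt_id s _)
  exact ((hC.hasFDerivWithinAt (Q := (q, s)) ⟨hq, hs⟩).comp_hasDerivWithinAt s h1
    fun r hr => ⟨hq, hr⟩).derivWithin (uniqueDiffOn_Icc zero_lt_one s hs)

lemma IsGeodesicMap.contDiffOn_flowVelocity (hC : IsGeodesicMap G X C) (hX : IsOpen X) :
    ContDiffOn ℝ ∞ (flowVelocity X C) (flowDomain X) :=
  (hC.contDiffOn.fderivWithin (uniqueDiffOn_flowDomain hX) (by simp)).clm_apply contDiffOn_const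

lemma IsGeodesicMap.velocity_geodesic (hC : IsGeodesicMap G X C) {x y : Coord d} (hx : x ∈ X)
    (hy : y ∈ X) {s : ℝ} (hs : s ∈ Set.Icc (0 : ℝ) 1) :
    velocity (geodesic G X x y) 0 1 s = flowVelocity X C ((x, y), s) := by
  rw [velocity_congr (hC.eqOn_geodesic hx hy) hs, hC.velocity_eq (q := (x, y)) ⟨hx, hy⟩ hs]

lemma IsGeodesicMap.mapsTo (hC : IsGeodesicMap G X C) : Set.MapsTo C (flowDomain X) X :=
  fun Q hQ => (hC.isGeodesic Q.1 hQ.1).mapsTo hQ.2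

variable (hX : IsOpen X) (hG : ∀ μ ν, ContDiffOn ℝ ∞ (fun ξ => G ξ μ ν) X)
  (hpos : ∀ ξ ∈ X, (G ξ).PosDef)
include hX hG hpos

/-- Constancy of the speed allows evaluation at any time `s`; interior times leave room for
two-sided derivatives. -/
lemma IsGeodesicMap.synge_eq (hC : IsGeodesicMap G X C) {x y : Coord d} (hx : x ∈ X)
    (hy : y ∈ X) {s : ℝ} (hs : s ∈ Set.Icc (0 : ℝ) 1) :
    synge G X x y = bform (G (C ((x, y), s))) (flowVelocity X C ((x, y), s))
      (flowVelocity X C ((x, y), s)) / 2 := by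
  rw [synge, (hC.isGeodesic_geodesic hx hy).curveLength_sq hX hG hpos hs,
    hC.velocity_geodesic hx hy hs, hC.eqOn_geodesic hx hy hs]

omit hX hpos in
lemma continuousOn_bform {E : Type*} [TopologicalSpace E] {S : Set E} {f v w : E → Coord d}
    (hf : ContinuousOn f S) (hfX : Set.MapsTo f S X) (hv : ContinuousOn v S)
    (hw : ContinuousOn w S) : ContinuousOn (fun p => bform (G (f p)) (v p) (w p)) S := by
  have hcoord : ∀ {v : E → Coord d}, ContinuousOn v S → ∀ μ, ContinuousOn (fun p => v p μ) S :=
    fun hv μ => (EuclideanSpace.proj μ : Coord d →L[ℝ] ℝ).continuous.comp_continuousOn hv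
  exact continuousOn_finsetSum _ fun μ _ => continuousOn_finsetSum _ fun ν _ =>
    (((hG μ ν).continuousOn.comp hf hfX).mul (hcoord hv μ)).mul (hcoord hw ν)

lemma IsGeodesicMap.differentiableAt_synge (hC : IsGeodesicMap G X C) {q : Coord d × Coord d}
    (hq : q ∈ X ×ˢ X) : DifferentiableAt ℝ (fun q => synge G X q.1 q.2) q := by
  -- Any fixed time in the interval would serve.
  have hh : (1 / 2 : ℝ) ∈ Set.Icc (0 : ℝ) 1 := by constructor <;> norm_num
  have hmaps : Set.MapsTo (fun q : Coord d × Coord d => (q, (1 / 2 : ℝ))) (X ×ˢ X) (flowDomain X) :=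
    fun q hq => ⟨hq, hh⟩
  have hj : DifferentiableOn ℝ (fun q : Coord d × Coord d => (q, (1 / 2 : ℝ))) (X ×ˢ X) := by
    fun_prop
  have h1 : DifferentiableOn ℝ (fun q => C (q, (1 / 2 : ℝ))) (X ×ˢ X) :=
    (hC.contDiffOn.differentiableOn (by simp)).comp hj hmaps
  have h2 : ∀ μ, DifferentiableOn ℝ (fun q => flowVelocity X C (q, (1 / 2 : ℝ)) μ) (X ×ˢ X) :=
    fun μ => (EuclideanSpace.proj μ : Coord d →L[ℝ] ℝ).differentiable.comp_differentiableOn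
      (((hC.contDiffOn_flowVelocity hX).differentiableOn (by simp)).comp hj hmaps)
  have h3 : ∀ μ ν, DifferentiableOn ℝ (fun q => G (C (q, (1 / 2 : ℝ))) μ ν) (X ×ˢ X) :=
    fun μ ν => ((hG μ ν).differentiableOn (by simp)).comp h1 fun q hq => hC.mapsTo (hmaps hq)
  have h4 : DifferentiableOn ℝ (fun q : Coord d × Coord d => synge G X q.1 q.2) (X ×ˢ X) := by
    have : DifferentiableOn ℝ (fun q : Coord d × Coord d => bform (G (C (q, (1 / 2 : ℝ))))
        (flowVelocity X C (q, (1 / 2 : ℝ))) (flowVelocity X C (q, (1 / 2 : ℝ)))) (X ×ˢ X) :=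
      DifferentiableOn.fun_sum fun μ _ => DifferentiableOn.fun_sum fun ν _ =>
        ((h3 μ ν).mul (h2 μ)).mul (h2 ν)
    refine (this.mul (differentiableOn_const (1 / 2 : ℝ))).congr fun q hq => ?_
    rw [Pi.mul_apply, mul_one_div]
    exact hC.synge_eq hX hG hpos (x := q.1) (y := q.2) hq.1 hq.2 hh
  exact h4.differentiableAt ((hX.prod hX).mem_nhds hq)

omit hG hpos in
lemma flowDomain_mem_nhds {q : Coord d × Coord d} (hq : q ∈ X ×ˢ X) {s : ℝ}
    (hs : s ∈ Set.Ioo (0 : ℝ) 1) : flowDomain X ∈ nhds (q, s) :=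
  prod_mem_nhds ((hX.prod hX).mem_nhds hq) (Icc_mem_nhds hs.1 hs.2)

omit hG hpos in
lemma eventually_flowVelocity {q : Coord d × Coord d} (hq : q ∈ X ×ˢ X) {s : ℝ}
    (hs : s ∈ Set.Ioo (0 : ℝ) 1) : fderivWithin ℝ C (flowDomain X) =ᶠ[nhds (q, s)] fderiv ℝ C := by
  filter_upwards [eventually_mem_nhds_iff.2 (flowDomain_mem_nhds hX hq hs)] with Q hQ
  exact fderivWithin_of_mem_nhds hQ

omit hG hpos in
/-- The mixed second derivatives of the geodesic map, at interior times. -/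
lemma IsGeodesicMap.exists_mixed_deriv (hC : IsGeodesicMap G X C) {q : Coord d × Coord d}
    (hq : q ∈ X ×ˢ X) {s : ℝ} (hs : s ∈ Set.Ioo (0 : ℝ) 1) (w : Coord d × Coord d) :
    ∃ V' : Coord d,
      HasDerivAt (fun r => fderivWithin ℝ C (flowDomain X) (q, r) (w, 0)) V' s ∧
      HasDerivAt (fun τ : ℝ => flowVelocity X C (q + τ • w, s)) V' 0 ∧
      HasDerivAt (fun τ : ℝ => C (q + τ • w, s))
        (fderivWithin ℝ C (flowDomain X) (q, s) (w, 0)) 0 := by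
  have hev := eventually_flowVelocity (C := C) hX hq hs
  have hcd : ContDiffAt ℝ ∞ C (q, s) :=
    hC.contDiffOn.contDiffAt (flowDomain_mem_nhds hX hq hs)
  -- At an interior time `C` is smooth in a full neighbourhood, so its second derivative is
  -- symmetric and the two mixed derivatives are the same vector `V'`.
  have hsymm : IsSymmSndFDerivAt ℝ C (q, s) := hcd.isSymmSndFDerivAt (by
    rw [minSmoothness_of_isRCLikeNormedField]; exact ENat.LEInfty.out)
  have hD : HasFDerivAt (fderivWithin ℝ C (flowDomain X)) (fderiv ℝ (fderiv ℝ C) (q, s)) (q, s) :=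
    (((hcd.fderiv_right (m := ∞) (by simp)).differentiableAt (by simp)).hasFDerivAt).congr_of_eventuallyEq
      hev
  have hr : HasDerivAt (fun r : ℝ => (q, r)) (0, 1) s :=
    (hasDerivAt_const s q).prodMk (hasDerivAt_id s)
  have hτ : HasDerivAt (fun τ : ℝ => (q + τ • w, s)) (w, 0) 0 := by
    have := (((hasDerivAt_id (0 : ℝ)).smul_const w).const_add q).prodMk (hasDerivAt_const (0 : ℝ) s)
    simpa using this
  have e0 : (q + (0 : ℝ) • w, s) = (q, s) := by simp
  have hD0 : HasFDerivAt (fderivWithin ℝ C (flowDomain X)) (fderiv ℝ (fderiv ℝ C) (q, s))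
      (q + (0 : ℝ) • w, s) := by rwa [e0]
  refine ⟨fderiv ℝ (fderiv ℝ C) (q, s) (0, 1) (w, 0), ?_, ?_, ?_⟩
  · exact ((ContinuousLinearMap.apply ℝ (Coord d) ((w, 0) : (Coord d × Coord d) × ℝ)).hasFDerivAt.comp_hasDerivAt
      s (hD.comp_hasDerivAt s hr))
  · rw [hsymm.eq]
    exact ((ContinuousLinearMap.apply ℝ (Coord d) ((0, 1) : (Coord d × Coord d) × ℝ)).hasFDerivAt.comp_hasDerivAt
      0 (hD0.comp_hasDerivAt 0 hτ))
  · have : HasFDerivAt C (fderivWithin ℝ C (flowDomain X) (q, s)) (q + (0 : ℝ) • w, s) := by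
      rw [e0, hev.eq_of_nhds]
      exact (hcd.differentiableAt (by simp)).hasFDerivAt
    exact this.comp_hasDerivAt 0 hτ

/-- The first variation of the world function. -/
lemma IsGeodesicMap.fderiv_synge (hC : IsGeodesicMap G X C) {x y : Coord d} (hx : x ∈ X)
    (hy : y ∈ X) (w : Coord d × Coord d) :
    fderiv ℝ (fun q : Coord d × Coord d => synge G X q.1 q.2) (x, y) w =
      bform (G x) (flowVelocity X C ((x, y), 1)) w.1 -
      bform (G y) (flowVelocity X C ((x, y), 0)) w.2 := by
  set q : Coord d × Coord d := (x, y) with hqdef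
  have hq : q ∈ X ×ˢ X := ⟨hx, hy⟩
  have hγ := hC.isGeodesic q hq
  set V : ℝ → Coord d := fun s => fderivWithin ℝ C (flowDomain X) (q, s) (w, 0) with hV
  set p : ℝ → ℝ := fun s => bform (G (C (q, s))) (flowVelocity X C (q, s)) (V s) with hp
  have hjc : ContinuousOn (fun s : ℝ => (q, s)) (Set.Icc 0 1) := by fun_prop
  have hjm : Set.MapsTo (fun s : ℝ => (q, s)) (Set.Icc 0 1) (flowDomain X) := fun s hs => ⟨hq, hs⟩
  have hpc : ContinuousOn p (Set.Icc 0 1) := by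
    refine continuousOn_bform hG (hC.contDiffOn.continuousOn.comp hjc hjm)
      (fun s hs => hC.mapsTo (hjm hs))
      ((hC.contDiffOn_flowVelocity hX).continuousOn.comp hjc hjm) ?_
    exact ((hC.contDiffOn.continuousOn_fderivWithin (uniqueDiffOn_flowDomain hX)
      (by simp)).clm_apply continuousOn_const).comp hjc hjm
  -- The derivative of `p = g(γ̇, V)` does not depend on `s`. It equals the derivative of `g(γ̇, γ̇)
  -- / 2` at time `s` in the direction `w`, and this expression is the world function whatever `s`
  -- is.
  have hpd : ∀ s ∈ Set.Ioo (0 : ℝ) 1, HasDerivAt p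
      (fderiv ℝ (fun q : Coord d × Coord d => synge G X q.1 q.2) q w) s := by
    intro s hs
    have hs' := Set.Ioo_subset_Icc_self hs
    obtain ⟨V', hV1, hV2, hV3⟩ := hC.exists_mixed_deriv hX hq hs w
    have h1 := hγ.hasDerivWithinAt_bform_velocity hX hG hpos hs' Set.Ioo_subset_Icc_self
      (hV1.hasDerivWithinAt (s := Set.Ioo 0 1))
    have h2 : HasDerivAt p (bform (metricDeriv G (C (q, s)) (V s)) (flowVelocity X C (q, s))
        (flowVelocity X C (q, s)) / 2 + bform (G (C (q, s))) (flowVelocity X C (q, s)) V') s := by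
      rw [← hC.velocity_eq hq hs']
      refine (h1.congr (fun r hr => ?_) ?_).hasDerivAt (isOpen_Ioo.mem_nhds hs)
      · rw [hC.velocity_eq hq (Set.Ioo_subset_Icc_self hr)]
      · rw [hC.velocity_eq hq hs']
    convert h2 using 1
    have hCs : C (q + (0 : ℝ) • w, s) = C (q, s) := by simp
    have hvs : flowVelocity X C (q + (0 : ℝ) • w, s) = flowVelocity X C (q, s) := by simp
    have hξ : C (q, s) ∈ X := hC.mapsTo (hjm hs')
    have h3 := (hasDerivWithinAt_bform (G := G) (S := Set.univ)
      (fun μ ν => by rw [hCs]; exact differentiableAt_metric hX hG hξ μ ν)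
      hV3.hasDerivWithinAt hV2.hasDerivWithinAt hV2.hasDerivWithinAt).div_const 2
    rw [hasDerivWithinAt_univ] at h3
    simp only [hCs, hvs] at h3
    have hline : HasDerivAt (fun τ : ℝ => q + τ • w) w 0 := by
      simpa using ((hasDerivAt_id (0 : ℝ)).smul_const w).const_add q
    have h4 : HasDerivAt (fun τ : ℝ => synge G X (q + τ • w).1 (q + τ • w).2)
        (fderiv ℝ (fun q : Coord d × Coord d => synge G X q.1 q.2) q w) 0 := by
      have : HasFDerivAt (fun q : Coord d × Coord d => synge G X q.1 q.2)
          (fderiv ℝ (fun q : Coord d × Coord d => synge G X q.1 q.2) q) (q + (0 : ℝ) • w) := by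
        rw [zero_smul, add_zero]
        exact (hC.differentiableAt_synge hX hG hpos hq).hasFDerivAt
      exact this.comp_hasDerivAt 0 hline
    have hev : (fun τ : ℝ => synge G X (q + τ • w).1 (q + τ • w).2) =ᶠ[nhds 0] fun τ =>
        bform (G (C (q + τ • w, s))) (flowVelocity X C (q + τ • w, s))
          (flowVelocity X C (q + τ • w, s)) / 2 := by
      have : ∀ᶠ τ : ℝ in nhds 0, q + τ • w ∈ X ×ˢ X :=
        hline.continuousAt.eventually_mem (by simpa using (hX.prod hX).mem_nhds hq)
      filter_upwards [this] with τ hτ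
      exact hC.synge_eq hX hG hpos hτ.1 hτ.2 hs'
    rw [(h4.congr_of_eventuallyEq hev.symm).unique h3,
      bform_comm (metric_isSymm hpos hξ) V']
    ring
  -- As the derivative is constant on the open interval, the mean value theorem gives `p 1 - p 0`
  -- without derivatives at the end times.
  obtain ⟨s, hs, hs'⟩ := exists_hasDerivAt_eq_slope p _ zero_lt_one hpc hpd
  rw [hs', sub_zero, div_one]
  -- At times `1` and `0` the geodesic map is the projection to `x` or `y`, hence its own
  -- derivative; this evaluates `V` at both ends.
  have hend : ∀ s ∈ Set.Icc (0 : ℝ) 1, ∀ L : Coord d × Coord d →L[ℝ] Coord d,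
      Set.EqOn (fun q => C (q, s)) L (X ×ˢ X) → V s = L w := by
    intro s hs L hL
    have h1 : HasFDerivWithinAt (fun q : Coord d × Coord d => (q, s))
        (ContinuousLinearMap.inl ℝ (Coord d × Coord d) ℝ) (X ×ˢ X) q := by
      have := ((hasFDerivAt_id (𝕜 := ℝ) q).prodMk (hasFDerivAt_const (𝕜 := ℝ) s q)).hasFDerivWithinAt
        (s := X ×ˢ X)
      exact this
    have hm : Set.MapsTo (fun q : Coord d × Coord d => (q, s)) (X ×ˢ X) (flowDomain X) :=
      fun r hr => ⟨hr, hs⟩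
    have h2 := (hC.hasFDerivWithinAt (Q := (q, s)) ⟨hq, hs⟩).comp q h1 hm
    have h3 : HasFDerivWithinAt L _ (X ×ˢ X) q := h2.congr (fun r hr => (hL hr).symm) (hL hq).symm
    have h4 := ((hX.prod hX).uniqueDiffOn q hq).eq (L.hasFDerivAt.hasFDerivWithinAt) h3
    rw [h4]
    rfl
  have hC1 : C (q, 1) = x := hγ.finish
  have hC0 : C (q, 0) = y := hγ.start
  have hV1 : V 1 = w.1 := hend 1 (Set.right_mem_Icc.2 zero_le_one)
    (ContinuousLinearMap.fst ℝ _ _) fun r hr => (hC.isGeodesic r hr).finish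
  have hV0 : V 0 = w.2 := hend 0 (Set.left_mem_Icc.2 zero_le_one)
    (ContinuousLinearMap.snd ℝ _ _) fun r hr => (hC.isGeodesic r hr).start
  simp only [hp, hC1, hC0, hV1, hV0]

omit hX hG in
lemma sum_inv_bform {ξ : Coord d} (hξ : ξ ∈ X) (v : Coord d) (ρ : Fin d) :
    ∑ ν, (G ξ)⁻¹ ρ ν * bform (G ξ) v (EuclideanSpace.single ν 1) = v ρ := by
  have h1 : ∀ ν, bform (G ξ) v (EuclideanSpace.single ν 1) = (G ξ).mulVec v.ofLp ν := by
    intro ν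
    simp only [bform, Matrix.mulVec, dotProduct]
    refine Finset.sum_congr rfl fun μ _ => ?_
    rw [Finset.sum_eq_single ν]
    · simp [(metric_isSymm hpos hξ).apply]
    · intro b _ hb; simp [hb]
    · simp
  simp only [h1]
  change ((G ξ)⁻¹.mulVec ((G ξ).mulVec v.ofLp)) ρ = _
  rw [Matrix.mulVec_mulVec, Matrix.nonsing_inv_mul _ (isUnit_iff_ne_zero.2 (hpos ξ hξ).det_pos.ne'),
    Matrix.one_mulVec]

/-- First variation in the directions `(e_ν, 0)`; raising the index recovers the velocity. -/
lemma IsGeodesicMap.syngeUp_eq (hC : IsGeodesicMap G X C) {x y : Coord d} (hx : x ∈ X)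
    (hy : y ∈ X) (ρ : Fin d) : syngeUp G X ρ x y = velocity (geodesic G X x y) 0 1 1 ρ := by
  rw [hC.velocity_geodesic hx hy (Set.right_mem_Icc.2 zero_le_one), syngeUp,
    ← sum_inv_bform hpos hx (flowVelocity X C ((x, y), 1)) ρ]
  refine Finset.sum_congr rfl fun ν _ => ?_
  congr 1
  have h1 : HasFDerivAt (fun η : Coord d => (η, y)) (ContinuousLinearMap.inl ℝ _ _) x :=
    hasFDerivAt_prodMk_left x y
  have h2 := (hC.differentiableAt_synge hX hG hpos (q := (x, y)) ⟨hx, hy⟩).hasFDerivAt.comp x h1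
  have h3 : fderiv ℝ (fun η => synge G X η y) x = _ := h2.fderiv
  rw [pd, h3, ContinuousLinearMap.comp_apply, hC.fderiv_synge hX hG hpos hx hy]
  simp [bform]

/-- First variation in the directions `(0, e_ν)`; the boundary term at `y` carries the minus sign.
-/
lemma IsGeodesicMap.syngeUp'_eq (hC : IsGeodesicMap G X C) {x y : Coord d} (hx : x ∈ X)
    (hy : y ∈ X) (ρ : Fin d) : syngeUp' G X ρ x y = -velocity (geodesic G X x y) 0 1 0 ρ := by
  rw [hC.velocity_geodesic hx hy (Set.left_mem_Icc.2 zero_le_one), syngeUp',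
    ← sum_inv_bform hpos hy (flowVelocity X C ((x, y), 0)) ρ, ← Finset.sum_neg_distrib]
  refine Finset.sum_congr rfl fun ν _ => ?_
  have hinv : ((G y)⁻¹).IsSymm := by
    rw [Matrix.IsSymm, Matrix.transpose_nonsing_inv, (metric_isSymm hpos hy).eq]
  have h1 : HasFDerivAt (fun η : Coord d => (x, η)) (ContinuousLinearMap.inr ℝ _ _) y :=
    hasFDerivAt_prodMk_right x y
  have h2 := (hC.differentiableAt_synge hX hG hpos (q := (x, y)) ⟨hx, hy⟩).hasFDerivAt.comp y h1
  have h3 : fderiv ℝ (fun η => synge G X x η) y = _ := h2.fderiv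
  rw [pd, h3, ContinuousLinearMap.comp_apply, hC.fderiv_synge hX hG hpos hx hy, hinv.apply]
  simp [bform, mul_comm]

end FirstVariation

/-! ### Reparameterization and the uniform expansions -/

section Expansion

variable {d : ℕ} {X : Set (Coord d)} {G : Coord d → Matrix (Fin d) (Fin d) ℝ}

/-- Reparameterization of a geodesic on `[u₀, u₁]` to the unit interval. -/
lemma IsGeodesic.rescale {u₀ u₁ : ℝ} (hu : u₀ < u₁) {x y : Coord d} {γ : ℝ → Coord d}
    (hγ : IsGeodesic G X u₀ u₁ x y γ) :
    IsGeodesic G X 0 1 x y (fun s => γ (u₀ + (u₁ - u₀) * s)) ∧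
    ∀ s ∈ Set.Icc (0 : ℝ) 1, velocity (fun s => γ (u₀ + (u₁ - u₀) * s)) 0 1 s =
      (u₁ - u₀) • velocity γ u₀ u₁ (u₀ + (u₁ - u₀) * s) := by
  have hL : 0 < u₁ - u₀ := sub_pos.2 hu
  have hm : Set.MapsTo (fun s => u₀ + (u₁ - u₀) * s) (Set.Icc 0 1) (Set.Icc u₀ u₁) :=
    fun s hs => ⟨by nlinarith [hs.1], by nlinarith [hs.2]⟩
  have hd : ∀ s, HasDerivWithinAt (fun s => u₀ + (u₁ - u₀) * s) (u₁ - u₀) (Set.Icc 0 1) s :=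
    fun s => by simpa using (((hasDerivAt_id s).const_mul (u₁ - u₀)).const_add u₀).hasDerivWithinAt
  have h1 : ∀ s ∈ Set.Icc (0 : ℝ) 1, HasDerivWithinAt (fun s => γ (u₀ + (u₁ - u₀) * s))
      ((u₁ - u₀) • velocity γ u₀ u₁ (u₀ + (u₁ - u₀) * s)) (Set.Icc 0 1) s :=
    fun s hs => (hγ.hasDerivWithinAt (hm hs)).scomp s (hd s) hm
  have hv : ∀ s ∈ Set.Icc (0 : ℝ) 1, velocity (fun s => γ (u₀ + (u₁ - u₀) * s)) 0 1 s =
      (u₁ - u₀) • velocity γ u₀ u₁ (u₀ + (u₁ - u₀) * s) :=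
    fun s hs => (h1 s hs).derivWithin (uniqueDiffOn_Icc zero_lt_one s hs)
  refine ⟨⟨fun s hs => hγ.mapsTo (hm hs), by simp [hγ.start], by simp [hγ.finish],
    fun s hs => (h1 s hs).differentiableWithinAt, fun s hs ρ => ?_⟩, hv⟩
  have h2 := ((hγ.equation _ (hm hs) ρ).scomp s (hd s) hm).const_mul (u₁ - u₀)
  refine (h2.congr (fun r hr => ?_) ?_).congr_deriv ?_
  · rw [hv r hr]; rfl
  · rw [hv s hs]; rfl
  -- The geodesic equation is quadratic in the velocity, so both sides scale by `(u₁ - u₀)²`.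
  · rw [hv s hs]
    simp only [smul_eq_mul, mul_neg, neg_inj, Finset.mul_sum, PiLp.smul_apply]
    exact Finset.sum_congr rfl fun μ _ => Finset.sum_congr rfl fun ν _ => by ring

variable {ι : Type*} [Fintype ι] [DecidableEq ι] {A : Fin d → Coord d → Matrix ι ι ℝ}

attribute [local instance] Matrix.linftyOpNormedRing Matrix.linftyOpNormedAlgebra

omit [Fintype ι] [DecidableEq ι] in
lemma pullback_congr {u₀ u₁ : ℝ} {γ γ' : ℝ → Coord d} (h : Set.EqOn γ γ' (Set.Icc u₀ u₁)) {s : ℝ}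
    (hs : s ∈ Set.Icc u₀ u₁) : pullback A u₀ u₁ γ s = pullback A u₀ u₁ γ' s := by
  simp only [pullback, velocity_congr h hs, h hs]

variable {C : (Coord d × Coord d) × ℝ → Coord d}

lemma IsGeodesicMap.orderedExp_apply (hC : IsGeodesicMap G X C)
    (hA : ∀ μ a b, ContDiffOn ℝ ∞ (fun ξ => A μ ξ a b) X) {x y : Coord d} (hx : x ∈ X)
    (hy : y ∈ X) {F : ℝ → Matrix ι ι ℝ} (hF0 : F 0 = 1) (hF : ∀ s ∈ Set.Icc (0 : ℝ) 1,
      HasDerivWithinAt F (-(pullback A 0 1 (geodesic G X x y) s * F s)) (Set.Icc 0 1) s) :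
    orderedExp G X A x y = F 1 := by
  ext a b
  exact (hasSum_orderedTerm zero_le_one
    ((hC.isGeodesic_geodesic hx hy).continuousOn_pullback hA) hF hF0 a b).tsum_eq

/-- The ordered exponential does not depend on the parameterization of the geodesic. -/
theorem IsGeodesicMap.hasSum_orderedTerm (hC : IsGeodesicMap G X C)
    (hA : ∀ μ a b, ContDiffOn ℝ ∞ (fun ξ => A μ ξ a b) X) {x y : Coord d} (hx : x ∈ X)
    (hy : y ∈ X) {u₀ u₁ : ℝ} (hu : u₀ < u₁) {γ : ℝ → Coord d}
    (hγ : IsGeodesic G X u₀ u₁ x y γ) (a b : ι) :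
    HasSum (fun k => orderedTerm A u₀ u₁ γ k a b) (orderedExp G X A x y a b) := by
  have hac := hγ.continuousOn_pullback hA
  obtain ⟨M, hM⟩ := isCompact_Icc.exists_bound_of_continuousOn hac
  obtain ⟨F, hF0, hF, -, -⟩ := exists_transport hu.le hac hM
  obtain ⟨hγ1, hv⟩ := hγ.rescale hu
  have hL : 0 < u₁ - u₀ := sub_pos.2 hu
  have hm : Set.MapsTo (fun s => u₀ + (u₁ - u₀) * s) (Set.Icc 0 1) (Set.Icc u₀ u₁) :=
    fun s hs => ⟨by nlinarith [hs.1], by nlinarith [hs.2]⟩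
  have hd : ∀ s, HasDerivWithinAt (fun s => u₀ + (u₁ - u₀) * s) (u₁ - u₀) (Set.Icc 0 1) s :=
    fun s => by simpa using (((hasDerivAt_id s).const_mul (u₁ - u₀)).const_add u₀).hasDerivWithinAt
  have heq : Set.EqOn (geodesic G X x y) (fun s => γ (u₀ + (u₁ - u₀) * s)) (Set.Icc 0 1) :=
    (hC.eqOn_geodesic hx hy).trans (hC.unique (x, y) ⟨hx, hy⟩ _ hγ1).symm
  -- The reparameterized transport solves the equation on `[0, 1]`: the chain rule factor `u₁ - u₀`
  -- is absorbed by the rescaled velocity.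
  have h1 : orderedExp G X A x y = F (u₀ + (u₁ - u₀) * 1) := by
    refine hC.orderedExp_apply hA hx hy (F := fun s => F (u₀ + (u₁ - u₀) * s)) (by simp [hF0])
      fun s hs => ?_
    refine ((hF _ (hm hs)).scomp s (hd s) hm).congr_deriv ?_
    rw [pullback_congr heq hs]
    simp only [pullback, hv s hs, smul_neg, ← smul_mul_assoc, Finset.smul_sum,
      PiLp.smul_apply, smul_eq_mul, mul_smul]
  rw [h1, mul_one, add_sub_cancel]
  exact YangMills.hasSum_orderedTerm hu.le hac hF hF0 a b

section Terms

variable (hX : IsOpen X) (hG : ∀ μ ν, ContDiffOn ℝ ∞ (fun ξ => G ξ μ ν) X)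
  (hpos : ∀ ξ ∈ X, (G ξ).PosDef)
include hX hG hpos

/-- The `k` factors `σ^{μ'} = -γ̇^μ(0)` cancel the sign `(-1) ^ k` of the term. -/
lemma IsGeodesicMap.rightTaylorTerm_eq (hC : IsGeodesicMap G X C) {x y : Coord d} (hx : x ∈ X)
    (hy : y ∈ X) (k : ℕ) : rightTaylorTerm G X A k x y = (1 / (k.factorial : ℝ)) •
      contract (rightIter G A k) (phase (geodesic G X x y) 0 1 0) := by
  have h0 : geodesic G X x y 0 = y := (hC.isGeodesic_geodesic hx hy).start
  simp only [rightTaylorTerm, contract, phase, h0, hC.syngeUp'_eq hX hG hpos hx hy,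
    Finset.prod_neg, Finset.card_univ, Fintype.card_fin, mul_smul, ← Finset.smul_sum]
  rw [smul_smul, div_mul_eq_mul_div, ← mul_pow]
  simp

lemma IsGeodesicMap.leftTaylorTerm_eq (hC : IsGeodesicMap G X C) {x y : Coord d} (hx : x ∈ X)
    (hy : y ∈ X) (k : ℕ) : leftTaylorTerm G X A k x y = ((-1) ^ k / (k.factorial : ℝ)) •
      contract (leftIter G A k) (phase (geodesic G X x y) 0 1 1) := by
  have h0 : geodesic G X x y 1 = x := (hC.isGeodesic_geodesic hx hy).finish
  simp only [leftTaylorTerm, contract, phase, h0, hC.syngeUp_eq hX hG hpos hx hy]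

variable (hA : ∀ μ a b, ContDiffOn ℝ ∞ (fun ξ => A μ ξ a b) X)
include hA

/-- The remainders of the two expansions, in terms of bounds along the geodesic. -/
lemma IsGeodesicMap.norm_remainder_le (hC : IsGeodesicMap G X C) {x y : Coord d} (hx : x ∈ X)
    (hy : y ∈ X) {M B : ℝ} (N : ℕ)
    (hM : ∀ s ∈ Set.Icc (0 : ℝ) 1, ‖contractForm A (phase (geodesic G X x y) 0 1 s)‖ ≤ M)
    (hR : ∀ s ∈ Set.Icc (0 : ℝ) 1,
      ‖contract (rightIter G A (N + 1)) (phase (geodesic G X x y) 0 1 s)‖ ≤ B)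
    (hL : ∀ s ∈ Set.Icc (0 : ℝ) 1,
      ‖contract (leftIter G A (N + 1)) (phase (geodesic G X x y) 0 1 s)‖ ≤ B) :
    ‖orderedExp G X A x y - ∑ k ∈ Finset.range (N + 1), rightTaylorTerm G X A k x y‖
      ≤ B * (‖(1 : Matrix ι ι ℝ)‖ * Real.exp M) / (N.factorial : ℝ) ∧
    ‖orderedExp G X A x y - ∑ k ∈ Finset.range (N + 1), leftTaylorTerm G X A k x y‖
      ≤ B * (‖(1 : Matrix ι ι ℝ)‖ * Real.exp M) / (N.factorial : ℝ) := by
  have hγ := hC.isGeodesic_geodesic hx hy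
  have hac := hγ.continuousOn_pullback hA
  have hdet : ∀ ξ ∈ X, (G ξ).det ≠ 0 := fun ξ hξ => (hpos ξ hξ).det_pos.ne'
  have hB : 0 ≤ B := (norm_nonneg _).trans (hR 0 (Set.left_mem_Icc.2 zero_le_one))
  obtain ⟨F, hF0, hF, -, hFM⟩ := exists_transport zero_le_one hac (M := M) hM
  obtain ⟨H, hH1, hH, hHM⟩ := exists_backward_transport zero_le_one hac (M := M) hM
  rw [sub_zero, mul_one] at hFM hHM
  simp only [hC.rightTaylorTerm_eq hX hG hpos hx hy, hC.leftTaylorTerm_eq hX hG hpos hx hy,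
    hC.orderedExp_apply hA hx hy hF0 hF]
  constructor
  · refine hγ.norm_sub_rightSum_le hX hG hdet hA hF hF0 N fun s hs => ?_
    exact (norm_mul_le _ _).trans (mul_le_mul (hR s hs) (hFM s hs) (norm_nonneg _) hB)
  · rw [transport_eq_backward zero_le_one hF hF0 hH hH1]
    refine hγ.norm_sub_leftSum_le hX hG hdet hA hH hH1 N fun s hs => ?_
    rw [mul_comm B]
    exact (norm_mul_le _ _).trans (mul_le_mul (hHM s hs) (hL s hs) (norm_nonneg _) (by positivity))

end Terms

lemma exists_norm_contract_le {K : Set (Coord d)} (hK : IsCompact K) (hKX : K ⊆ X) {k : ℕ}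
    {h : TensorField d ι k} (hh : ∀ κ a b, ContDiffOn ℝ ∞ (fun ξ => h κ ξ a b) X) :
    ∃ B, ∀ ξ ∈ K, ∀ v, ‖contract h (ξ, v)‖ ≤ B * ‖v‖ ^ k := by
  choose B hB using fun κ => hK.exists_bound_of_continuousOn
    ((contDiffOn_matrix (hh κ)).continuousOn.mono hKX)
  refine ⟨∑ κ, B κ, fun ξ hξ v => ?_⟩
  rw [Finset.sum_mul]
  refine (norm_sum_le _ _).trans (Finset.sum_le_sum fun κ _ => ?_)
  rw [norm_smul, mul_comm]
  refine mul_le_mul (hB κ ξ hξ) ?_ (norm_nonneg _) ((norm_nonneg _).trans (hB κ ξ hξ))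
  rw [norm_prod]
  calc ∏ i, ‖v (κ i)‖ ≤ ∏ _i : Fin k, ‖v‖ :=
        Finset.prod_le_prod (fun _ _ => norm_nonneg _) fun i _ => PiLp.norm_apply_le v (κ i)
    _ = ‖v‖ ^ k := by simp

/-- The metric form has a positive lower bound on the compact set of unit vectors over `K`;
homogeneity does the rest. -/
lemma exists_norm_le_sqrt_bform (hG : ∀ μ ν, ContDiffOn ℝ ∞ (fun ξ => G ξ μ ν) X)
    (hpos : ∀ ξ ∈ X, (G ξ).PosDef) {K : Set (Coord d)} (hK : IsCompact K) (hKX : K ⊆ X) :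
    ∃ m, 0 ≤ m ∧ ∀ ξ ∈ K, ∀ v, ‖v‖ ≤ m * Real.sqrt (bform (G ξ) v v) := by
  have hc : ContinuousOn (fun p : Coord d × Coord d => bform (G p.1) p.2 p.2)
      (K ×ˢ Metric.sphere 0 1) :=
    continuousOn_bform hG continuousOn_fst (fun p hp => hKX hp.1) continuousOn_snd continuousOn_snd
  obtain ⟨m, hm0, hm⟩ := (hK.prod (isCompact_sphere 0 1)).exists_forall_le' hc (a := 0)
    fun p hp => bform_self_pos hpos (hKX hp.1) (by
      have := hp.2
      rw [mem_sphere_zero_iff_norm] at this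
      exact norm_ne_zero_iff.1 (by rw [this]; exact one_ne_zero))
  refine ⟨Real.sqrt m⁻¹, Real.sqrt_nonneg _, fun ξ hξ v => ?_⟩
  rcases eq_or_ne v 0 with rfl | hv
  · rw [norm_zero]; positivity
  have hv' : 0 < ‖v‖ := norm_pos_iff.2 hv
  rw [← Real.sqrt_mul (by positivity)]
  refine Real.le_sqrt_of_sq_le ?_
  have h1 := hm (ξ, ‖v‖⁻¹ • v) ⟨hξ, by
    rw [mem_sphere_zero_iff_norm, norm_smul, norm_inv, norm_norm, inv_mul_cancel₀ hv'.ne']⟩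
  have h2 : bform (G ξ) v v = ‖v‖ ^ 2 * bform (G ξ) (‖v‖⁻¹ • v) (‖v‖⁻¹ • v) := by
    simp only [bform, PiLp.smul_apply, smul_eq_mul, Finset.mul_sum]
    refine Finset.sum_congr rfl fun μ _ => Finset.sum_congr rfl fun ν _ => ?_
    field_simp
  rw [h2, ← mul_assoc, mul_comm m⁻¹, mul_assoc]
  refine le_mul_of_one_le_right (by positivity) ?_
  rw [inv_mul_eq_div, one_le_div hm0]
  exact h1

/-- The two covariant Taylor expansions, uniformly on compact sets. -/
theorem IsGeodesicMap.exists_expansion_bound (hC : IsGeodesicMap G X C) (hX : IsOpen X)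
    (hG : ∀ μ ν, ContDiffOn ℝ ∞ (fun ξ => G ξ μ ν) X) (hpos : ∀ ξ ∈ X, (G ξ).PosDef)
    (hA : ∀ μ a b, ContDiffOn ℝ ∞ (fun ξ => A μ ξ a b) X)
    {K : Set (Coord d)} (hK : IsCompact K) (hKX : K ⊆ X) (N : ℕ) :
    ∃ c : ℝ, ∀ x ∈ K, ∀ y ∈ K,
      ‖orderedExp G X A x y - ∑ k ∈ Finset.range (N + 1), rightTaylorTerm G X A k x y‖
        ≤ c * Real.sqrt (synge G X x y) ^ (N + 1) ∧
      ‖orderedExp G X A x y - ∑ k ∈ Finset.range (N + 1), leftTaylorTerm G X A k x y‖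
        ≤ c * Real.sqrt (synge G X x y) ^ (N + 1) := by
  have hdet : ∀ ξ ∈ X, (G ξ).det ≠ 0 := fun ξ hξ => (hpos ξ hξ).det_pos.ne'
  have hS : IsCompact ((K ×ˢ K) ×ˢ Set.Icc (0 : ℝ) 1) := (hK.prod hK).prod isCompact_Icc
  have hSX : (K ×ˢ K) ×ˢ Set.Icc (0 : ℝ) 1 ⊆ flowDomain X :=
    Set.prod_mono (Set.prod_mono hKX hKX) subset_rfl
  have hCc : ContinuousOn C ((K ×ˢ K) ×ˢ Set.Icc (0 : ℝ) 1) := hC.contDiffOn.continuousOn.mono hSX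
  have hvc := (hC.contDiffOn_flowVelocity hX).continuousOn.mono hSX
  -- A geodesic joining points of `K` may leave `K`, so bounds are taken on the compact set swept
  -- out by all these geodesics.
  have hT : IsCompact (C '' ((K ×ˢ K) ×ˢ Set.Icc (0 : ℝ) 1)) := hS.image_of_continuousOn hCc
  have hTX : C '' ((K ×ˢ K) ×ˢ Set.Icc (0 : ℝ) 1) ⊆ X := by
    rintro _ ⟨Q, hQ, rfl⟩
    exact hC.mapsTo (hSX hQ)
  obtain ⟨m, hm0, hm⟩ := exists_norm_le_sqrt_bform hG hpos hT hTX
  obtain ⟨BR, hBR⟩ := exists_norm_contract_le hT hTX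
    (contDiffOn_rightIter (by simp) hX hG hdet hA (N + 1))
  obtain ⟨BL, hBL⟩ := exists_norm_contract_le hT hTX
    (contDiffOn_leftIter (by simp) hX hG hdet hA (N + 1))
  have hMc : ContinuousOn (fun Q => contractForm A (C Q, flowVelocity X C Q))
      ((K ×ˢ K) ×ˢ Set.Icc (0 : ℝ) 1) :=
    (contDiffOn_contractForm hA).continuousOn.comp (hCc.prodMk hvc)
      fun Q hQ => ⟨hC.mapsTo (hSX hQ), trivial⟩
  obtain ⟨M, hM⟩ := hS.exists_bound_of_continuousOn hMc
  -- The factor `m √2` converts speed into `√σ`, since `g(γ̇, γ̇) = 2σ`. The maximum with `0` is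
  -- there because `BR` and `BL` come without a sign.
  refine ⟨max (max BR BL) 0 * (m * Real.sqrt 2) ^ (N + 1) *
    (‖(1 : Matrix ι ι ℝ)‖ * Real.exp M) / (N.factorial : ℝ), fun x hx y hy => ?_⟩
  have hphase : ∀ s ∈ Set.Icc (0 : ℝ) 1, phase (geodesic G X x y) 0 1 s =
      (C ((x, y), s), flowVelocity X C ((x, y), s)) := fun s hs => by
    rw [phase, hC.eqOn_geodesic (hKX hx) (hKX hy) hs, hC.velocity_geodesic (hKX hx) (hKX hy) hs]
  have hmem : ∀ s ∈ Set.Icc (0 : ℝ) 1, ((x, y), s) ∈ (K ×ˢ K) ×ˢ Set.Icc (0 : ℝ) 1 :=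
    fun s hs => ⟨⟨hx, hy⟩, hs⟩
  have hspeed : ∀ s ∈ Set.Icc (0 : ℝ) 1, ‖flowVelocity X C ((x, y), s)‖ ≤
      m * Real.sqrt 2 * Real.sqrt (synge G X x y) := fun s hs => by
    rw [mul_assoc, ← Real.sqrt_mul zero_le_two, hC.synge_eq hX hG hpos (hKX hx) (hKX hy) hs,
      mul_div_cancel₀ _ two_ne_zero]
    exact hm _ ⟨_, hmem s hs, rfl⟩ _
  have hbound : ∀ {B : ℝ}, B ≤ max BR BL → ∀ {h : TensorField d ι (N + 1)},
      (∀ ξ ∈ C '' ((K ×ˢ K) ×ˢ Set.Icc (0 : ℝ) 1), ∀ v,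
        ‖contract h (ξ, v)‖ ≤ B * ‖v‖ ^ (N + 1)) → ∀ s ∈ Set.Icc (0 : ℝ) 1,
      ‖contract h (phase (geodesic G X x y) 0 1 s)‖ ≤
        max (max BR BL) 0 * (m * Real.sqrt 2 * Real.sqrt (synge G X x y)) ^ (N + 1) := by
    intro B hB h hh s hs
    rw [hphase s hs]
    refine (hh _ ⟨_, hmem s hs, rfl⟩ _).trans ?_
    refine (mul_le_mul_of_nonneg_right (hB.trans (le_max_left _ 0)) (by positivity)).trans ?_
    gcongr
    exact hspeed s hs
  have := hC.norm_remainder_le hX hG hpos hA (hKX hx) (hKX hy) N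
    (fun s hs => by rw [hphase s hs]; exact hM _ (hmem s hs))
    (hbound (le_max_left _ _) hBR) (hbound (le_max_right _ _) hBL)
  have e : max (max BR BL) 0 * (m * Real.sqrt 2) ^ (N + 1) * (‖(1 : Matrix ι ι ℝ)‖ * Real.exp M) /
      (N.factorial : ℝ) * Real.sqrt (synge G X x y) ^ (N + 1) =
      max (max BR BL) 0 * (m * Real.sqrt 2 * Real.sqrt (synge G X x y)) ^ (N + 1) *
        (‖(1 : Matrix ι ι ℝ)‖ * Real.exp M) / (N.factorial : ℝ) := by
    rw [mul_pow (m * Real.sqrt 2)]; ring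
  rw [e]
  exact this

end Expansion

/-! ### Factorial bounds for iterates of an analytic first order operator -/

section DerivativeScale

variable {E V W : Type*} [NormedAddCommGroup E] [NormedSpace ℝ E]
  [NormedAddCommGroup V] [NormedSpace ℝ V] [NormedAddCommGroup W] [NormedSpace ℝ W]
  {Ω : Set E} {p : E} {ρ : ℝ}

/-- The weighted sum `∑_{n ≤ m} ρ^n / n! ‖D^n f(p)‖` of the derivatives of `f` at `p`. -/
def derivSum (Ω : Set E) (p : E) (ρ : ℝ) (m : ℕ) (f : E → V) : ℝ :=
  ∑ n ∈ Finset.range (m + 1), ρ ^ n / (n.factorial : ℝ) * ‖iteratedFDerivWithin ℝ n f Ω p‖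

lemma derivSum_nonneg (hρ : 0 ≤ ρ) (m : ℕ) (f : E → V) : 0 ≤ derivSum Ω p ρ m f :=
  Finset.sum_nonneg fun _ _ => by positivity

lemma derivSum_mono_rho {ρ' : ℝ} (hρ : 0 ≤ ρ) (h : ρ ≤ ρ') (m : ℕ) (f : E → V) :
    derivSum Ω p ρ m f ≤ derivSum Ω p ρ' m f :=
  Finset.sum_le_sum fun n _ => by gcongr

lemma derivSum_congr {f g : E → V} (h : Set.EqOn f g Ω) (hp : p ∈ Ω) (m : ℕ) :
    derivSum Ω p ρ m f = derivSum Ω p ρ m g :=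
  Finset.sum_congr rfl fun n _ => by rw [iteratedFDerivWithin_congr h hp n]

lemma norm_le_derivSum (hρ : 0 ≤ ρ) (m : ℕ) (f : E → V) : ‖f p‖ ≤ derivSum Ω p ρ m f := by
  have := Finset.single_le_sum (f := fun n : ℕ => ρ ^ n / (n.factorial : ℝ) *
    ‖iteratedFDerivWithin ℝ n f Ω p‖) (fun n _ => by positivity)
    (Finset.mem_range.2 (Nat.succ_pos m))
  simpa [derivSum] using this

lemma derivSum_const (m : ℕ) (v : V) : derivSum Ω p ρ m (fun _ => v) = ‖v‖ := by
  rw [derivSum, Finset.sum_range_succ']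
  simp [iteratedFDerivWithin_succ_const]

lemma derivSum_add_le (hΩ : UniqueDiffOn ℝ Ω) (hp : p ∈ Ω) (hρ : 0 ≤ ρ) {f g : E → V}
    (hf : ContDiffOn ℝ ∞ f Ω) (hg : ContDiffOn ℝ ∞ g Ω) (m : ℕ) :
    derivSum Ω p ρ m (fun x => f x + g x) ≤ derivSum Ω p ρ m f + derivSum Ω p ρ m g := by
  simp only [derivSum, ← Finset.sum_add_distrib, ← mul_add]
  refine Finset.sum_le_sum fun n _ => ?_
  gcongr
  have h := iteratedFDerivWithin_add_apply (i := n)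
    ((hf p hp).of_le (by exact_mod_cast le_top)) ((hg p hp).of_le (by exact_mod_cast le_top)) hΩ hp
  have e : (fun x => f x + g x) = f + g := rfl
  rw [e, h]
  exact norm_add_le _ _

/-- With the weights `1 / n!` Leibniz' rule is a Cauchy product, and its truncation is part of the
product of the truncated sums. -/
lemma derivSum_clm_apply_le (hΩ : UniqueDiffOn ℝ Ω) (hp : p ∈ Ω) (hρ : 0 ≤ ρ) {f : E → V →L[ℝ] W}
    {g : E → V} (hf : ContDiffOn ℝ ∞ f Ω) (hg : ContDiffOn ℝ ∞ g Ω) (m : ℕ) :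
    derivSum Ω p ρ m (fun x => f x (g x)) ≤ derivSum Ω p ρ m f * derivSum Ω p ρ m g := by
  set a : ℕ → ℝ := fun n => ρ ^ n / (n.factorial : ℝ) * ‖iteratedFDerivWithin ℝ n f Ω p‖ with ha
  set b : ℕ → ℝ := fun n => ρ ^ n / (n.factorial : ℝ) * ‖iteratedFDerivWithin ℝ n g Ω p‖ with hb
  have ha0 : ∀ n, 0 ≤ a n := fun n => by positivity
  have hb0 : ∀ n, 0 ≤ b n := fun n => by positivity
  calc derivSum Ω p ρ m (fun x => f x (g x))
      ≤ ∑ n ∈ Finset.range (m + 1), ∑ i ∈ Finset.range (n + 1), a i * b (n - i) := by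
        refine Finset.sum_le_sum fun n _ => ?_
        have h := norm_iteratedFDerivWithin_clm_apply hf hg hΩ hp (n := n)
          (by exact_mod_cast le_top)
        refine (mul_le_mul_of_nonneg_left h (by positivity)).trans_eq ?_
        rw [Finset.mul_sum]
        refine Finset.sum_congr rfl fun i hi => ?_
        have hi' : i ≤ n := Nat.lt_succ_iff.1 (Finset.mem_range.1 hi)
        rw [Nat.cast_choose ℝ hi', ha, hb]
        have : ρ ^ n = ρ ^ i * ρ ^ (n - i) := by rw [← pow_add, Nat.add_sub_cancel' hi']
        rw [this]
        have h1 : (n.factorial : ℝ) ≠ 0 := by positivity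
        field_simp
    _ = ∑ i ∈ Finset.range (m + 1), ∑ j ∈ Finset.range (m + 1 - i), a i * b j :=
        Finset.sum_range_diag_flip (m + 1) fun i j => a i * b j
    _ ≤ ∑ i ∈ Finset.range (m + 1), ∑ j ∈ Finset.range (m + 1), a i * b j := by
        refine Finset.sum_le_sum fun i _ => ?_
        exact Finset.sum_le_sum_of_subset_of_nonneg
          (Finset.range_subset_range.2 (Nat.sub_le _ _))
          fun j _ _ => mul_nonneg (ha0 i) (hb0 j)
    _ = derivSum Ω p ρ m f * derivSum Ω p ρ m g := by
        rw [derivSum, derivSum, Finset.sum_mul_sum]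

/-- Bernoulli's inequality: shrinking the radius from `ρ` to `ρ'` pays for the factor `n + 1` of a
derivative. -/
lemma succ_mul_pow_le {ρ ρ' : ℝ} (hρ' : 0 ≤ ρ') (h : ρ' ≤ ρ) (n : ℕ) :
    (n + 1) * ρ' ^ n * (ρ - ρ') ≤ ρ ^ (n + 1) := by
  have hd : 0 ≤ ρ - ρ' := sub_nonneg.2 h
  have : ρ' ^ (n + 1) + (n + 1) * ρ' ^ n * (ρ - ρ') ≤ ρ ^ (n + 1) := by
    induction n with
    | zero => simp
    | succ n ih =>
      have h1 := mul_le_mul_of_nonneg_right ih (hρ'.trans h)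
      have h2 : 0 ≤ (n + 1) * ρ' ^ n * (ρ - ρ') * (ρ - ρ') := by positivity
      calc _ = (ρ' ^ (n + 1) + (n + 1) * ρ' ^ n * (ρ - ρ')) * ρ -
            (n + 1) * ρ' ^ n * (ρ - ρ') * (ρ - ρ') := by push_cast; ring
        _ ≤ ρ ^ (n + 1) * ρ := by linarith
        _ = ρ ^ (n + 1 + 1) := by ring
  linarith [pow_nonneg hρ' (n + 1)]

/-- A Cauchy estimate in this scale: one derivative costs a factor `(ρ - ρ')⁻¹` and one order of
truncation. -/
lemma derivSum_fderiv_le (hΩ : UniqueDiffOn ℝ Ω) (hp : p ∈ Ω) {ρ ρ' : ℝ} (hρ' : 0 ≤ ρ')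
    (h : ρ' < ρ) (f : E → V) (m : ℕ) :
    derivSum Ω p ρ' m (fderivWithin ℝ f Ω) ≤ (ρ - ρ')⁻¹ * derivSum Ω p ρ (m + 1) f := by
  have hd : 0 < ρ - ρ' := sub_pos.2 h
  have hρ : 0 ≤ ρ := hρ'.trans h.le
  rw [derivSum, derivSum, Finset.sum_range_succ' _ (m + 1), mul_add, Finset.mul_sum]
  refine le_add_of_le_of_nonneg (Finset.sum_le_sum fun n _ => ?_) (by positivity)
  rw [norm_iteratedFDerivWithin_fderivWithin hΩ hp, ← mul_assoc]
  gcongr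
  rw [Nat.factorial_succ]
  push_cast
  rw [inv_mul_eq_div, le_div_iff₀ hd, div_mul_eq_mul_div, div_le_div_iff₀ (by positivity)
    (by positivity)]
  have := mul_le_mul_of_nonneg_right (succ_mul_pow_le hρ' h.le n)
    (Nat.cast_nonneg (α := ℝ) n.factorial)
  linarith

/-- `k ^ k / k!` is a single term of the exponential series at `k`. -/
lemma natCast_pow_self_le (k : ℕ) : (k : ℝ) ^ k ≤ (k.factorial : ℝ) * Real.exp 1 ^ k := by
  have := Real.pow_div_factorial_le_exp (x := (k : ℝ)) (Nat.cast_nonneg k) k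
  rw [div_le_iff₀ (by positivity)] at this
  rw [← Real.exp_one_rpow, Real.rpow_natCast] at this
  linarith

/-- Factorial bounds for the iterates of a first order differential operator with coefficients
whose derivatives at `p` grow at most like those of an analytic function. -/
lemma norm_iterate_le (hΩ : IsOpen Ω) (hp : p ∈ Ω) {Z : E → E} {L : E → V →L[ℝ] V}
    (hZ : ContDiffOn ℝ ∞ Z Ω) (hL : ContDiffOn ℝ ∞ L Ω) {T : ℕ → E → V} {v : V}
    (hT : ∀ k, ContDiffOn ℝ ∞ (T k) Ω) (hT0 : ∀ x ∈ Ω, T 0 x = v)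
    (hTs : ∀ k, ∀ x ∈ Ω, T (k + 1) x = fderiv ℝ (T k) x (Z x) + L x (T k x))
    {ρ M : ℝ} (hρ : 0 < ρ) (hZM : ∀ m, derivSum Ω p ρ m Z ≤ M)
    (hLM : ∀ m, derivSum Ω p ρ m L ≤ M) (k : ℕ) :
    ‖T k p‖ ≤ ‖v‖ * (k.factorial : ℝ) * (Real.exp 1 * (M * (ρ⁻¹ + 1))) ^ k := by
  have hu := hΩ.uniqueDiffOn (𝕜 := ℝ)
  have hM : 0 ≤ M := (derivSum_nonneg hρ.le 0 Z).trans (hZM 0)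
  rcases Nat.eq_zero_or_pos k with rfl | hk
  · simp [hT0 p hp]
  have hk' : (0 : ℝ) < k := Nat.cast_pos.2 hk
  have hk1 : (1 : ℝ) ≤ k := Nat.one_le_cast.2 hk
  -- The radius is spent in `k` equal portions, one for each application of the operator. At the end
  -- it is `0`, where only the value at `p` is needed.
  set δ : ℝ := ρ / k with hδ
  have hδ0 : 0 < δ := by positivity
  -- All truncation orders are carried at once, because each step needs order `m + 1` of the step
  -- before.
  have key : ∀ j ≤ k, ∀ m, derivSum Ω p (ρ - j * δ) m (T j) ≤ ‖v‖ * (M * (δ⁻¹ + 1)) ^ j := by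
    intro j
    induction j with
    | zero =>
      intro _ m
      rw [derivSum_congr (g := fun _ => v) (fun x hx => hT0 x hx) hp, derivSum_const]
      simp
    | succ j ih =>
      intro hj m
      have hj' : ((j + 1 : ℕ) : ℝ) ≤ k := Nat.cast_le.2 hj
      set r' : ℝ := ρ - ((j + 1 : ℕ) : ℝ) * δ with hr'
      have hr0 : 0 ≤ r' := by
        have : ((j + 1 : ℕ) : ℝ) * δ ≤ k * δ := by gcongr
        have h2 : k * δ = ρ := by rw [hδ]; field_simp
        rw [hr']; linarith
      have hrr : ρ - j * δ - r' = δ := by rw [hr']; push_cast; ring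
      have hlt : r' < ρ - j * δ := by linarith
      have hle : r' ≤ ρ := by
        have : 0 ≤ ((j + 1 : ℕ) : ℝ) * δ := by positivity
        linarith
      have hfd : ContDiffOn ℝ ∞ (fderivWithin ℝ (T j) Ω) Ω := (hT j).fderivWithin hu (by simp)
      have hIH := ih (Nat.le_of_succ_le hj)
      have h1 : derivSum Ω p r' m (fun x => fderivWithin ℝ (T j) Ω x (Z x)) ≤
          δ⁻¹ * (‖v‖ * (M * (δ⁻¹ + 1)) ^ j) * M := by
        refine (derivSum_clm_apply_le hu hp hr0 hfd hZ m).trans ?_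
        refine mul_le_mul ?_ ((derivSum_mono_rho hr0 hle m Z).trans (hZM m))
          (derivSum_nonneg hr0 m Z) (by positivity)
        refine (derivSum_fderiv_le hu hp hr0 hlt (T j) m).trans ?_
        rw [hrr]
        gcongr
        exact hIH (m + 1)
      have h2 : derivSum Ω p r' m (fun x => L x (T j x)) ≤ M * (‖v‖ * (M * (δ⁻¹ + 1)) ^ j) := by
        refine (derivSum_clm_apply_le hu hp hr0 hL (hT j) m).trans ?_
        refine mul_le_mul ((derivSum_mono_rho hr0 hle m L).trans (hLM m)) ?_
          (derivSum_nonneg hr0 m _) hM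
        exact (derivSum_mono_rho hr0 hlt.le m _).trans (hIH m)
      rw [derivSum_congr (g := fun x => fderivWithin ℝ (T j) Ω x (Z x) + L x (T j x))
        (fun x hx => by simp only [hTs j x hx, fderivWithin_of_isOpen hΩ hx]) hp]
      refine (derivSum_add_le hu hp hr0 (hfd.clm_apply hZ) (hL.clm_apply (hT j)) m).trans ?_
      refine (add_le_add h1 h2).trans_eq ?_
      ring
  have h0 : ρ - k * δ = 0 := by rw [hδ]; field_simp; ring
  have h3 := key k le_rfl 0
  rw [h0] at h3
  refine ((norm_le_derivSum le_rfl 0 (T k)).trans h3).trans ?_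
  -- Since `δ⁻¹ = k / ρ`, the `k` steps produce `k ^ k`, which is a factorial up to `e ^ k`.
  have h4 : M * (δ⁻¹ + 1) ≤ k * (M * (ρ⁻¹ + 1)) := by
    have : δ⁻¹ = k * ρ⁻¹ := by rw [hδ]; field_simp
    rw [this]
    have : M * (k * ρ⁻¹ + 1) ≤ M * (k * ρ⁻¹ + k) := by gcongr
    linarith
  have hδi : 0 ≤ M * (δ⁻¹ + 1) := by positivity
  calc ‖v‖ * (M * (δ⁻¹ + 1)) ^ k ≤ ‖v‖ * (k * (M * (ρ⁻¹ + 1))) ^ k := by gcongr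
    _ = ‖v‖ * ((k : ℝ) ^ k * (M * (ρ⁻¹ + 1)) ^ k) := by rw [mul_pow]
    _ ≤ ‖v‖ * (((k.factorial : ℝ) * Real.exp 1 ^ k) * (M * (ρ⁻¹ + 1)) ^ k) := by
        gcongr
        exact natCast_pow_self_le k
    _ = _ := by rw [mul_pow (Real.exp 1)]; ring

/-- The `n`-th derivative sums the coefficient `q n` over the `n!` permutations of its arguments. -/
lemma norm_iteratedFDeriv_le_of_hasFPowerSeries [CompleteSpace V] {f : E → V}
    {q : FormalMultilinearSeries ℝ E V} {r : ENNReal} (h : HasFPowerSeriesOnBall f q p r) (n : ℕ) :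
    ‖iteratedFDeriv ℝ n f p‖ ≤ (n.factorial : ℝ) * ‖q n‖ := by
  refine ContinuousMultilinearMap.opNorm_le_bound (by positivity) fun v => ?_
  rw [h.iteratedFDeriv_eq_sum_of_completeSpace]
  refine (norm_sum_le _ _).trans ?_
  have : ∀ σ : Equiv.Perm (Fin n), ‖q n fun i => v (σ i)‖ ≤ ‖q n‖ * ∏ i, ‖v i‖ := fun σ => by
    rw [← Equiv.prod_comp σ fun i => ‖v i‖]
    exact (q n).le_opNorm _
  refine (Finset.sum_le_sum fun σ _ => this σ).trans_eq ?_
  simp [Fintype.card_perm, mul_assoc]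

/-- Locally uniform Cauchy estimates for a real-analytic function. -/
lemma AnalyticAt.exists_derivSum_le [CompleteSpace V] (hΩ : IsOpen Ω) {f : E → V} {p₀ : E}
    (hf : AnalyticAt ℝ f p₀) :
    ∃ ρ > 0, ∃ M, ∀ᶠ p in nhds p₀, p ∈ Ω → ∀ m, derivSum Ω p ρ m f ≤ M := by
  obtain ⟨q, R, hq⟩ := hf
  have hR : (0 : ENNReal) < min R (q.radius / 2) :=
    lt_min hq.r_pos (ENNReal.half_pos (hq.r_pos.trans_le hq.r_le).ne')
  obtain ⟨r, hr0, hr⟩ := ENNReal.lt_iff_exists_nnreal_btwn.1 hR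
  have hr0' : 0 < r := by exact_mod_cast hr0
  have hrr : (r + r : ENNReal) < q.radius := by
    calc (r + r : ENNReal) < q.radius / 2 + q.radius / 2 :=
          ENNReal.add_lt_add (hr.trans_le (min_le_right _ _)) (hr.trans_le (min_le_right _ _))
      _ = q.radius := ENNReal.add_halves _
  -- Re-expansion at any point within distance `r` is dominated by this one series with displacement
  -- and weight both equal to `r`; its convergence requires `2r` below the radius.
  have hs := NNReal.summable_sigma.1 (q.changeOriginSeries_summable_aux₁ hrr)
  refine ⟨r, by exact_mod_cast hr0', ((∑' n : ℕ, ∑' s : Σ l : ℕ,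
    { s : Finset (Fin (n + l)) // s.card = l }, ‖q (n + s.1)‖₊ * r ^ s.1 * r ^ n : NNReal) : ℝ), ?_⟩
  filter_upwards [Metric.ball_mem_nhds p₀ (NNReal.coe_pos.2 hr0')] with p hp hpΩ m
  obtain ⟨y, rfl⟩ : ∃ y, p = p₀ + y := ⟨p - p₀, by abel⟩
  have hy : ‖y‖₊ ≤ r := by
    rw [Metric.mem_ball, dist_eq_norm, add_sub_cancel_left] at hp
    exact_mod_cast hp.le
  have hyR : (‖y‖₊ : ENNReal) < R :=
    (ENNReal.coe_le_coe.2 hy).trans_lt (hr.trans_le (min_le_left _ _))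
  have hyrad : (‖y‖₊ : ENNReal) < q.radius := hyR.trans_le hq.r_le
  have hc := hq.changeOrigin hyR
  have hterm : ∀ n : ℕ, (r : ℝ) ^ n / (n.factorial : ℝ) *
      ‖iteratedFDerivWithin ℝ n f Ω (p₀ + y)‖ ≤ ((r ^ n * ‖q.changeOrigin y n‖₊ : NNReal) : ℝ) := by
    intro n
    rw [iteratedFDerivWithin_of_isOpen n hΩ hpΩ, div_mul_eq_mul_div, div_le_iff₀ (by positivity)]
    push_cast
    rw [mul_assoc]
    refine mul_le_mul_of_nonneg_left ?_ (by positivity)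
    rw [mul_comm]
    exact norm_iteratedFDeriv_le_of_hasFPowerSeries hc n
  have hterm' : ∀ n : ℕ, r ^ n * ‖q.changeOrigin y n‖₊ ≤
      ∑' s : Σ l : ℕ, { s : Finset (Fin (n + l)) // s.card = l },
        ‖q (n + s.1)‖₊ * r ^ s.1 * r ^ n := by
    intro n
    rw [NNReal.tsum_mul_right, mul_comm]
    gcongr
    refine (q.nnnorm_changeOrigin_le n hyrad).trans ?_
    refine Summable.tsum_le_tsum (fun s => by gcongr)
      (q.changeOriginSeries_summable_aux₂ hyrad n)
      (q.changeOriginSeries_summable_aux₂ ?_ n)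
    exact lt_of_le_of_lt le_self_add hrr
  refine (Finset.sum_le_sum fun n _ => (hterm n).trans (NNReal.coe_le_coe.2 (hterm' n))).trans ?_
  rw [← NNReal.coe_sum, NNReal.coe_le_coe]
  exact hs.2.sum_le_tsum _ fun _ _ => zero_le

/-- Locally uniform factorial bounds for the iterates of a first order differential operator with
analytic coefficients. -/
lemma eventually_norm_iterate_le [CompleteSpace E] [CompleteSpace V] (hΩ : IsOpen Ω) {p₀ : E}
    (hp₀ : p₀ ∈ Ω)
    {Z : E → E} {L : E → V →L[ℝ] V} (hZ : ContDiffOn ℝ ω Z Ω) (hL : ContDiffOn ℝ ω L Ω)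
    {T : ℕ → E → V} {v : V} (hT : ∀ k, ContDiffOn ℝ ∞ (T k) Ω) (hT0 : ∀ x ∈ Ω, T 0 x = v)
    (hTs : ∀ k, ∀ x ∈ Ω, T (k + 1) x = fderiv ℝ (T k) x (Z x) + L x (T k x)) :
    ∃ D, ∀ᶠ p in nhds p₀, ∀ k, ‖T k p‖ ≤ ‖v‖ * (k.factorial : ℝ) * D ^ k := by
  have hZa : AnalyticAt ℝ Z p₀ := (hZ.contDiffAt (hΩ.mem_nhds hp₀)).analyticAt
  have hLa : AnalyticAt ℝ L p₀ := (hL.contDiffAt (hΩ.mem_nhds hp₀)).analyticAt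
  obtain ⟨ρ₁, hρ₁, M₁, h1⟩ := AnalyticAt.exists_derivSum_le hΩ hZa
  obtain ⟨ρ₂, hρ₂, M₂, h2⟩ := AnalyticAt.exists_derivSum_le hΩ hLa
  have hρ : 0 < min ρ₁ ρ₂ := lt_min hρ₁ hρ₂
  refine ⟨Real.exp 1 * (max M₁ M₂ * ((min ρ₁ ρ₂)⁻¹ + 1)), ?_⟩
  filter_upwards [h1, h2, hΩ.mem_nhds hp₀] with p hp1 hp2 hp k
  refine norm_iterate_le hΩ hp (hZ.of_le le_top) (hL.of_le le_top) hT hT0 hTs hρ ?_ ?_ k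
  · exact fun m => ((derivSum_mono_rho hρ.le (min_le_left _ _) m _).trans (hp1 hp m)).trans
      (le_max_left _ _)
  · exact fun m => ((derivSum_mono_rho hρ.le (min_le_right _ _) m _).trans (hp2 hp m)).trans
      (le_max_right _ _)

variable {𝔸 : Type*} [NormedRing 𝔸] [NormedAlgebra ℝ 𝔸] [CompleteSpace 𝔸]

lemma eventually_norm_left_iterate_le [CompleteSpace E] (hΩ : IsOpen Ω) {p₀ : E} (hp₀ : p₀ ∈ Ω)
    {Z : E → E} {a : E → 𝔸} (hZ : ContDiffOn ℝ ω Z Ω) (ha : ContDiffOn ℝ ω a Ω)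
    {T : ℕ → E → 𝔸} {v : 𝔸} (hT : ∀ k, ContDiffOn ℝ ∞ (T k) Ω) (hT0 : ∀ x ∈ Ω, T 0 x = v)
    (hTs : ∀ k, ∀ x ∈ Ω, T (k + 1) x = fderiv ℝ (T k) x (Z x) + a x * T k x) :
    ∃ D, ∀ᶠ p in nhds p₀, ∀ k, ‖T k p‖ ≤ ‖v‖ * (k.factorial : ℝ) * D ^ k :=
  eventually_norm_iterate_le hΩ hp₀ hZ
    ((ContinuousLinearMap.mul ℝ 𝔸).contDiff.comp_contDiffOn ha) hT hT0 hTs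

lemma eventually_norm_right_iterate_le [CompleteSpace E] (hΩ : IsOpen Ω) {p₀ : E} (hp₀ : p₀ ∈ Ω)
    {Z : E → E} {a : E → 𝔸} (hZ : ContDiffOn ℝ ω Z Ω) (ha : ContDiffOn ℝ ω a Ω)
    {T : ℕ → E → 𝔸} {v : 𝔸} (hT : ∀ k, ContDiffOn ℝ ∞ (T k) Ω) (hT0 : ∀ x ∈ Ω, T 0 x = v)
    (hTs : ∀ k, ∀ x ∈ Ω, T (k + 1) x = fderiv ℝ (T k) x (Z x) - T k x * a x) :
    ∃ D, ∀ᶠ p in nhds p₀, ∀ k, ‖T k p‖ ≤ ‖v‖ * (k.factorial : ℝ) * D ^ k :=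
  eventually_norm_iterate_le hΩ hp₀ hZ
    ((ContinuousLinearMap.mul ℝ 𝔸).flip.contDiff.comp_contDiffOn ha).neg hT hT0
    fun k x hx => (hTs k x hx).trans (sub_eq_add_neg _ _)

end DerivativeScale

/-! ### Geometric decay near the zero section -/

section Convergence

variable {d : ℕ} {X : Set (Coord d)} {G : Coord d → Matrix (Fin d) (Fin d) ℝ}
  {ι : Type*} [Fintype ι] [DecidableEq ι] {A : Fin d → Coord d → Matrix ι ι ℝ}

attribute [local instance] Matrix.linftyOpNormedRing Matrix.linftyOpNormedAlgebra

lemma hasSum_of_remainder {V : Type*} [NormedAddCommGroup V] [NormedSpace ℝ V] [CompleteSpace V]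
    {f : ℕ → V} {S : V} {c c' : ℝ} (h1 : ∀ k, ‖f k‖ ≤ c * (1 / 2) ^ k)
    (h2 : ∀ N : ℕ, ‖S - ∑ k ∈ Finset.range (N + 1), f k‖ ≤
      c' * (((N + 1 : ℕ) : ℝ) * (1 / 2) ^ (N + 1))) : HasSum f S := by
  have hs : Summable f := Summable.of_norm_bounded
    ((summable_geometric_of_lt_one (by norm_num) (by norm_num)).mul_left c) h1
  rw [hs.hasSum_iff_tendsto_nat, ← Filter.tendsto_add_atTop_iff_nat 1, tendsto_iff_norm_sub_tendsto_zero]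
  have h3 : Filter.Tendsto (fun N : ℕ => c' * (((N + 1 : ℕ) : ℝ) * (1 / 2) ^ (N + 1)))
      Filter.atTop (nhds 0) := by
    have := ((tendsto_self_mul_const_pow_of_lt_one (r := (1 / 2 : ℝ)) (by norm_num)
      (by norm_num)).comp (Filter.tendsto_add_atTop_nat 1)).const_mul c'
    simpa using this
  exact squeeze_zero (fun _ => norm_nonneg _) (fun N => by rw [norm_sub_rev]; exact h2 N) h3

/-- By homogeneity in `v`, shrinking velocities by `θ = 1 / (2 (|D| + 1))` turns `D ^ k` into at
most `(1 / 2) ^ k`; the map `v ↦ θ⁻¹ v` fixes `(z, 0)`, so the bound is still available nearby. -/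
lemma eventually_contract_le_half {h : (k : ℕ) → TensorField d ι k} {z : Coord d} {c D : ℝ}
    (hc : 0 ≤ c) (hD : ∀ᶠ p in nhds ((z, 0) : Coord d × Coord d), ∀ k,
      ‖contract (h k) p‖ ≤ c * (k.factorial : ℝ) * D ^ k) :
    ∀ᶠ p in nhds ((z, 0) : Coord d × Coord d), ∀ k,
      ‖contract (h k) p‖ ≤ c * (k.factorial : ℝ) * (1 / 2) ^ k := by
  set θ : ℝ := 1 / (2 * (|D| + 1)) with hθ
  have hθ0 : 0 < θ := by positivity
  have hcont : ContinuousAt (fun p : Coord d × Coord d => (p.1, θ⁻¹ • p.2)) (z, 0) := by fun_prop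
  have hlim : Filter.Tendsto (fun p : Coord d × Coord d => (p.1, θ⁻¹ • p.2)) (nhds (z, 0))
      (nhds (z, 0)) := by
    have := hcont.tendsto
    simpa using this
  filter_upwards [hlim.eventually hD] with p hp k
  have e : contract (h k) p = θ ^ k • contract (h k) (p.1, θ⁻¹ • p.2) := by
    rw [← contract_smul, smul_inv_smul₀ hθ0.ne']
  rw [e, norm_smul, norm_pow, Real.norm_eq_abs, abs_of_pos hθ0]
  refine (mul_le_mul_of_nonneg_left (hp k) (by positivity)).trans ?_
  calc θ ^ k * (c * (k.factorial : ℝ) * D ^ k) = c * (k.factorial : ℝ) * (θ * D) ^ k := by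
        rw [mul_pow]; ring
    _ ≤ c * (k.factorial : ℝ) * (1 / 2) ^ k := by
        refine mul_le_mul_of_nonneg_left ?_ (by positivity)
        refine (le_abs_self _).trans ?_
        rw [abs_pow]
        refine pow_le_pow_left₀ (abs_nonneg _) ?_ k
        rw [abs_mul, abs_of_pos hθ0, hθ, div_mul_eq_mul_div, div_le_div_iff₀ (by positivity)
          (by norm_num)]
        linarith [abs_nonneg D]

variable (hX : IsOpen X) (hG : ∀ μ ν, ContDiffOn ℝ ω (fun ξ => G ξ μ ν) X)
  (hdet : ∀ ξ ∈ X, (G ξ).det ≠ 0) (hA : ∀ μ a b, ContDiffOn ℝ ω (fun ξ => A μ ξ a b) X)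
include hX in
lemma fderiv_contract_spray {k : ℕ} {h : TensorField d ι k}
    (hh : ∀ κ a b, ContDiffOn ℝ ∞ (fun ξ => h κ ξ a b) X) {p : Coord d × Coord d}
    (hp : p ∈ X ×ˢ (Set.univ : Set (Coord d))) :
    fderiv ℝ (contract h) p (spray G p) = contract (nabla G h) p := by
  obtain ⟨D, hD, hDs⟩ := hasFDerivAt_contract G (h := h) (p := p) fun κ a b =>
    ((hh κ a b).differentiableOn (by simp)).differentiableAt (hX.mem_nhds hp.1)
  rw [hD.fderiv, hDs]

include hX hG hdet hA

/-- The contractions are the iterates, starting from `1`, of the spray derivative plus left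
multiplication by `v^μ A_μ`. -/
lemma eventually_leftIter_le {z : Coord d} (hz : z ∈ X) :
    ∀ᶠ p in nhds ((z, 0) : Coord d × Coord d), ∀ k,
      ‖contract (leftIter G A k) p‖ ≤ ‖(1 : Matrix ι ι ℝ)‖ * (k.factorial : ℝ) * (1 / 2) ^ k := by
  have hh : ∀ k κ a b, ContDiffOn ℝ ∞ (fun ξ => leftIter G A k κ ξ a b) X := fun k κ a b =>
    (contDiffOn_leftIter (by simp) hX hG hdet hA k κ a b).of_le le_top
  obtain ⟨D, hD⟩ := eventually_norm_left_iterate_le (hX.prod isOpen_univ)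
    (p₀ := ((z, 0) : Coord d × Coord d)) (Set.mk_mem_prod hz (Set.mem_univ _))
    (contDiffOn_spray (by simp) hX hG hdet) (contDiffOn_contractForm hA)
    (T := fun k => contract (leftIter G A k)) (v := 1) (fun k => contDiffOn_contract (hh k))
    (fun x _ => by simp [contract, leftIter])
    (fun k x hx => (contract_leftD G A _ x).trans
      (congrArg (· + _) (fderiv_contract_spray hX (hh k) hx).symm))
  exact eventually_contract_le_half (norm_nonneg _) hD

lemma eventually_rightIter_le {z : Coord d} (hz : z ∈ X) :
    ∀ᶠ p in nhds ((z, 0) : Coord d × Coord d), ∀ k,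
      ‖contract (rightIter G A k) p‖ ≤ ‖(1 : Matrix ι ι ℝ)‖ * (k.factorial : ℝ) * (1 / 2) ^ k := by
  have hh : ∀ k κ a b, ContDiffOn ℝ ∞ (fun ξ => rightIter G A k κ ξ a b) X := fun k κ a b =>
    (contDiffOn_rightIter (by simp) hX hG hdet hA k κ a b).of_le le_top
  obtain ⟨D, hD⟩ := eventually_norm_right_iterate_le (hX.prod isOpen_univ)
    (p₀ := ((z, 0) : Coord d × Coord d)) (Set.mk_mem_prod hz (Set.mem_univ _))
    (contDiffOn_spray (by simp) hX hG hdet) (contDiffOn_contractForm hA)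
    (T := fun k => contract (rightIter G A k)) (v := 1) (fun k => contDiffOn_contract (hh k))
    (fun x _ => by simp [contract, rightIter])
    (fun k x hx => (contract_rightD G A _ x).trans
      (congrArg (· - _) (fderiv_contract_spray hX (hh k) hx).symm))
  exact eventually_contract_le_half (norm_nonneg _) hD

end Convergence

/-! ### Convergence for nearby end points -/

section Nearby

variable {d : ℕ} {X : Set (Coord d)} {G : Coord d → Matrix (Fin d) (Fin d) ℝ}
  {C : (Coord d × Coord d) × ℝ → Coord d}

lemma isGeodesic_const {z : Coord d} (hz : z ∈ X) : IsGeodesic G X 0 1 z z fun _ => z := by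
  have hv : ∀ s, velocity (fun _ => z) 0 1 s = 0 := fun s => by simp [velocity]
  refine ⟨fun _ _ => hz, rfl, rfl, differentiableOn_const _, fun s hs ρ => ?_⟩
  simp only [hv]
  simpa using hasDerivWithinAt_const s (Set.Icc (0 : ℝ) 1) (0 : ℝ)

/-- Geodesics between nearby points stay close to the zero section of the phase space. -/
lemma IsGeodesicMap.eventually_phase (hC : IsGeodesicMap G X C) (hX : IsOpen X) {z : Coord d}
    (hz : z ∈ X) {P : Coord d × Coord d → Prop}
    (hP : ∀ᶠ p in nhds ((z, 0) : Coord d × Coord d), P p) :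
    ∀ᶠ q in nhds ((z, z) : Coord d × Coord d), ∀ s ∈ Set.Icc (0 : ℝ) 1,
      P (C (q, s), flowVelocity X C (q, s)) := by
  have hq : ((z, z) : Coord d × Coord d) ∈ X ×ˢ X := ⟨hz, hz⟩
  have hev : ∀ᶠ q in nhds ((z, z) : Coord d × Coord d), ∀ s ∈ Set.Icc (0 : ℝ) 1,
      s ∈ Set.Icc (0 : ℝ) 1 → P (C (q, s), flowVelocity X C (q, s)) := by
    -- Compactness of the time interval makes the neighbourhood of `(z, z)` independent of `s`.
    refine isCompact_Icc.eventually_forall_of_forall_eventually fun s hs => ?_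
    have hcw : ContinuousWithinAt (fun Q => (C Q, flowVelocity X C Q)) (flowDomain X) ((z, z), s) :=
      (hC.contDiffOn.continuousOn.prodMk (hC.contDiffOn_flowVelocity hX).continuousOn) _ ⟨hq, hs⟩
    -- By uniqueness the geodesic from `z` to itself is constant, so its lift is the point `(z, 0)`.
    have heq := hC.unique _ hq _ (isGeodesic_const hz)
    have hval : (C ((z, z), s), flowVelocity X C ((z, z), s)) = (z, 0) := by
      rw [← hC.velocity_eq hq hs, ← velocity_congr heq hs]
      refine Prod.ext (heq hs).symm ?_
      simp [velocity]
    rw [ContinuousWithinAt, hval] at hcw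
    have h1 := eventually_nhdsWithin_iff.1 (hcw.eventually hP)
    have h2 : ∀ᶠ Q : (Coord d × Coord d) × ℝ in nhds ((z, z), s), Q.1 ∈ X ×ˢ X :=
      continuousAt_fst.eventually_mem ((hX.prod hX).mem_nhds hq)
    filter_upwards [h1, h2] with Q hQ hQX hQs
    exact hQ ⟨hQX, hQs⟩
  filter_upwards [hev] with q hq s hs
  exact hq s hs hs

variable {ι : Type*} [Fintype ι] [DecidableEq ι] {A : Fin d → Coord d → Matrix ι ι ℝ}

attribute [local instance] Matrix.linftyOpNormedRing Matrix.linftyOpNormedAlgebra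

/-- For analytic data both expansions converge for nearby points. -/
theorem IsGeodesicMap.eventually_hasSum (hC : IsGeodesicMap G X C) (hX : IsOpen X)
    (hG : ∀ μ ν, ContDiffOn ℝ ω (fun ξ => G ξ μ ν) X) (hpos : ∀ ξ ∈ X, (G ξ).PosDef)
    (hA : ∀ μ a b, ContDiffOn ℝ ω (fun ξ => A μ ξ a b) X) {z : Coord d} (hz : z ∈ X) :
    ∀ᶠ q in nhds ((z, z) : Coord d × Coord d),
      HasSum (fun k => rightTaylorTerm G X A k q.1 q.2) (orderedExp G X A q.1 q.2) ∧
      HasSum (fun k => leftTaylorTerm G X A k q.1 q.2) (orderedExp G X A q.1 q.2) := by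
  have hdet : ∀ ξ ∈ X, (G ξ).det ≠ 0 := fun ξ hξ => (hpos ξ hξ).det_pos.ne'
  have hG' : ∀ μ ν, ContDiffOn ℝ ∞ (fun ξ => G ξ μ ν) X := fun μ ν => (hG μ ν).of_le le_top
  have hA' : ∀ μ a b, ContDiffOn ℝ ∞ (fun ξ => A μ ξ a b) X := fun μ a b => (hA μ a b).of_le le_top
  have hM : ∀ᶠ p in nhds ((z, 0) : Coord d × Coord d), ‖contractForm A p‖ < 1 := by
    have hc : ContinuousAt (contractForm A) (z, 0) :=
      (contDiffOn_contractForm hA').continuousOn.continuousAt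
        ((hX.prod isOpen_univ).mem_nhds ⟨hz, trivial⟩)
    refine hc.norm.eventually_lt_const ?_
    simp [contractForm]
  have hgood := hC.eventually_phase hX hz
    ((eventually_rightIter_le hX hG hdet hA hz).and
      ((eventually_leftIter_le hX hG hdet hA hz).and hM))
  have hXq : ∀ᶠ q in nhds ((z, z) : Coord d × Coord d), q ∈ X ×ˢ X :=
    (hX.prod hX).mem_nhds ⟨hz, hz⟩
  filter_upwards [hgood, hXq] with q hq hqX
  obtain ⟨x, y⟩ := q
  have hx : x ∈ X := hqX.1
  have hy : y ∈ X := hqX.2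
  have hphase : ∀ s ∈ Set.Icc (0 : ℝ) 1, phase (geodesic G X x y) 0 1 s =
      (C ((x, y), s), flowVelocity X C ((x, y), s)) := fun s hs => by
    rw [phase, hC.eqOn_geodesic hx hy hs, hC.velocity_geodesic hx hy hs]
  have hrem := fun N => hC.norm_remainder_le (A := A) hX hG' hpos hA' hx hy N (M := 1)
    (B := ‖(1 : Matrix ι ι ℝ)‖ * ((N + 1).factorial : ℝ) * (1 / 2) ^ (N + 1))
    (fun s hs => by rw [hphase s hs]; exact (hq s hs).2.2.le)
    (fun s hs => by rw [hphase s hs]; exact (hq s hs).1 (N + 1))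
    (fun s hs => by rw [hphase s hs]; exact (hq s hs).2.1 (N + 1))
  -- The factorials leave only `N + 1`, and `(N + 1) / 2 ^ (N + 1)` tends to zero.
  have e : ∀ N : ℕ, ‖(1 : Matrix ι ι ℝ)‖ * ((N + 1).factorial : ℝ) * (1 / 2) ^ (N + 1) *
      (‖(1 : Matrix ι ι ℝ)‖ * Real.exp 1) / (N.factorial : ℝ) =
      ‖(1 : Matrix ι ι ℝ)‖ * (‖(1 : Matrix ι ι ℝ)‖ * Real.exp 1) *
        (((N + 1 : ℕ) : ℝ) * (1 / 2) ^ (N + 1)) := fun N => by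
    rw [Nat.factorial_succ]
    push_cast
    field_simp
  simp only [e] at hrem
  have hterm : ∀ (k : ℕ) (c : ℝ), |c| = 1 → ∀ P : Matrix ι ι ℝ,
      ‖P‖ ≤ ‖(1 : Matrix ι ι ℝ)‖ * (k.factorial : ℝ) * (1 / 2) ^ k →
      ‖(c / (k.factorial : ℝ)) • P‖ ≤ ‖(1 : Matrix ι ι ℝ)‖ * (1 / 2) ^ k := by
    intro k c hc P hP
    rw [norm_smul, Real.norm_eq_abs, abs_div, hc, Nat.abs_cast, one_div, inv_mul_le_iff₀ (by positivity)]
    refine hP.trans_eq ?_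
    ring
  have h0 : (0 : ℝ) ∈ Set.Icc (0 : ℝ) 1 := Set.left_mem_Icc.2 zero_le_one
  have h1 : (1 : ℝ) ∈ Set.Icc (0 : ℝ) 1 := Set.right_mem_Icc.2 zero_le_one
  refine ⟨hasSum_of_remainder (c := ‖(1 : Matrix ι ι ℝ)‖) (fun k => ?_) fun N => (hrem N).1,
    hasSum_of_remainder (c := ‖(1 : Matrix ι ι ℝ)‖) (fun k => ?_) fun N => (hrem N).2⟩
  · rw [hC.rightTaylorTerm_eq hX hG' hpos hx hy, hphase 0 h0]
    exact hterm k 1 abs_one _ ((hq 0 h0).1 k)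
  · rw [hC.leftTaylorTerm_eq hX hG' hpos hx hy, hphase 1 h1]
    exact hterm k _ (by simp) _ ((hq 1 h1).2.1 k)

end Nearby

/-! ### Metric and connection components in a chart -/

section Chart

variable {d : ℕ} {M : Type*} [TopologicalSpace M] [ChartedSpace (Coord d) M]
  [IsManifold (𝓡 d) ∞ M] {φ : OpenPartialHomeomorph M (Coord d)}

omit [IsManifold (𝓡 d) ∞ M] in
theorem mdifferentiable_of_mem_maximalAtlas (hφ : φ ∈ IsManifold.maximalAtlas (𝓡 d) ∞ M) :
    φ.MDifferentiable (𝓡 d) (𝓡 d) :=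
  ⟨(contMDiffOn_of_mem_maximalAtlas hφ).mdifferentiableOn (by simp),
    (contMDiffOn_symm_of_mem_maximalAtlas hφ).mdifferentiableOn (by simp)⟩

/-- The coordinate vector fields are smooth. -/
theorem contMDiffOn_coordVector (hφ : φ ∈ IsManifold.maximalAtlas (𝓡 d) ∞ M) (μ : Fin d) :
    ContMDiffOn (𝓡 d) (𝓡 d).tangent ∞
      (fun ξ => (⟨φ.symm ξ, coordVector φ μ ξ⟩ : TangentBundle (𝓡 d) M)) φ.target := by
  have hsymm := contMDiffOn_symm_of_mem_maximalAtlas hφ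
  have hT := hsymm.contMDiffOn_tangentMapWithin (m := ∞) (by simp)
    φ.open_target.uniqueMDiffOn
  have hconst : ContMDiffOn (𝓡 d) (𝓡 d).tangent ∞
      (fun ξ : Coord d => (⟨ξ, (EuclideanSpace.single μ (1 : ℝ) : Coord d)⟩ :
        TangentBundle (𝓡 d) (Coord d))) φ.target :=
    contMDiffOn_vectorSpace_iff_contDiffOn
      (V := fun _ => (EuclideanSpace.single μ (1 : ℝ) : Coord d)).2 contDiffOn_const
  refine (hT.comp hconst fun ξ hξ => hξ).congr fun ξ hξ => ?_
  simp only [Function.comp_apply, tangentMapWithin, coordVector]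
  rw [mfderivWithin_of_isOpen φ.open_target hξ]

theorem contDiffOn_metricComponents
    (g : Bundle.ContMDiffRiemannianMetric (𝓡 d) ∞ (Coord d) (fun p : M => TangentSpace (𝓡 d) p))
    (hφ : φ ∈ IsManifold.maximalAtlas (𝓡 d) ∞ M) (μ ν : Fin d) :
    ContDiffOn ℝ ∞ (fun ξ => metricComponents g φ ξ μ ν) φ.target := by
  rw [← contMDiffOn_iff_contDiffOn]
  intro ξ hξ
  have hb := (contMDiffOn_symm_of_mem_maximalAtlas hφ) ξ hξ
  have : ContMDiffWithinAt (𝓡 d) ((𝓡 d).prod 𝓘(ℝ)) ∞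
      (fun η => Bundle.TotalSpace.mk' ℝ (E := Bundle.Trivial M ℝ) (φ.symm η)
        (g.inner (φ.symm η) (coordVector φ μ η) (coordVector φ ν η))) φ.target ξ := by
    apply ContMDiffWithinAt.clm_bundle_apply₂ (F₁ := Coord d) (F₂ := Coord d)
    · exact ContMDiffAt.comp_contMDiffWithinAt ξ g.contMDiff.contMDiffAt hb
    · exact contMDiffOn_coordVector hφ μ ξ hξ
    · exact contMDiffOn_coordVector hφ ν ξ hξ
  simp only [Bundle.contMDiffWithinAt_totalSpace] at this
  exact this.2

/-- The quadratic form at `v` is `g(w, w)` with `w = v^μ ∂_μ`, and `w ≠ 0` because the inverse chart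
has an injective differential. -/
theorem posDef_metricComponents
    (g : Bundle.ContMDiffRiemannianMetric (𝓡 d) ∞ (Coord d) (fun p : M => TangentSpace (𝓡 d) p))
    (hφ : φ ∈ IsManifold.maximalAtlas (𝓡 d) ∞ M) {ξ : Coord d} (hξ : ξ ∈ φ.target) :
    (metricComponents g φ ξ).PosDef := by
  refine Matrix.PosDef.of_dotProduct_mulVec_pos ?_ fun v hv => ?_
  · rw [Matrix.isHermitian_iff_isSymm]
    ext μ ν
    exact g.symm _ _ _
  · have hw : mfderiv (𝓡 d) (𝓡 d) φ.symm ξ (WithLp.toLp 2 v : Coord d) =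
        ∑ μ, v μ • coordVector φ μ ξ := by
      have hv' : (WithLp.toLp 2 v : Coord d) =
          ∑ μ, v μ • (EuclideanSpace.single μ (1 : ℝ) : Coord d) := by
        ext i
        simp [Finset.sum_apply, Pi.single_apply]
      have h := congrArg (mfderiv (𝓡 d) (𝓡 d) φ.symm ξ) hv'
      refine h.trans ((map_sum (mfderiv (𝓡 d) (𝓡 d) φ.symm ξ) _ _).trans
        (Finset.sum_congr rfl fun μ _ => map_smul (mfderiv (𝓡 d) (𝓡 d) φ.symm ξ) _ _))
    have hw0 : mfderiv (𝓡 d) (𝓡 d) φ.symm ξ (WithLp.toLp 2 v : Coord d) ≠ 0 := by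
      intro h0
      apply hv
      have hinj := (mdifferentiable_of_mem_maximalAtlas hφ).symm.mfderiv_injective
        (x := ξ) (by simpa using hξ)
      have := hinj (h0.trans (map_zero (mfderiv (𝓡 d) (𝓡 d) φ.symm ξ)).symm)
      funext i
      exact congrArg (fun w : Coord d => w i) this
    have hpos := g.pos (φ.symm ξ) _ hw0
    rw [hw] at hpos
    refine lt_of_lt_of_eq hpos ?_
    simp only [dotProduct, Matrix.mulVec, metricComponents, Matrix.of_apply, map_sum, map_smul,
      _root_.sum_apply, _root_.smul_apply, smul_eq_mul, star_trivial,
      Finset.mul_sum]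
    rw [Finset.sum_comm]
    refine Finset.sum_congr rfl fun μ _ => Finset.sum_congr rfl fun ν _ => ?_
    ring

end Chart

theorem contDiffOn_connMatrix {d : ℕ} {𝔤 : Type*} [LieRing 𝔤] [LieAlgebra ℝ 𝔤] {ι : Type*}
    [Fintype ι] (t : Module.Basis ι ℝ 𝔤) {B : Fin d → Coord d → 𝔤} {X : Set (Coord d)}
    {n : WithTop ℕ∞} (hB : ∀ μ a, ContDiffOn ℝ n (fun ξ => t.repr (B μ ξ) a) X)
    (μ : Fin d) (a b : ι) : ContDiffOn ℝ n (fun ξ => connMatrix t B μ ξ a b) X := by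
  simp only [connMatrix, Matrix.of_apply]
  exact ContDiffOn.sum fun c _ => contDiffOn_const.mul (hB μ c)

end YangMills

end

/-! ### Transfer from coordinates to the manifold -/

theorem lemma1
    -- a smooth Riemannian manifold, and a chart
    {d : ℕ} {M : Type*} [TopologicalSpace M] [ChartedSpace (YangMills.Coord d) M]
    [IsManifold (𝓡 d) ∞ M]
    (g : Bundle.ContMDiffRiemannianMetric (𝓡 d) ∞ (YangMills.Coord d)
      (fun p : M => TangentSpace (𝓡 d) p))
    (φ : OpenPartialHomeomorph M (YangMills.Coord d))
    (hφ : φ ∈ IsManifold.maximalAtlas (𝓡 d) ∞ M)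
    -- the convex domain `U`, its image `X` in the coordinates, the metric components `G`
    (U : Set M) (hU : IsOpen U) (hUφ : U ⊆ φ.source)
    (X : Set (YangMills.Coord d)) (hX : X = φ '' U)
    (G : YangMills.Coord d → Matrix (Fin d) (Fin d) ℝ)
    (hG : G = YangMills.metricComponents g φ)
    (hconv : YangMills.IsConvexDomain G X)
    -- the compact semisimple Lie algebra with its generators
    {𝔤 : Type*} [LieRing 𝔤] [LieAlgebra ℝ 𝔤] {ι : Type*} [Fintype ι] [DecidableEq ι]
    (t : Module.Basis ι ℝ 𝔤)
    (ht : ∀ a b, killingForm ℝ 𝔤 (t a) (t b) = if a = b then -2 else 0)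
    -- the smooth connection components, and their matrices in the adjoint representation
    (B : Fin d → M → 𝔤)
    (hB : ∀ μ a, ContMDiffOn (𝓡 d) 𝓘(ℝ, ℝ) ∞ (fun p => t.repr (B μ p) a) U)
    (A : Fin d → YangMills.Coord d → Matrix ι ι ℝ)
    (hA : A = YangMills.connMatrix t (fun μ ξ => B μ (φ.symm ξ))) :
    -- `Φ(x, y)` is the sum of the series of iterated integrals along any parameterization of
    -- the geodesic from `y` to `x`
    (∀ x ∈ U, ∀ y ∈ U, ∀ (u₀ u₁ : ℝ) (γ : ℝ → YangMills.Coord d), u₀ < u₁ →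
      YangMills.IsGeodesic G X u₀ u₁ (φ x) (φ y) γ → ∀ a b,
        HasSum (fun k => YangMills.orderedTerm A u₀ u₁ γ k a b)
          (YangMills.orderedExp G X A (φ x) (φ y) a b)) ∧
    -- the two Taylor expansions, to every order, locally uniformly in both points
    (∀ K ⊆ U, IsCompact K → ∀ N : ℕ, ∃ C : ℝ, ∀ x ∈ K, ∀ y ∈ K, ∀ a b,
      |YangMills.orderedExp G X A (φ x) (φ y) a b -
          ∑ k ∈ Finset.range (N + 1), YangMills.rightTaylorTerm G X A k (φ x) (φ y) a b|
        ≤ C * Real.sqrt (YangMills.synge G X (φ x) (φ y)) ^ (N + 1) ∧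
      |YangMills.orderedExp G X A (φ x) (φ y) a b -
          ∑ k ∈ Finset.range (N + 1), YangMills.leftTaylorTerm G X A k (φ x) (φ y) a b|
        ≤ C * Real.sqrt (YangMills.synge G X (φ x) (φ y)) ^ (N + 1)) ∧
    -- for real-analytic data both series converge to `Φ(x, y)` for nearby points
    ((∀ μ ν, AnalyticOnNhd ℝ (fun ξ => G ξ μ ν) X) →
      (∀ μ a, AnalyticOnNhd ℝ (fun ξ => t.repr (B μ (φ.symm ξ)) a) X) →
      ∀ z ∈ U, ∃ W ⊆ U, IsOpen W ∧ z ∈ W ∧ ∀ x ∈ W, ∀ y ∈ W, ∀ a b,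
        HasSum (fun k => YangMills.rightTaylorTerm G X A k (φ x) (φ y) a b)
          (YangMills.orderedExp G X A (φ x) (φ y) a b) ∧
        HasSum (fun k => YangMills.leftTaylorTerm G X A k (φ x) (φ y) a b)
          (YangMills.orderedExp G X A (φ x) (φ y) a b)) := by
  have hXt : X ⊆ φ.target := by
    rw [hX]
    rintro _ ⟨p, hp, rfl⟩
    exact φ.map_source (hUφ hp)
  have hmem : ∀ p ∈ U, φ p ∈ X := fun p hp => hX ▸ Set.mem_image_of_mem φ hp
  have hsymm : Set.MapsTo φ.symm X U := by
    rw [hX]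
    rintro _ ⟨p, hp, rfl⟩
    rwa [φ.left_inv (hUφ hp)]
  have hXo := hconv.1
  obtain ⟨C, hC⟩ := hconv.exists_isGeodesicMap
  have hGs : ∀ μ ν, ContDiffOn ℝ ∞ (fun ξ => G ξ μ ν) X := fun μ ν => by
    rw [hG]
    exact (YangMills.contDiffOn_metricComponents g hφ μ ν).mono hXt
  have hpos : ∀ ξ ∈ X, (G ξ).PosDef := fun ξ hξ => by
    rw [hG]
    exact YangMills.posDef_metricComponents g hφ (hXt hξ)
  have hAs : ∀ μ a b, ContDiffOn ℝ ∞ (fun ξ => A μ ξ a b) X := by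
    rw [hA]
    refine YangMills.contDiffOn_connMatrix t fun μ a => ?_
    exact contMDiffOn_iff_contDiffOn.1
      ((hB μ a).comp ((contMDiffOn_symm_of_mem_maximalAtlas hφ).mono hXt) hsymm)
  refine ⟨fun x hx y hy u₀ u₁ γ hu hγ a b =>
    hC.hasSum_orderedTerm hAs (hmem x hx) (hmem y hy) hu hγ a b, ?_, ?_⟩
  · intro K hKU hK N
    obtain ⟨c, hc⟩ := hC.exists_expansion_bound hXo hGs hpos hAs
      (hK.image_of_continuousOn (φ.continuousOn.mono (hKU.trans hUφ)))
      (Set.image_subset_iff.2 fun p hp => hmem p (hKU hp)) N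
    refine ⟨c, fun x hx y hy a b => ?_⟩
    obtain ⟨h₁, h₂⟩ := hc _ (Set.mem_image_of_mem φ hx) _ (Set.mem_image_of_mem φ hy)
    constructor
    · refine le_trans ?_ ((YangMills.abs_entry_le _ a b).trans h₁)
      rw [Matrix.sub_apply, Matrix.sum_apply]
    · refine le_trans ?_ ((YangMills.abs_entry_le _ a b).trans h₂)
      rw [Matrix.sub_apply, Matrix.sum_apply]
  · intro hGa hBa z hz
    have hAa : ∀ μ a b, ContDiffOn ℝ ω (fun ξ => A μ ξ a b) X := by
      rw [hA]
      exact YangMills.contDiffOn_connMatrix t fun μ a =>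
        (hBa μ a).contDiffOn hXo.uniqueDiffOn
    have hev := hC.eventually_hasSum hXo
      (fun μ ν => (hGa μ ν).contDiffOn hXo.uniqueDiffOn) hpos hAa (hmem z hz)
    -- A neighbourhood of a diagonal point contains a square, which supplies one set for both end
    -- points.
    rw [nhds_prod_eq, Filter.eventually_prod_self_iff'] at hev
    obtain ⟨s, hs, hsum⟩ := hev
    obtain ⟨V, hVs, hVo, hzV⟩ := mem_nhds_iff.1 hs
    refine ⟨U ∩ (φ.source ∩ φ ⁻¹' V), Set.inter_subset_left,
      hU.inter (φ.isOpen_inter_preimage hVo), ⟨hz, hUφ hz, hzV⟩, fun x hx y hy a b => ?_⟩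
    obtain ⟨h₁, h₂⟩ := hsum _ (hVs hx.2.2) _ (hVs hy.2.2)
    exact ⟨h₁.mapL (YangMills.entryL a b), h₂.mapL (YangMills.entryL a b)⟩
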